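/- **Setting.** Let $\Omega\subset\mathbb R^3$ be a bounded open set, $T>0$, $Y=[-\tfrac12,\tfrac12)^3$ the unit period cube, $|\cdot|$ the Euclidean norm, and $H_r(x)$ the ball of radius $r$ centred at $x$. Let $\lambda,\gamma,\delta,\rho_f,\rho_m,C_f,C_m,C_i$ be positive constants. Let $\chi_f$ be the indicator function of a measurable subset of $Y$ (the inclusion phase), extended $Y$-periodically to $\mathbb R^3$, let $\chi_m=1-\chi_f$, and put $$\rho(y)=\chi_f(y)\rho_f+\chi_m(y)\rho_m,$$ $$\alpha(y,\hat y)=C_f\chi_f(y)\chi_f(\hat y)+C_m\chi_m(y)\chi_m(\hat y)+C_i\big(\chi_f(y)\chi_m(\hat y)+\chi_m(y)\chi_f(\hat y)\big).$$ Let $\tfrac32<p<\infty$, and let $L^p_{\rm per}(Y;C(\overline\Omega)^3)$ be the space of $Y$-periodic functions $y\mapsto\psi(\cdot,y)$ that are (strongly) measurable with values in the Banach space $C(\overline\Omega)^3$ and $L^p$-integrable on $Y$. Let $u_0,v_0\in L^p_{\rm per}(Y;C(\overline\Omega)^3)$ and $b\in C([0,T];L^p_{\rm per}(Y;C(\overline\Omega)^3))$.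 For $\varepsilon=1/n$, $n=1,2,\dots$, let $u^\varepsilon\in C^2([0,T];L^p(\Omega)^3)$ be the solution of the peridynamic initial value problem $$\begin{aligned}\rho\big(\tfrac x\varepsilon\big)\partial_t^2u^\varepsilon(x,t)=&\int_{H_\gamma(x)\cap\Omega}\lambda\frac{(\hat x-x)\otimes(\hat x-x)}{|\hat x-x|^3}\big(u^\varepsilon(\hat x,t)-u^\varepsilon(x,t)\big)\,d\hat x\\&+\int_{H_{\varepsilon\delta}(x)\cap\Omega}\frac1{\varepsilon^2}\,\alpha\big(\tfrac x\varepsilon,\tfrac{\hat x}\varepsilon\big)\frac{(\hat x-x)\otimes(\hat x-x)}{|\hat x-x|^3}\big(u^\varepsilon(\hat x,t)-u^\varepsilon(x,t)\big)\,d\hat x+b\big(x,\tfrac x\varepsilon,t\big)\end{aligned}$$ (for every $t\in[0,T]$ and a.e. $x\in\Omega$), with $u^\varepsilon(x,0)=u_0(x,\tfrac x\varepsilon)$ and $\partial_tu^\varepsilon(x,0)=v_0(x,\tfrac x\varepsilon)$. A bounded sequence $(v^\varepsilon)$ in $L^p(\Omega\times(0,T))^3$ *two-scale converges* to $v\in L^p(\Omega\times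 Y\times(0,T))^3$ if, as $\varepsilon\to0$, $$\int_{\Omega\times(0,T)}v^\varepsilon(x,t)\cdot\psi\big(x,\tfrac x\varepsilon,t\big)\,dx\,dt\to\int_{\Omega\times Y\times(0,T)}v(x,y,t)\cdot\psi(x,y,t)\,dx\,dy\,dt$$ for all smooth $\psi:\mathbb R^3\times\mathbb R^3\times\mathbb R\to\mathbb R^3$ that are $Y$-periodic in $y$ and vanish for $(x,t)$ outside a compact set. **Theorem 3.10.** The sequence $(u^\varepsilon)$ is bounded in $L^p(\Omega\times(0,T))^3$ and two-scale converges to a limit $u$. The $Y$-periodic extension of $u$ in $y$, also denoted by $u$, belongs to $C^2([0,T];L^p_{\rm per}(Y;C(\overline\Omega)^3))$ and is the unique solution in that space of $$\begin{aligned}\rho(y)\partial_t^2u(x,y,t)=&\int_{H_\gamma(x)\cap\Omega}\lambda\frac{(\hat x-x)\otimes(\hat x-x)}{|\hat x-x|^3}\Big(\int_Yu(\hat x,y',t)\,dy'-u(x,y,t)\Big)d\hat x\\&+\int_{H_\delta(y)}\alpha(y,\hat y)\frac{(\hat y-y)\otimes(\hat y-y)}{|\hat y-y|^3}\big(u(x,\hat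 y,t)-u(x,y,t)\big)\,d\hat y+b(x,y,t)\end{aligned}$$ (for every $t\in[0,T]$, a.e. $y\in\mathbb R^3$ and all $x\in\overline\Omega$) with the initial conditions $u(x,y,0)=u_0(x,y)$ and $\partial_tu(x,y,0)=v_0(x,y)$. -/

import Mathlib

open MeasureTheory Filter Topology Set
open scoped ENNReal NNReal

noncomputable section

/-- Physical space `ℝ³` with its Euclidean norm and Lebesgue measure. -/
abbrev E3 : Type := EuclideanSpace ℝ (Fin 3)

/-- The unit period cube `Y`, centred at the origin. -/
def unitCell : Set E3 := {y | ∀ i, y i ∈ Ico (-(1 / 2) : ℝ) (1 / 2)}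

/-- The representative in `Y` of a point of `ℝ³` modulo `ℤ³`. -/
def wrap (y : E3) : E3 := WithLp.toLp 2 fun i => y i - (⌊y i + 1 / 2⌋ : ℝ)

/-- The matrix `ξ ⊗ ξ / |ξ|³` applied to the vector `η`. -/
def bond (ξ η : E3) : E3 := (inner ℝ ξ η / ‖ξ‖ ^ 3) • ξ

/-- The value at `x` of a continuous vector field on `K` (zero for `x` outside `K`). -/
def valueAt {K : Set E3} (f : C(K, E3)) (x : E3) : E3 :=
  open Classical in if h : x ∈ K then f ⟨x, h⟩ else 0

/-- A two-phase periodic peridynamic composite occupying a bounded open set `Ω`.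
The set `inclusion ∩ Y` is the inclusion phase inside the period cube. -/
structure Composite where
  Ω : Set E3
  isOpen_Ω : IsOpen Ω
  isBounded_Ω : Bornology.IsBounded Ω
  inclusion : Set E3
  measurableSet_inclusion : MeasurableSet inclusion
  /-- strength of the long-range bonds -/
  lam : ℝ
  lam_pos : 0 < lam
  /-- horizon of the long-range bonds -/
  γ : ℝ
  γ_pos : 0 < γ
  /-- horizon, in the rescaled variable, of the short-range bonds -/
  δ : ℝ
  δ_pos : 0 < δ
  /-- mass density of the inclusion -/
  ρf : ℝ
  ρf_pos : 0 < ρf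
  /-- mass density of the matrix -/
  ρm : ℝ
  ρm_pos : 0 < ρm
  /-- bond strength inside the inclusion phase -/
  Cf : ℝ
  Cf_pos : 0 < Cf
  /-- bond strength inside the matrix phase -/
  Cm : ℝ
  Cm_pos : 0 < Cm
  /-- bond strength across an interface -/
  Ci : ℝ
  Ci_pos : 0 < Ci

namespace Composite

variable (M : Composite)

instance : CompactSpace (closure M.Ω) :=
  isCompact_iff_compactSpace.mp M.isBounded_Ω.isCompact_closure

/-- Indicator function of the inclusion phase, extended periodically from `Y` to `ℝ³`. -/
def χf (y : E3) : ℝ := M.inclusion.indicator (fun _ => 1) (wrap y)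

/-- Indicator function of the matrix phase. -/
def χm (y : E3) : ℝ := 1 - M.χf y

/-- The periodic mass density. -/
def ρ (y : E3) : ℝ := M.χf y * M.ρf + M.χm y * M.ρm

/-- The periodic bond strength. -/
def α (y z : E3) : ℝ :=
  M.Cf * (M.χf y * M.χf z) + M.Cm * (M.χm y * M.χm z)
    + M.Ci * (M.χf y * M.χm z + M.χm y * M.χf z)

/-- The Lebesgue space `L^p(Ω)³`. -/
abbrev LpField (p : ℝ≥0∞) : Type := Lp E3 p (volume.restrict M.Ω)

/-- The Bochner space `L^p_per(Y; C(Ω̄)³)`. A `Y`-periodic function is given by its restriction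
to `Y`; the periodic function itself is recovered by `perExt`. -/
abbrev PerField (p : ℝ≥0∞) : Type := Lp C(closure M.Ω, E3) p (volume.restrict unitCell)

variable {M}

/-- The `Y`-periodic extension of `w` to `y ∈ ℝ³`, as a function `(x, y) ↦ w(x, y)`. -/
def perExt {p : ℝ≥0∞} (w : M.PerField p) (x y : E3) : E3 := valueAt (w (wrap y)) x

/-- `u ∈ C²([0,T]; L^p(Ω)³)` solves the peridynamic initial value problem at scale `ε` with
initial data `u₀(x, x/ε)`, `v₀(x, x/ε)` and body force `b(x, x/ε, t)`. -/
structure IsSolution {p : ℝ≥0∞} [Fact (1 ≤ p)] (T ε : ℝ) (u₀ v₀ : M.PerField p)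
    (b : ℝ → M.PerField p) (u : ℝ → M.LpField p) : Prop where
  contDiffOn : ContDiffOn ℝ 2 u (Icc 0 T)
  equation : ∀ t ∈ Icc 0 T, ∀ᵐ x ∂(volume.restrict M.Ω),
    M.ρ (ε⁻¹ • x) • (iteratedDerivWithin 2 u (Icc 0 T) t) x =
      (∫ z in Metric.ball x M.γ ∩ M.Ω, M.lam • bond (z - x) (u t z - u t x))
      + (∫ z in Metric.ball x (ε * M.δ) ∩ M.Ω,
          ((1 / ε ^ 2) * M.α (ε⁻¹ • x) (ε⁻¹ • z)) • bond (z - x) (u t z - u t x))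
      + perExt (b t) x (ε⁻¹ • x)
  initial : ∀ᵐ x ∂(volume.restrict M.Ω), u 0 x = perExt u₀ x (ε⁻¹ • x)
  initial_deriv : ∀ᵐ x ∂(volume.restrict M.Ω),
    (derivWithin u (Icc 0 T) 0) x = perExt v₀ x (ε⁻¹ • x)

/-- `u ∈ C²([0,T]; L^p_per(Y; C(Ω̄)³))` solves the two-scale peridynamic initial value problem. -/
structure IsTwoScaleSolution {p : ℝ≥0∞} [Fact (1 ≤ p)] (T : ℝ) (u₀ v₀ : M.PerField p)
    (b : ℝ → M.PerField p) (u : ℝ → M.PerField p) : Prop where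
  contDiffOn : ContDiffOn ℝ 2 u (Icc 0 T)
  equation : ∀ t ∈ Icc 0 T, ∀ᵐ y : E3, ∀ x ∈ closure M.Ω,
    M.ρ y • perExt (iteratedDerivWithin 2 u (Icc 0 T) t) x y =
      (∫ z in Metric.ball x M.γ ∩ M.Ω,
        M.lam • bond (z - x) ((∫ y' in unitCell, perExt (u t) z y') - perExt (u t) x y))
      + (∫ z in Metric.ball y M.δ,
          M.α y z • bond (z - y) (perExt (u t) x z - perExt (u t) x y))
      + perExt (b t) x y
  initial : u 0 = u₀
  initial_deriv : derivWithin u (Icc 0 T) 0 = v₀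

/-- Smooth vector-valued test functions `ψ(x, y, t)`, `Y`-periodic in `y` and vanishing for
`(x, t)` outside a compact set. (Only their values for `t ∈ (0, T)` will matter.) -/
structure IsTestFunction (ψ : E3 → E3 → ℝ → E3) : Prop where
  smooth : ContDiff ℝ ((⊤ : ℕ∞) : WithTop ℕ∞) fun q : E3 × E3 × ℝ => ψ q.1 q.2.1 q.2.2
  periodic : ∀ x y t i, ψ x (y + EuclideanSpace.single i 1) t = ψ x y t
  compact_support : ∃ K : Set (E3 × ℝ), IsCompact K ∧ ∀ x y t, (x, t) ∉ K → ψ x y t = 0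

/-- Two-scale convergence along the scales `ε n → 0` of a bounded sequence in
`L^p(Ω × (0,T))³`, seen as `L^p((0,T); L^p(Ω)³)`, to a limit in
`L^p((0,T); L^p_per(Y; C(Ω̄)³))`, a subspace of `L^p(Ω × Y × (0,T))³`.
Integrals over the product domains are written as iterated integrals. -/
structure TwoScaleConverges {p : ℝ≥0∞} [Fact (1 ≤ p)] (T : ℝ) (ε : ℕ → ℝ)
    (v : ℕ → ℝ → M.LpField p) (w : ℝ → M.PerField p) : Prop where
  memLp : ∀ n, MemLp (v n) p (volume.restrict (Ioo 0 T))
  bounded : ∃ C : ℝ≥0, ∀ n, eLpNorm (v n) p (volume.restrict (Ioo 0 T)) ≤ C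
  memLp_limit : MemLp w p (volume.restrict (Ioo 0 T))
  tendsto : ∀ ψ, IsTestFunction ψ →
    Tendsto
      (fun n => ∫ t in Ioo 0 T, ∫ x in M.Ω, inner ℝ (v n t x) (ψ x ((ε n)⁻¹ • x) t))
      atTop
      (𝓝 (∫ t in Ioo 0 T, ∫ y in unitCell, ∫ x in M.Ω, inner ℝ (perExt (w t) x y) (ψ x y t)))

end Composite

end

noncomputable section

/-! Both problems are linear equations `u'' = A u + F` in a Banach space with a bounded generator
`A`, and homogenization is a numerical-analysis style argument: consistency plus stability gives
convergence.

Boundedness. The kernel ξ ⊗ ξ / |ξ|³ has norm at most |ξ|⁻¹, integrable near 0 in dimension three,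
so Schur's test (`SchurKernel.toCLM`) bounds all nonlocal operators. In the short-range term put `z
= x + εξ`: the volume gives ε³, the kernel ε⁻¹, and the factor ε⁻² cancels both
(`nonlocalAt_eq_setIntegral`). Hence the generators `A_ε` on L^p(Ω) are bounded uniformly in ε.
Existence for the limit problem follows from Duhamel's formula, uniqueness from Gronwall.

Consistency. Let `E_ε w = w(x, x/ε)`, an operator from L^p_per(Y; C(Ω̄)) to L^p(Ω) bounded uniformly
in ε. The claim is that `A_ε E_ε w - E_ε A w → 0` in L^p(Ω) for each w (`tendsto_consistencyError`).
By equiboundedness and density it suffices to take `w = 1_A(y) φ(x)`. In the long-range term the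
oscillating indicator converges weakly to its cell average, which produces the mean over Y in the
limit equation. In the short-range term the fast variable is reproduced exactly, and the only error
is `φ(x + εξ) - φ(x)`.

Convergence. The orbit `u([0,T])` is compact, so the consistency error is uniformly small along it,
and Gronwall's inequality gives `u^ε(t) - E_ε u(t) → 0` in L^p(Ω) (`tendsto_sub_trace`). Two-scale
convergence is thereby reduced to that of the traces `E_ε u(t)`, which is the weak convergence of
oscillating functions again (`tendsto_integral_inner_trace`), followed by dominated convergence in
time. -/

/-! ### The period cube -/

/-- The lattice `ℤ³`. -/
def intLattice : AddSubgroup E3 :=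
  AddMonoidHom.range (G := Fin 3 → ℤ)
    { toFun := fun k => WithLp.toLp 2 fun i => (k i : ℝ)
      map_zero' := by ext i; simp
      map_add' := fun a b => by ext i; simp }

theorem mem_intLattice {v : E3} : v ∈ intLattice ↔ ∃ k : Fin 3 → ℤ, ∀ i, v i = k i := by
  constructor
  · rintro ⟨k, rfl⟩
    exact ⟨k, fun i => rfl⟩
  · rintro ⟨k, hk⟩
    exact ⟨k, by ext i; simp [hk]⟩

instance : Countable intLattice := (Set.countable_range _).to_subtype

theorem wrap_apply (y : E3) (i : Fin 3) : wrap y i = y i - ⌊y i + 1 / 2⌋ := rfl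

theorem wrap_mem (y : E3) : wrap y ∈ unitCell := fun i => by
  have h1 := Int.floor_le (y i + 1 / 2)
  have h2 := Int.lt_floor_add_one (y i + 1 / 2)
  rw [wrap_apply]
  constructor <;> linarith

theorem wrap_of_mem {y : E3} (hy : y ∈ unitCell) : wrap y = y := by
  ext i
  have h : ⌊y i + 1 / 2⌋ = 0 := Int.floor_eq_iff.2 ⟨by have := (hy i).1; push_cast; linarith,
    by have := (hy i).2; push_cast; linarith⟩
  rw [wrap_apply, h]; simp

theorem wrap_add_of_mem_intLattice (y : E3) {v : E3} (hv : v ∈ intLattice) :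
    wrap (y + v) = wrap y := by
  obtain ⟨k, hk⟩ := mem_intLattice.1 hv
  ext i
  have : ⌊y i + v i + 1 / 2⌋ = ⌊y i + 1 / 2⌋ + k i := by
    rw [hk, add_right_comm, Int.floor_add_intCast]
  rw [wrap_apply, wrap_apply, PiLp.add_apply, this, hk]
  push_cast; ring

theorem wrap_sub_self_mem (y : E3) : wrap y - y ∈ intLattice :=
  mem_intLattice.2 ⟨fun i => -⌊y i + 1 / 2⌋, fun i => by
    rw [PiLp.sub_apply, wrap_apply]; push_cast; ring⟩

theorem wrap_wrap_add (y s : E3) : wrap (wrap y + s) = wrap (y + s) := by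
  have : wrap y + s = (y + s) + (wrap y - y) := by abel
  rw [this, wrap_add_of_mem_intLattice _ (wrap_sub_self_mem y)]

theorem wrap_wrap (y : E3) : wrap (wrap y) = wrap y := wrap_of_mem (wrap_mem y)

theorem measurable_wrap : Measurable wrap := by
  unfold wrap
  refine (WithLp.measurable_toLp 2 _).comp (measurable_pi_lambda _ fun i => ?_)
  have h : Measurable fun y : E3 => y i := (EuclideanSpace.proj (𝕜 := ℝ) i).continuous.measurable
  exact h.sub (measurable_from_top.comp (Int.measurable_floor.comp (h.add_const _)))

theorem measurableSet_unitCell : MeasurableSet unitCell := by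
  have : unitCell = ⋂ i : Fin 3, (fun y : E3 => y i) ⁻¹' Ico (-(1 / 2) : ℝ) (1 / 2) := by
    ext y; simp [unitCell]
  rw [this]
  exact MeasurableSet.iInter fun i =>
    (EuclideanSpace.proj (𝕜 := ℝ) i).continuous.measurable measurableSet_Ico

theorem volume_unitCell : volume unitCell = 1 := by
  have h := (PiLp.volume_preserving_ofLp (Fin 3)).measure_preimage_equiv
    (f := (MeasurableEquiv.toLp 2 (Fin 3 → ℝ)).symm) (Set.pi univ fun _ => Ico (-(1 / 2) : ℝ) (1 / 2))
  have h2 : unitCell = (MeasurableEquiv.toLp 2 (Fin 3 → ℝ)).symm ⁻¹'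
      (Set.pi univ fun _ => Ico (-(1 / 2) : ℝ) (1 / 2)) := by
    ext y; simp only [mem_preimage, mem_univ_pi]; rfl
  rw [h2, h, Real.volume_pi_Ico]
  norm_num

instance : IsProbabilityMeasure (volume.restrict unitCell) :=
  ⟨by rw [Measure.restrict_apply_univ, volume_unitCell]⟩

theorem ae_unitCell_of_ae {P : E3 → Prop} (h : ∀ᵐ y : E3, P y) :
    ∀ᵐ y ∂(volume.restrict unitCell), P y ∧ y ∈ unitCell :=
  (ae_restrict_of_ae h).and (ae_restrict_mem measurableSet_unitCell)

theorem norm_le_one_of_mem_unitCell {y : E3} (hy : y ∈ unitCell) : ‖y‖ ≤ 1 := by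
  rw [EuclideanSpace.norm_eq, Real.sqrt_le_one, Fin.sum_univ_three]
  have h : ∀ i, ‖y i‖ ^ 2 ≤ 1 / 4 := fun i => by
    have := hy i
    rw [Real.norm_eq_abs, sq_abs]
    nlinarith [this.1, this.2]
  linarith [h 0, h 1, h 2]

/-- Every translate of the period cube is a fundamental domain of `ℤ³`. -/
theorem isAddFundamentalDomain_preimage_add (s : E3) :
    IsAddFundamentalDomain intLattice ((fun y => y + s) ⁻¹' unitCell) (volume : Measure E3) := by
  refine IsAddFundamentalDomain.mk'
    ((measurable_add_const s) measurableSet_unitCell).nullMeasurableSet fun x => ?_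
  refine ⟨⟨wrap (x + s) - (x + s), wrap_sub_self_mem _⟩, ?_, fun v hv => ?_⟩
  · change (wrap (x + s) - (x + s)) + x + s ∈ unitCell
    have : (wrap (x + s) - (x + s)) + x + s = wrap (x + s) := by abel
    rw [this]; exact wrap_mem _
  · have hv' : (v : E3) + x + s ∈ unitCell := hv
    have h := wrap_of_mem hv'
    have h2 : (v : E3) + x + s = x + s + v := by abel
    rw [h2, wrap_add_of_mem_intLattice _ v.2] at h
    apply Subtype.ext
    change (v : E3) = wrap (x + s) - (x + s)
    rw [h]; abel

theorem isAddFundamentalDomain_unitCell :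
    IsAddFundamentalDomain intLattice unitCell (volume : Measure E3) := by
  simpa using isAddFundamentalDomain_preimage_add 0

/-- The cell Y and its translate Y - s are both fundamental domains of the lattice, and a periodic
function has the same integral over each. -/
theorem setLIntegral_unitCell_wrap_add (g : E3 → ℝ≥0∞) (s : E3) :
    ∫⁻ y in unitCell, g (wrap (y + s)) = ∫⁻ y in unitCell, g y := by
  have h1 : ∫⁻ y in unitCell, g y = ∫⁻ y in unitCell, g (wrap y) :=
    setLIntegral_congr_fun measurableSet_unitCell fun y hy => by rw [wrap_of_mem hy]
  have h2 := (isAddFundamentalDomain_preimage_add s).setLIntegral_eq isAddFundamentalDomain_unitCell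
    (fun y => g (wrap (y + s))) fun v x => by
      change g (wrap ((v : E3) + x + s)) = _
      rw [show (v : E3) + x + s = x + s + v by abel, wrap_add_of_mem_intLattice _ v.2]
  rw [h1, ← h2]
  exact (measurePreserving_add_right volume s).setLIntegral_comp_preimage_emb
    (measurableEmbedding_addRight s) (fun y => g (wrap y)) unitCell

theorem setIntegral_unitCell_wrap_add {F : Type*} [NormedAddCommGroup F] [NormedSpace ℝ F]
    (g : E3 → F) (s : E3) :
    ∫ y in unitCell, g (wrap (y + s)) = ∫ y in unitCell, g y := by
  have h1 : ∫ y in unitCell, g y = ∫ y in unitCell, g (wrap y) :=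
    setIntegral_congr_fun measurableSet_unitCell fun y hy => by simp only [wrap_of_mem hy]
  have h2 := (isAddFundamentalDomain_preimage_add s).setIntegral_eq isAddFundamentalDomain_unitCell
    (f := fun y => g (wrap (y + s))) fun v x => by
      change g (wrap ((v : E3) + x + s)) = _
      rw [show (v : E3) + x + s = x + s + v by abel, wrap_add_of_mem_intLattice _ v.2]
  rw [h1, ← h2]
  exact (measurePreserving_add_right volume s).setIntegral_preimage_emb
    (measurableEmbedding_addRight s) (fun y => g (wrap y)) unitCell

/-- The preimage of a null subset of Y is lattice-invariant and meets a fundamental domain in a null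
set, hence is null. This carries statements for almost every y in the cell to almost every y in
space. -/
theorem quasiMeasurePreserving_wrap :
    Measure.QuasiMeasurePreserving wrap volume (volume.restrict unitCell) := by
  refine ⟨measurable_wrap, Measure.AbsolutelyContinuous.mk fun s hs h0 => ?_⟩
  rw [Measure.map_apply measurable_wrap hs]
  refine isAddFundamentalDomain_unitCell.measure_zero_of_invariant _ (fun v => ?_) ?_
  · ext x
    rw [mem_vadd_set_iff_neg_vadd_mem, mem_preimage, mem_preimage]
    change wrap (((-v : intLattice) : E3) + x) ∈ s ↔ _
    rw [add_comm, wrap_add_of_mem_intLattice _ (-v).2]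
  · rw [Measure.restrict_apply hs] at h0
    refine measure_mono_null (fun x hx => ?_) h0
    have := hx.1
    rw [mem_preimage, wrap_of_mem hx.2] at this
    exact ⟨this, hx.2⟩

/-- Integrals of rescaled periodic functions over balls are controlled by the integral over the
period cube. -/
theorem setLIntegral_ball_wrap_le {g : E3 → ℝ≥0∞} (hg : Measurable g) (r : ℝ) :
    ∫⁻ y in Metric.ball 0 r, g (wrap y) ≤
      volume (Metric.ball (0 : E3) (r + 1)) * ∫⁻ y in unitCell, g y := by
  have hG : Measurable fun y => g (wrap y) := hg.comp measurable_wrap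
  -- Averaging replaces counting cells: Y has volume 1 and lies in the unit ball, so for y in the
  -- ball of radius r the indicator of the ball of radius r + 1 equals 1 at every `y - s`. After
  -- Fubini and a translation the s-integral is a cell integral independent of y.
  have key : ∀ y : E3, (Metric.ball 0 r).indicator (fun y => g (wrap y)) y ≤
      ∫⁻ s in unitCell, (Metric.ball 0 (r + 1)).indicator 1 (y - s) * g (wrap y) := fun y => by
    by_cases hy : y ∈ Metric.ball (0 : E3) r
    · rw [indicator_of_mem hy]
      have : ∫⁻ s in unitCell, (Metric.ball (0 : E3) (r + 1)).indicator (1 : E3 → ℝ≥0∞) (y - s)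
          * g (wrap y) = ∫⁻ s in unitCell, g (wrap y) :=
        setLIntegral_congr_fun measurableSet_unitCell fun s hs => by
          have : y - s ∈ Metric.ball (0 : E3) (r + 1) := by
            rw [mem_ball_zero_iff] at hy ⊢
            linarith [norm_sub_le y s, norm_le_one_of_mem_unitCell hs]
          simp [indicator_of_mem this]
      rw [this, lintegral_const, Measure.restrict_apply_univ, volume_unitCell, mul_one]
    · rw [indicator_of_notMem hy]; exact zero_le
  have hI : Measurable ((Metric.ball (0 : E3) (r + 1)).indicator (1 : E3 → ℝ≥0∞)) :=
    measurable_one.indicator Metric.isOpen_ball.measurableSet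
  calc ∫⁻ y in Metric.ball 0 r, g (wrap y)
      = ∫⁻ y, (Metric.ball 0 r).indicator (fun y => g (wrap y)) y :=
        (lintegral_indicator Metric.isOpen_ball.measurableSet _).symm
    _ ≤ ∫⁻ y, ∫⁻ s in unitCell, (Metric.ball 0 (r + 1)).indicator 1 (y - s) * g (wrap y) :=
        lintegral_mono key
    _ = ∫⁻ s in unitCell, ∫⁻ y, (Metric.ball 0 (r + 1)).indicator 1 (y - s) * g (wrap y) :=
        lintegral_lintegral_swap (Measurable.aemeasurable (by
          apply Measurable.mul
          · exact hI.comp (measurable_fst.sub measurable_snd)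
          · exact hG.comp measurable_fst))
    _ = ∫⁻ s in unitCell, ∫⁻ y, (Metric.ball 0 (r + 1)).indicator 1 y * g (wrap (y + s)) := by
        refine lintegral_congr fun s => ?_
        rw [← lintegral_add_right_eq_self (fun y => (Metric.ball (0 : E3) (r + 1)).indicator
          (1 : E3 → ℝ≥0∞) (y - s) * g (wrap y)) s]
        simp
    _ = ∫⁻ y, ∫⁻ s in unitCell, (Metric.ball 0 (r + 1)).indicator 1 y * g (wrap (y + s)) := by
        refine (lintegral_lintegral_swap (Measurable.aemeasurable ?_)).symm
        apply Measurable.mul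
        · exact hI.comp measurable_fst
        · exact hG.comp (measurable_fst.add measurable_snd)
    _ = ∫⁻ y, (Metric.ball 0 (r + 1)).indicator 1 y * ∫⁻ s in unitCell, g (wrap (y + s)) := by
        refine lintegral_congr fun y => lintegral_const_mul _ (hG.comp (measurable_const.add measurable_id))
    _ = volume (Metric.ball (0 : E3) (r + 1)) * ∫⁻ y in unitCell, g y := by
        have h : ∀ y, ∫⁻ s in unitCell, g (wrap (y + s)) = ∫⁻ y in unitCell, g y := fun y => by
          simp_rw [add_comm y, setLIntegral_unitCell_wrap_add g y]
        simp_rw [h]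
        rw [lintegral_mul_const _ hI, lintegral_indicator_one Metric.isOpen_ball.measurableSet]

/-- A rescaled periodic function on a bounded set is controlled by its integral over the period
cube, uniformly in the scale. -/
theorem setLIntegral_wrap_smul_le {g : E3 → ℝ≥0∞} (hg : Measurable g) {s : Set E3} {R : ℝ}
    (hs : s ⊆ Metric.ball 0 R) {ε : ℝ} (hε : 0 < ε) (hε1 : ε ≤ 1) :
    ∫⁻ x in s, g (wrap (ε⁻¹ • x)) ≤
      volume (Metric.ball (0 : E3) (R + 1)) * ∫⁻ y in unitCell, g y := by
  have hG : Measurable fun y => g (wrap y) := hg.comp measurable_wrap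
  have hε3 : ENNReal.ofReal |(ε⁻¹ ^ Module.finrank ℝ E3)⁻¹| = ENNReal.ofReal (ε ^ 3) := by
    rw [finrank_euclideanSpace_fin, inv_pow, inv_inv, abs_of_pos (by positivity)]
  have hmap : ∫⁻ x in Metric.ball 0 R, g (wrap (ε⁻¹ • x)) =
      ENNReal.ofReal (ε ^ 3) * ∫⁻ y in Metric.ball 0 (ε⁻¹ * R), g (wrap y) := by
    have hpre : Metric.ball (0 : E3) R = (fun x => ε⁻¹ • x) ⁻¹' Metric.ball 0 (ε⁻¹ * R) := by
      ext x
      simp only [mem_preimage, mem_ball_zero_iff, norm_smul, norm_inv, Real.norm_eq_abs,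
        abs_of_pos hε]
      rw [mul_lt_mul_iff_right₀ (inv_pos.2 hε)]
    rw [hpre, ← setLIntegral_map Metric.isOpen_ball.measurableSet hG (measurable_const_smul _),
      Measure.map_addHaar_smul volume (inv_ne_zero hε.ne'), hε3, Measure.restrict_smul,
      lintegral_smul_measure, smul_eq_mul]
  calc ∫⁻ x in s, g (wrap (ε⁻¹ • x)) ≤ ∫⁻ x in Metric.ball 0 R, g (wrap (ε⁻¹ • x)) :=
        lintegral_mono_set hs
    _ ≤ ENNReal.ofReal (ε ^ 3) * (volume (Metric.ball (0 : E3) (ε⁻¹ * R + 1)) *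
          ∫⁻ y in unitCell, g y) := by
        rw [hmap]; gcongr; exact setLIntegral_ball_wrap_le hg _
    _ ≤ ENNReal.ofReal (ε ^ 3) * (volume (Metric.ball (0 : E3) (ε⁻¹ * (R + 1))) *
          ∫⁻ y in unitCell, g y) := by
        gcongr
        -- As ε ≤ 1, the margin 1 is at most ε⁻¹. The enlarged ball has ε⁻³ times the volume of the
        -- ball of radius R + 1, and this cancels the Jacobian ε³.
        have : 1 ≤ ε⁻¹ := (one_le_inv₀ hε).2 hε1
        rw [mul_add, mul_one]; gcongr
    _ = _ := by
        rw [Measure.addHaar_ball_mul_of_pos volume 0 (inv_pos.2 hε), finrank_euclideanSpace_fin,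
          ← mul_assoc, ← mul_assoc, ← ENNReal.ofReal_mul (by positivity), inv_pow,
          mul_inv_cancel₀ (by positivity), ENNReal.ofReal_one, one_mul]

/-! ### Integral operators between Lebesgue spaces of vector-valued functions -/

/-- The data of an integral operator `v ↦ ∫ Φ y ξ (v (σ y ξ)) dτ(ξ)` that is bounded on `L^p` by
Schur's test, with weight `weight` and constant `C`. -/
structure SchurKernel {X Y Ξ : Type*} [MeasurableSpace X] [MeasurableSpace Y] [MeasurableSpace Ξ]
    (μ : Measure X) (ν : Measure Y) (τ : Measure Ξ) (V V' : Type*)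
    [NormedAddCommGroup V] [NormedSpace ℝ V] [NormedAddCommGroup V'] [NormedSpace ℝ V'] where
  σ : Y → Ξ → X
  Φ : Y → Ξ → V →L[ℝ] V'
  weight : Y → Ξ → ℝ≥0∞
  C : ℝ≥0
  measurable_weight : Measurable (Function.uncurry weight)
  measurable_σ : Measurable (Function.uncurry σ)
  stronglyMeasurable : ∀ v : X → V, StronglyMeasurable v →
    StronglyMeasurable fun q : Y × Ξ => Φ q.1 q.2 (v (σ q.1 q.2))
  enorm_le : ∀ y ξ, ‖Φ y ξ‖ₑ ≤ weight y ξ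
  lintegral_weight_le : ∀ y, ∫⁻ ξ, weight y ξ ∂τ ≤ C
  lintegral_lintegral_le : ∀ g : X → ℝ≥0∞, Measurable g →
    ∫⁻ y, ∫⁻ ξ, weight y ξ * g (σ y ξ) ∂τ ∂ν ≤ C * ∫⁻ x, g x ∂μ

/-- Hölder's inequality between exponents 1 and q for the measure `m dτ`, whose total mass is at
most C. -/
theorem lintegral_mul_rpow_le {Ξ : Type*} [MeasurableSpace Ξ] (τ : Measure Ξ) {m g : Ξ → ℝ≥0∞}
    (hm : Measurable m) (hg : Measurable g) {C : ℝ≥0} (hC : ∫⁻ ξ, m ξ ∂τ ≤ C) {q : ℝ}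
    (hq : 1 ≤ q) :
    (∫⁻ ξ, m ξ * g ξ ∂τ) ^ q ≤ (C : ℝ≥0∞) ^ (q - 1) * ∫⁻ ξ, m ξ * g ξ ^ q ∂τ := by
  have hq0 : 0 < q := by linarith
  have h := eLpNorm'_le_eLpNorm'_mul_rpow_measure_univ (f := g) (μ := τ.withDensity m)
    zero_lt_one hq hg.aestronglyMeasurable
  simp only [eLpNorm', enorm_eq_self, ENNReal.rpow_one, div_one] at h
  rw [lintegral_withDensity_eq_lintegral_mul _ hm hg,
    lintegral_withDensity_eq_lintegral_mul _ hm (hg.pow_const q), withDensity_apply _ .univ,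
    setLIntegral_univ] at h
  simp only [Pi.mul_apply] at h
  have h2 := ENNReal.rpow_le_rpow h hq0.le
  rw [ENNReal.mul_rpow_of_nonneg _ _ hq0.le, ← ENNReal.rpow_mul, ← ENNReal.rpow_mul,
    one_div_mul_cancel hq0.ne', ENNReal.rpow_one, mul_comm,
    show (1 - 1 / q) * q = q - 1 by field_simp] at h2
  refine h2.trans ?_
  gcongr

namespace SchurKernel

variable {X Y Ξ : Type*} [MeasurableSpace X] [MeasurableSpace Y] [MeasurableSpace Ξ]
  {μ : Measure X} {ν : Measure Y} {τ : Measure Ξ} {V V' : Type*}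
  [NormedAddCommGroup V] [NormedSpace ℝ V] [NormedAddCommGroup V'] [NormedSpace ℝ V']
  (K : SchurKernel μ ν τ V V')

/-- The integral operator on functions. -/
def apply (v : X → V) (y : Y) : V' := ∫ ξ, K.Φ y ξ (v (K.σ y ξ)) ∂τ

theorem enorm_apply_le (v : X → V) (y : Y) :
    ‖K.apply v y‖ₑ ≤ ∫⁻ ξ, K.weight y ξ * ‖v (K.σ y ξ)‖ₑ ∂τ :=
  (enorm_integral_le_lintegral_enorm _).trans <| lintegral_mono fun ξ =>
    ((K.Φ y ξ).le_opENorm _).trans <| by gcongr; exact K.enorm_le y ξ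

theorem integrable_of_lintegral_lt_top {v : X → V} (hv : StronglyMeasurable v) {y : Y}
    (hy : ∫⁻ ξ, K.weight y ξ * ‖v (K.σ y ξ)‖ₑ ∂τ < ∞) :
    Integrable (fun ξ => K.Φ y ξ (v (K.σ y ξ))) τ :=
  ⟨((K.stronglyMeasurable v hv).comp_measurable measurable_prodMk_left).aestronglyMeasurable,
    lt_of_le_of_lt (lintegral_mono fun ξ => ((K.Φ y ξ).le_opENorm _).trans <| by
      gcongr; exact K.enorm_le y ξ) hy⟩

theorem apply_smul (c : ℝ) (v : X → V) : K.apply (c • v) = c • K.apply v := by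
  ext y
  simp only [apply, Pi.smul_apply, map_smul, integral_smul]

variable [SFinite τ]

/-- Schur's test: the row bound contributes `C ^ (q - 1)` through `lintegral_mul_rpow_le`, and the
column bound applied to `g ^ q` contributes the last factor C. -/
theorem lintegral_rpow_le {g : X → ℝ≥0∞} (hg : Measurable g) {q : ℝ} (hq : 1 ≤ q) :
    ∫⁻ y, (∫⁻ ξ, K.weight y ξ * g (K.σ y ξ) ∂τ) ^ q ∂ν ≤ (K.C : ℝ≥0∞) ^ q * ∫⁻ x, g x ^ q ∂μ := by
  have hmeas : Measurable (Function.uncurry fun y ξ => K.weight y ξ * g (K.σ y ξ) ^ q) :=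
    K.measurable_weight.mul ((hg.comp K.measurable_σ).pow_const q)
  calc ∫⁻ y, (∫⁻ ξ, K.weight y ξ * g (K.σ y ξ) ∂τ) ^ q ∂ν
      ≤ ∫⁻ y, (K.C : ℝ≥0∞) ^ (q - 1) * ∫⁻ ξ, K.weight y ξ * g (K.σ y ξ) ^ q ∂τ ∂ν :=
        lintegral_mono fun y => lintegral_mul_rpow_le τ
          (K.measurable_weight.of_uncurry_left) (hg.comp (K.measurable_σ.of_uncurry_left))
          (K.lintegral_weight_le y) hq
    _ = (K.C : ℝ≥0∞) ^ (q - 1) * ∫⁻ y, ∫⁻ ξ, K.weight y ξ * g (K.σ y ξ) ^ q ∂τ ∂ν :=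
        lintegral_const_mul _ hmeas.lintegral_prod_right'
    _ ≤ (K.C : ℝ≥0∞) ^ (q - 1) * (K.C * ∫⁻ x, g x ^ q ∂μ) := by
        gcongr; exact K.lintegral_lintegral_le _ (hg.pow_const q)
    _ = _ := by
        rw [← mul_assoc]
        congr 1
        nth_rewrite 2 [← ENNReal.rpow_one (K.C : ℝ≥0∞)]
        rw [← ENNReal.rpow_add_of_nonneg _ _ (by linarith) zero_le_one]
        congr 1; ring

theorem stronglyMeasurable_apply {v : X → V} (hv : StronglyMeasurable v) :
    StronglyMeasurable (K.apply v) :=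
  (K.stronglyMeasurable v hv).integral_prod_right'

variable {p : ℝ≥0∞}

theorem eLpNorm_apply_le {v : X → V} (hv : StronglyMeasurable v) (hp : 1 ≤ p) (hp' : p ≠ ∞) :
    eLpNorm (K.apply v) p ν ≤ K.C * eLpNorm v p μ := by
  have hp0 : p ≠ 0 := (zero_lt_one.trans_le hp).ne'
  have hq : 1 ≤ p.toReal := by simpa using ENNReal.toReal_mono hp' hp
  have hq0 : 0 < p.toReal := by linarith
  rw [eLpNorm_eq_lintegral_rpow_enorm_toReal hp0 hp', eLpNorm_eq_lintegral_rpow_enorm_toReal hp0 hp',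
    one_div]
  calc (∫⁻ y, ‖K.apply v y‖ₑ ^ p.toReal ∂ν) ^ p.toReal⁻¹
      ≤ ((K.C : ℝ≥0∞) ^ p.toReal * ∫⁻ x, ‖v x‖ₑ ^ p.toReal ∂μ) ^ p.toReal⁻¹ := by
        gcongr
        refine le_trans (lintegral_mono fun y => ?_) (K.lintegral_rpow_le hv.enorm hq)
        gcongr
        exact K.enorm_apply_le v y
    _ = _ := by
        rw [ENNReal.mul_rpow_of_nonneg _ _ (by positivity), ← ENNReal.rpow_mul,
          mul_inv_cancel₀ hq0.ne', ENNReal.rpow_one]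

theorem ae_lintegral_lt_top {v : X → V} (hv : StronglyMeasurable v) (hp : 1 ≤ p) (hp' : p ≠ ∞)
    (hvp : MemLp v p μ) : ∀ᵐ y ∂ν, ∫⁻ ξ, K.weight y ξ * ‖v (K.σ y ξ)‖ₑ ∂τ < ∞ := by
  have hp0 : p ≠ 0 := (zero_lt_one.trans_le hp).ne'
  have hq : 1 ≤ p.toReal := by simpa using ENNReal.toReal_mono hp' hp
  have h := K.lintegral_rpow_le hv.enorm hq
  have hfin : ∫⁻ x, ‖v x‖ₑ ^ p.toReal ∂μ < ∞ :=
    lintegral_rpow_enorm_lt_top_of_eLpNorm_lt_top hp0 hp' hvp.2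
  have hlt := h.trans_lt (ENNReal.mul_lt_top
    (ENNReal.rpow_lt_top_of_nonneg (by linarith) ENNReal.coe_ne_top) hfin)
  have hmeas : Measurable fun y => ∫⁻ ξ, K.weight y ξ * ‖v (K.σ y ξ)‖ₑ ∂τ :=
    (K.measurable_weight.mul (hv.enorm.comp K.measurable_σ)).lintegral_prod_right'
  filter_upwards [ae_lt_top (hmeas.pow_const _) hlt.ne] with y hy
  rwa [ENNReal.rpow_lt_top_iff_of_pos (by linarith)] at hy

theorem ae_integrable {v : X → V} (hv : StronglyMeasurable v) (hp : 1 ≤ p) (hp' : p ≠ ∞)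
    (hvp : MemLp v p μ) : ∀ᵐ y ∂ν, Integrable (fun ξ => K.Φ y ξ (v (K.σ y ξ))) τ := by
  filter_upwards [K.ae_lintegral_lt_top hv hp hp' hvp] with y hy
  exact K.integrable_of_lintegral_lt_top hv hy

theorem memLp_apply {v : X → V} (hv : StronglyMeasurable v) (hp : 1 ≤ p) (hp' : p ≠ ∞)
    (hvp : MemLp v p μ) : MemLp (K.apply v) p ν :=
  ⟨(K.stronglyMeasurable_apply hv).aestronglyMeasurable,
    (K.eLpNorm_apply_le hv hp hp').trans_lt (ENNReal.mul_lt_top ENNReal.coe_lt_top hvp.2)⟩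

theorem apply_add_ae {v w : X → V} (hv : StronglyMeasurable v) (hw : StronglyMeasurable w)
    (hp : 1 ≤ p) (hp' : p ≠ ∞) (hvp : MemLp v p μ) (hwp : MemLp w p μ) :
    K.apply (v + w) =ᵐ[ν] K.apply v + K.apply w := by
  filter_upwards [K.ae_integrable hv hp hp' hvp, K.ae_integrable hw hp hp' hwp] with y h1 h2
  simp only [apply, Pi.add_apply, map_add]
  exact integral_add h1 h2

/-- The column bound for `‖v - w‖` shows that the weighted difference vanishes almost everywhere. No
assumption is needed on how σ transports null sets, which matters where the weight is zero. -/
theorem apply_congr {v w : X → V} (hv : StronglyMeasurable v) (hw : StronglyMeasurable w)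
    (h : v =ᵐ[μ] w) : K.apply v =ᵐ[ν] K.apply w := by
  have hg : Measurable fun x => ‖v x - w x‖ₑ := (hv.sub hw).enorm
  have h0 : ∫⁻ x, ‖v x - w x‖ₑ ∂μ = 0 := by
    rw [lintegral_eq_zero_iff hg]
    filter_upwards [h] with x hx
    simp [hx]
  have h1 : ∫⁻ y, ∫⁻ ξ, K.weight y ξ * ‖v (K.σ y ξ) - w (K.σ y ξ)‖ₑ ∂τ ∂ν = 0 :=
    le_antisymm ((K.lintegral_lintegral_le _ hg).trans_eq (by rw [h0, mul_zero])) zero_le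
  have hm : Measurable (Function.uncurry fun y ξ =>
      K.weight y ξ * ‖v (K.σ y ξ) - w (K.σ y ξ)‖ₑ) :=
    K.measurable_weight.mul (hg.comp K.measurable_σ)
  filter_upwards [(lintegral_eq_zero_iff hm.lintegral_prod_right).1 h1] with y hy
  have hy' := (lintegral_eq_zero_iff hm.of_uncurry_left).1 hy
  refine integral_congr_ae ?_
  filter_upwards [hy'] with ξ hξ
  have h2 : ‖K.Φ y ξ (v (K.σ y ξ) - w (K.σ y ξ))‖ₑ ≤ 0 :=
    (((K.Φ y ξ).le_opENorm _).trans (by gcongr; exact K.enorm_le y ξ)).trans_eq hξ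
  rw [nonpos_iff_eq_zero, enorm_eq_zero, map_sub, sub_eq_zero] at h2
  exact h2

variable (p) [Fact (1 ≤ p)]

/-- The integral operator as a bounded operator between Lebesgue spaces. -/
def toCLM (hp : p ≠ ∞) : Lp V p μ →L[ℝ] Lp V' p ν :=
  LinearMap.mkContinuous
    { toFun := fun v => (K.memLp_apply (Lp.stronglyMeasurable v) Fact.out hp (Lp.memLp v)).toLp _
      map_add' := fun v w => by
        rw [← MemLp.toLp_add]
        refine MemLp.toLp_congr _ _ ((K.apply_congr (Lp.stronglyMeasurable _)
          ((Lp.stronglyMeasurable v).add (Lp.stronglyMeasurable w)) (Lp.coeFn_add v w)).trans ?_)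
        exact K.apply_add_ae (Lp.stronglyMeasurable v) (Lp.stronglyMeasurable w) Fact.out hp
          (Lp.memLp v) (Lp.memLp w)
      map_smul' := fun c v => by
        rw [RingHom.id_apply, ← MemLp.toLp_const_smul]
        refine MemLp.toLp_congr _ _ ((K.apply_congr (Lp.stronglyMeasurable _)
          ((Lp.stronglyMeasurable v).const_smul c) (Lp.coeFn_smul c v)).trans ?_)
        rw [K.apply_smul] }
    K.C fun v => by
      change ‖(K.memLp_apply (Lp.stronglyMeasurable v) Fact.out hp (Lp.memLp v)).toLp _‖ ≤ _
      rw [Lp.norm_toLp, Lp.norm_def, ← ENNReal.coe_toReal K.C, ← ENNReal.toReal_mul]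
      exact ENNReal.toReal_mono (ENNReal.mul_ne_top ENNReal.coe_ne_top (Lp.memLp v).2.ne)
        (K.eLpNorm_apply_le (Lp.stronglyMeasurable v) Fact.out hp)

theorem norm_toCLM_le (hp : p ≠ ∞) : ‖K.toCLM p hp‖ ≤ K.C :=
  LinearMap.mkContinuous_norm_le _ K.C.2 _

theorem coeFn_toCLM (hp : p ≠ ∞) (v : Lp V p μ) : K.toCLM p hp v =ᵐ[ν] K.apply v :=
  (K.memLp_apply (Lp.stronglyMeasurable v) Fact.out hp (Lp.memLp v)).coeFn_toLp

theorem coeFn_toCLM_of_ae_eq (hp : p ≠ ∞) {v : Lp V p μ} {w : X → V} (hw : StronglyMeasurable w)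
    (h : v =ᵐ[μ] w) : K.toCLM p hp v =ᵐ[ν] K.apply w :=
  (K.coeFn_toCLM p hp v).trans (K.apply_congr (Lp.stronglyMeasurable v) hw h)

end SchurKernel

/-! ### The bond kernel -/

/-- `ξ ⊗ ξ / |ξ|³` as a linear map. -/
def bondCLM (ξ : E3) : E3 →L[ℝ] E3 := (‖ξ‖ ^ 3)⁻¹ • (innerSL ℝ ξ).smulRight ξ

theorem bondCLM_apply (ξ η : E3) : bondCLM ξ η = bond ξ η := by
  simp [bondCLM, bond, smul_smul, div_eq_inv_mul]

theorem norm_bondCLM_le (ξ : E3) : ‖bondCLM ξ‖ ≤ ‖ξ‖⁻¹ := by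
  rw [bondCLM, norm_smul, ContinuousLinearMap.norm_smulRight_apply, innerSL_apply_norm, norm_inv,
    norm_pow, norm_norm]
  rcases eq_or_ne ‖ξ‖ 0 with h | h
  · simp [h]
  · exact le_of_eq (by field_simp)

theorem stronglyMeasurable_bondCLM : StronglyMeasurable bondCLM := by
  have h1 : Measurable fun ξ : E3 => (‖ξ‖ ^ 3)⁻¹ := (measurable_norm.pow_const 3).inv
  have h2 : Continuous fun ξ : E3 => (innerSL ℝ ξ).smulRight ξ := by fun_prop
  exact h1.stronglyMeasurable.smul h2.stronglyMeasurable

/-- The bond kernel, cut off at the horizon `r`. -/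
def horizonKernel (r : ℝ) : E3 → E3 →L[ℝ] E3 := (Metric.ball 0 r).indicator bondCLM

theorem stronglyMeasurable_horizonKernel (r : ℝ) : StronglyMeasurable (horizonKernel r) :=
  stronglyMeasurable_bondCLM.indicator Metric.isOpen_ball.measurableSet

/-- The singularity is at most |ξ|⁻¹ and 1 < 3. All operator bounds rest on this. -/
theorem integrable_horizonKernel (r : ℝ) : Integrable (horizonKernel r) := by
  have hb : MeasurableSet (Metric.ball (0 : E3) r) := Metric.isOpen_ball.measurableSet
  have h : IntegrableOn bondCLM (Metric.ball 0 r) volume := by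
    refine integrableOn_ball_of_norm_le_rpow (C := 1) (α := 1) (by simp) (by simp)
      (Eventually.of_forall fun ξ => ?_) stronglyMeasurable_bondCLM.aestronglyMeasurable
    rw [one_mul, Real.rpow_neg_one]
    exact norm_bondCLM_le ξ
  rw [← integrable_norm_iff (stronglyMeasurable_horizonKernel r).aestronglyMeasurable]
  have h2 : (fun ξ => ‖horizonKernel r ξ‖) =
      (Metric.ball (0 : E3) r).indicator fun ξ => ‖bondCLM ξ‖ :=
    funext fun ξ => norm_indicator_eq_indicator_norm _ _
  rw [h2]
  exact IntegrableOn.integrable_indicator (Integrable.norm h) hb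

/-- The total mass of the truncated bond kernel. -/
def horizonMass (r : ℝ) : ℝ≥0 := (∫⁻ ξ, ‖horizonKernel r ξ‖ₑ).toNNReal

theorem lintegral_enorm_horizonKernel (r : ℝ) :
    ∫⁻ ξ, ‖horizonKernel r ξ‖ₑ = horizonMass r :=
  (ENNReal.coe_toNNReal (integrable_horizonKernel r).2.ne).symm

theorem integrable_horizonKernel_apply (r : ℝ) {v : E3 → E3} (hv : StronglyMeasurable v) {C : ℝ}
    (hC : ∀ x, ‖v x‖ ≤ C) : Integrable fun ξ => horizonKernel r ξ (v ξ) := by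
  refine Integrable.mono' ((integrable_horizonKernel r).norm.mul_const C)
    (((ContinuousLinearMap.apply ℝ E3).flip.aestronglyMeasurable_comp₂
      (stronglyMeasurable_horizonKernel r).aestronglyMeasurable hv.aestronglyMeasurable))
    (Eventually.of_forall fun ξ => ((horizonKernel r ξ).le_opNorm _).trans ?_)
  gcongr
  exact hC ξ

theorem norm_integral_horizonKernel_le (r : ℝ) {v : E3 → E3} {C : ℝ} (hC : ∀ x, ‖v x‖ ≤ C) :
    ‖∫ ξ, horizonKernel r ξ (v ξ)‖ ≤ (∫ ξ, ‖horizonKernel r ξ‖) * C := by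
  rw [← integral_mul_const]
  refine norm_integral_le_of_norm_le ((integrable_horizonKernel r).norm.mul_const C)
    (Eventually.of_forall fun ξ => ((horizonKernel r ξ).le_opNorm _).trans ?_)
  gcongr
  exact hC ξ

/-! ### Translations and oscillations -/

section

variable {F : Type*} [NormedAddCommGroup F]

/-- Translations form a continuous family of measure-preserving maps, and composition with such a
family is continuous in L¹. -/
theorem tendsto_integral_norm_translate_sub {f : E3 → F} (hf : Integrable f) :
    Tendsto (fun h : E3 => ∫ z, ‖f (z + h) - f z‖) (𝓝 0) (𝓝 0) := by
  have hg : Tendsto (fun h : E3 => (⟨fun z => z + h, by fun_prop⟩ : C(E3, E3))) (𝓝 0)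
      (𝓝 ⟨fun z => z + 0, by fun_prop⟩) := by
    have : Continuous fun h : E3 => (⟨fun z => z + h, by fun_prop⟩ : C(E3, E3)) :=
      ContinuousMap.continuous_of_continuous_uncurry _ (by
        change Continuous fun q : E3 × E3 => q.2 + q.1
        fun_prop)
    exact this.tendsto 0
  have hmp : ∀ h : E3, MeasurePreserving (fun z : E3 => z + h) volume volume := fun h =>
    measurePreserving_add_right volume h
  have key := (tendsto_const_nhds (x := hf.toL1 f)).compMeasurePreservingLp hg
    (fun h => hmp h) (hmp 0) ENNReal.one_ne_top
  have key2 := (key.sub_const (hf.toL1 f)).norm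
  have hN : ∀ h : E3, ‖Lp.compMeasurePreserving (fun z : E3 => z + h) (hmp h) (hf.toL1 f)
      - hf.toL1 f‖ = ∫ z, ‖f (z + h) - f z‖ := fun h => by
    rw [L1.norm_eq_integral_norm]
    refine integral_congr_ae ?_
    have h1 := (hmp h).quasiMeasurePreserving.ae_eq_comp hf.coeFn_toL1
    filter_upwards [Lp.coeFn_sub (Lp.compMeasurePreserving (fun z : E3 => z + h) (hmp h)
      (hf.toL1 f)) (hf.toL1 f), Lp.coeFn_compMeasurePreserving (hf.toL1 f) (hmp h),
      hf.coeFn_toL1, h1] with z h2 h3 h4 h5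
    rw [h2, Pi.sub_apply, h3, h4, h5]
    rfl
  have h0 : ‖Lp.compMeasurePreserving (fun z : E3 => z + 0) (hmp 0) (hf.toL1 f)
      - hf.toL1 f‖ = 0 := by rw [hN 0]; simp
  refine (key2.congr hN).trans ?_
  exact le_of_eq (congrArg 𝓝 h0)


end

theorem norm_smul_le_of_norm_le_one {F : Type*} [NormedAddCommGroup F] [NormedSpace ℝ F]
    {a : ℝ} (ha : ‖a‖ ≤ 1) (v : F) : ‖a • v‖ ≤ ‖v‖ := by
  rw [norm_smul]; exact mul_le_of_le_one_left (norm_nonneg _) ha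

section

variable {F : Type*} [NormedAddCommGroup F] [NormedSpace ℝ F] {g : E3 → ℝ} {f : E3 → F}

theorem integrable_smul_of_norm_le_one (hgm : Measurable g) (hg1 : ∀ y, ‖g y‖ ≤ 1)
    (hf : Integrable f) : Integrable fun z => g z • f z :=
  Integrable.mono hf (hgm.aestronglyMeasurable.smul hf.1)
    (Eventually.of_forall fun z => norm_smul_le_of_norm_le_one (hg1 z) _)

theorem integrable_prod_oscillating (hgm : Measurable g) (hg1 : ∀ y, ‖g y‖ ≤ 1)
    (hf : Integrable f) (a : ℝ) :
    Integrable (Function.uncurry fun (s z : E3) => g (a • z + s) • f z)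
      ((volume.restrict unitCell).prod volume) := by
  refine Integrable.mono' (hf.norm.comp_snd (volume.restrict unitCell)) ?_
    (Eventually.of_forall fun q => norm_smul_le_of_norm_le_one (hg1 _) _)
  have h : Measurable fun q : E3 × E3 => a • q.2 + q.1 := by fun_prop
  exact (hgm.comp h).aestronglyMeasurable.smul hf.1.comp_snd

/-- Substituting `z + εs` for z shifts the phase of g by s while moving f only by εs, so a change of
phase costs no more than the L¹ translation modulus of f. -/
theorem norm_integral_oscillating_sub_le (hgm : Measurable g) (hg1 : ∀ y, ‖g y‖ ≤ 1)
    (hf : Integrable f) {ε : ℝ} (hε : 0 < ε) (s : E3) :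
    ‖(∫ z, g (ε⁻¹ • z) • f z) - ∫ z, g (ε⁻¹ • z + s) • f z‖ ≤
      ∫ z, ‖f (z + ε • s) - f z‖ := by
  have hI : ∫ z, g (ε⁻¹ • z) • f z = ∫ z, g (ε⁻¹ • z + s) • f (z + ε • s) := by
    rw [← integral_add_right_eq_self (fun z => g (ε⁻¹ • z) • f z) (ε • s)]
    simp only [smul_add, smul_smul, inv_mul_cancel₀ hε.ne', one_smul]
  have h : Measurable fun z : E3 => ε⁻¹ • z + s := by fun_prop
  have hi : ∀ h : E3, Integrable fun z => g (ε⁻¹ • z + s) • f (z + h) := fun h' =>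
    integrable_smul_of_norm_le_one (hgm.comp h) (fun _ => hg1 _) (hf.comp_add_right h')
  have h1 : Integrable fun z => g (ε⁻¹ • z + s) • f z := by simpa using hi 0
  rw [hI, ← integral_sub (hi _) h1]
  refine norm_integral_le_of_norm_le ((hf.comp_add_right _).sub hf).norm
    (Eventually.of_forall fun z => ?_)
  rw [← smul_sub]
  exact norm_smul_le_of_norm_le_one (hg1 _) _

variable [CompleteSpace F]

/-- Averaging over all phases s removes the oscillation exactly, whatever the frequency a. -/
theorem integral_integral_oscillating (hgm : Measurable g) (hg1 : ∀ y, ‖g y‖ ≤ 1) {c : ℝ}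
    (hc : ∀ y, ∫ s in unitCell, g (y + s) = c) (hf : Integrable f) (a : ℝ) :
    ∫ s in unitCell, ∫ z, g (a • z + s) • f z = c • ∫ z, f z := by
  rw [integral_integral_swap (integrable_prod_oscillating hgm hg1 hf a), ← integral_smul]
  refine integral_congr_ae (Eventually.of_forall fun z => ?_)
  dsimp only
  rw [integral_smul_const, hc]

/-- Rapidly oscillating bounded functions with constant cell averages converge weakly to their
average. -/
theorem tendsto_integral_oscillating (hgm : Measurable g) (hg1 : ∀ y, ‖g y‖ ≤ 1) {c : ℝ}
    (hc : ∀ y, ∫ s in unitCell, g (y + s) = c) (hf : Integrable f)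
    {ε : ℕ → ℝ} (hε : ∀ n, 0 < ε n) (hε0 : Tendsto ε atTop (𝓝 0)) :
    Tendsto (fun n => ∫ z, g ((ε n)⁻¹ • z) • f z) atTop (𝓝 (c • ∫ z, f z)) := by
  have hω := tendsto_integral_norm_translate_sub hf
  rw [Metric.tendsto_atTop]
  intro η hη
  obtain ⟨r, hr, hrω⟩ := Metric.tendsto_nhds_nhds.1 hω (η / 2) (half_pos hη)
  obtain ⟨N, hN⟩ := Metric.tendsto_atTop.1 hε0 r hr
  refine ⟨N, fun n hn => ?_⟩
  -- Y has measure 1, so the phase-zero integral is its own average over s. Its distance to the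
  -- limit is then an average of phase errors, each below η / 2.
  have hconst : ∫ z, g ((ε n)⁻¹ • z) • f z =
      ∫ s in unitCell, ∫ z, g ((ε n)⁻¹ • z) • f z := by
    rw [integral_const, probReal_univ, one_smul]
  have hi : Integrable (fun s => ∫ z, g ((ε n)⁻¹ • z + s) • f z) (volume.restrict unitCell) :=
    (integrable_prod_oscillating hgm hg1 hf (ε n)⁻¹).integral_prod_left
  rw [dist_eq_norm, ← integral_integral_oscillating hgm hg1 hc hf (ε n)⁻¹, hconst,
    ← integral_sub (integrable_const _) hi]
  have hb := norm_setIntegral_le_of_norm_le_const (μ := volume) (s := unitCell) (C := η / 2)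
    (f := fun s => (∫ z, g ((ε n)⁻¹ • z) • f z) - ∫ z, g ((ε n)⁻¹ • z + s) • f z)
    (by rw [volume_unitCell]; exact ENNReal.one_lt_top) fun s hs => by
      refine (norm_integral_oscillating_sub_le hgm hg1 hf (hε n) s).trans ?_
      have hd : dist (ε n • s) 0 < r := by
        rw [dist_zero_right, norm_smul]
        have h2 := hN n hn
        rw [dist_zero_right] at h2
        exact (mul_le_of_le_one_right (norm_nonneg _) (norm_le_one_of_mem_unitCell hs)).trans_lt h2
      have := hrω hd
      rw [dist_zero_right, Real.norm_eq_abs] at this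
      exact (le_abs_self _).trans this.le
  rw [measureReal_def, volume_unitCell, ENNReal.toReal_one, mul_one] at hb
  exact hb.trans_lt (half_lt_self hη)

/-- The rescaled periodic indicator function of a set converges weakly to the volume fraction. -/
theorem tendsto_integral_indicator_wrap_smul {A : Set E3} (hA : MeasurableSet A)
    (hf : Integrable f) {ε : ℕ → ℝ} (hε : ∀ n, 0 < ε n) (hε0 : Tendsto ε atTop (𝓝 0)) :
    Tendsto (fun n => ∫ z, A.indicator (1 : E3 → ℝ) (wrap ((ε n)⁻¹ • z)) • f z) atTop
      (𝓝 ((∫ y in unitCell, A.indicator (1 : E3 → ℝ) y) • ∫ z, f z)) := by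
  refine tendsto_integral_oscillating (g := fun y => A.indicator (1 : E3 → ℝ) (wrap y))
    ((measurable_one.indicator hA).comp measurable_wrap) (fun y => ?_) (fun y => ?_) hf hε hε0
  · by_cases h : wrap y ∈ A <;> simp [h]
  · simp_rw [add_comm y]
    exact setIntegral_unitCell_wrap_add (A.indicator (1 : E3 → ℝ)) y

end

/-- Convolution of an integrable function with a bounded function is continuous. -/
theorem continuous_integral_bilin {F₁ F₂ F₃ : Type*} [NormedAddCommGroup F₁] [NormedSpace ℝ F₁]
    [NormedAddCommGroup F₂] [NormedSpace ℝ F₂] [NormedAddCommGroup F₃] [NormedSpace ℝ F₃]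
    (L : F₁ →L[ℝ] F₂ →L[ℝ] F₃) {k : E3 → F₁} (hk : Integrable k) {φ : E3 → F₂}
    (hφ : StronglyMeasurable φ) {C : ℝ} (hC : ∀ z, ‖φ z‖ ≤ C) :
    Continuous fun x => ∫ ξ, L (k ξ) (φ (x + ξ)) := by
  have hC0 : 0 ≤ C := (norm_nonneg _).trans (hC 0)
  -- φ is merely measurable, so the dependence on x is moved to the integrable kernel, where
  -- continuity of translations applies.
  have heq : ∀ x, ∫ ξ, L (k ξ) (φ (x + ξ)) = ∫ z, L (k (z - x)) (φ z) := fun x => by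
    rw [← integral_sub_right_eq_self (fun ξ => L (k ξ) (φ (x + ξ))) x]
    simp
  have hint : ∀ x, Integrable fun z => L (k (z - x)) (φ z) := fun x => by
    refine Integrable.mono' (((hk.comp_sub_right x).norm.const_mul ‖L‖).mul_const C)
      (L.aestronglyMeasurable_comp₂ (hk.comp_sub_right x).1 hφ.aestronglyMeasurable)
      (Eventually.of_forall fun z => (L.le_opNorm₂ _ _).trans ?_)
    gcongr
    exact hC z
  rw [continuous_iff_continuousAt]
  intro x₀
  have hω := (tendsto_integral_norm_translate_sub hk).comp
    (show Tendsto (fun x : E3 => x₀ - x) (𝓝 x₀) (𝓝 0) by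
      have : Continuous fun x : E3 => x₀ - x := by fun_prop
      simpa using this.tendsto x₀)
  have hω2 := (hω.const_mul (‖L‖ * C))
  rw [mul_zero] at hω2
  simp only [ContinuousAt, heq]
  refine tendsto_iff_norm_sub_tendsto_zero.2 (squeeze_zero (fun _ => norm_nonneg _) (fun x => ?_) hω2)
  rw [← integral_sub (hint x) (hint x₀), Function.comp_apply,
    ← integral_sub_right_eq_self (fun z => ‖k (z + (x₀ - x)) - k z‖) x₀, ← integral_const_mul]
  refine norm_integral_le_of_norm_le ?_ (Eventually.of_forall fun z => ?_)
  · refine Integrable.const_mul ?_ _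
    simpa using ((hk.comp_sub_right x).sub (hk.comp_sub_right x₀)).norm
  · have : z - x₀ + (x₀ - x) = z - x := by abel
    rw [this, ← sub_apply, ← map_sub]
    refine (L.le_opNorm₂ _ _).trans ?_
    rw [mul_right_comm]
    gcongr
    exact hC z

/-! ### Nonlocal operators with a truncated bond kernel -/

/-- A bounded measurable modulation of the bond kernel. -/
structure BoundedCoefficient where
  toFun : E3 → E3 → ℝ
  measurable : Measurable (Function.uncurry toFun)
  bound : ℝ≥0
  norm_le : ∀ x ξ, ‖toFun x ξ‖ ≤ bound

namespace SchurKernel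

/-- Schur data for `v ↦ ∫ b x ξ • J (k ξ) (v (σ x ξ)) dξ`, where `k` is the truncated bond kernel. -/
def ofHorizon (μ : Measure E3) [SFinite μ] {V : Type*} [NormedAddCommGroup V] [NormedSpace ℝ V]
    (J : (E3 →L[ℝ] E3) → V →L[ℝ] V) (hJ : Continuous fun q : (E3 →L[ℝ] E3) × V => J q.1 q.2)
    (hJ1 : ∀ L, ‖J L‖ ≤ ‖L‖) (r : ℝ) (σ : E3 → E3 → E3) (hσ : Measurable (Function.uncurry σ))
    (b : BoundedCoefficient) (χ : E3 → E3 → ℝ≥0∞) (hχ : Measurable (Function.uncurry χ))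
    (hχ1 : ∀ x ξ, χ x ξ ≤ 1) (hb : ∀ x ξ, ‖b.toFun x ξ‖ₑ ≤ b.bound * χ x ξ)
    (htr : ∀ ξ (g : E3 → ℝ≥0∞), Measurable g → ∫⁻ x, χ x ξ * g (σ x ξ) ∂μ ≤ ∫⁻ x, g x ∂μ) :
    SchurKernel μ μ (volume : Measure E3) V V where
  σ := σ
  Φ x ξ := b.toFun x ξ • J (horizonKernel r ξ)
  -- For `gainKernel` the factor χ discards bonds leaving Ω; without it the integral of `g (σ x ξ)`
  -- would not be controlled by that of g over Ω.
  weight x ξ := b.bound * χ x ξ * ‖horizonKernel r ξ‖ₑ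
  C := b.bound * horizonMass r
  measurable_weight := (hχ.const_mul _).mul
    ((stronglyMeasurable_horizonKernel r).enorm.comp measurable_snd)
  measurable_σ := hσ
  stronglyMeasurable v hv := by
    have h1 : StronglyMeasurable fun q : E3 × E3 => (horizonKernel r q.2, v (σ q.1 q.2)) :=
      ((stronglyMeasurable_horizonKernel r).comp_measurable measurable_snd).prodMk
        (hv.comp_measurable hσ)
    exact b.measurable.stronglyMeasurable.smul (hJ.comp_stronglyMeasurable h1)
  enorm_le x ξ := by
    rw [enorm_smul]
    refine mul_le_mul' (hb x ξ) ?_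
    exact enorm_le_iff_norm_le.2 (hJ1 _)
  lintegral_weight_le x := by
    calc ∫⁻ ξ, b.bound * χ x ξ * ‖horizonKernel r ξ‖ₑ
        ≤ ∫⁻ ξ, b.bound * ‖horizonKernel r ξ‖ₑ := by
          refine lintegral_mono fun ξ => ?_
          dsimp only
          gcongr
          exact mul_le_of_le_one_right' (hχ1 x ξ)
      _ = _ := by
          rw [lintegral_const_mul _ (stronglyMeasurable_horizonKernel r).enorm,
            lintegral_enorm_horizonKernel]
          push_cast; rfl
  -- With ξ outermost, `htr` handles the x-integral for each fixed bond vector, and the remaining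
  -- integral is the kernel mass.
  lintegral_lintegral_le g hg := by
    have hk := (stronglyMeasurable_horizonKernel r).enorm
    calc ∫⁻ x, ∫⁻ ξ, b.bound * χ x ξ * ‖horizonKernel r ξ‖ₑ * g (σ x ξ) ∂volume ∂μ
        = ∫⁻ ξ, ∫⁻ x, b.bound * χ x ξ * ‖horizonKernel r ξ‖ₑ * g (σ x ξ) ∂μ ∂volume :=
          lintegral_lintegral_swap (Measurable.aemeasurable
            (((hχ.const_mul _).mul (hk.comp measurable_snd)).mul (hg.comp hσ)))
      _ = ∫⁻ ξ, b.bound * ‖horizonKernel r ξ‖ₑ * ∫⁻ x, χ x ξ * g (σ x ξ) ∂μ := by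
          refine lintegral_congr fun ξ => ?_
          have hχξ : Measurable fun x => χ x ξ := hχ.comp measurable_prodMk_right
          have hσξ : Measurable fun x => σ x ξ := hσ.comp measurable_prodMk_right
          have hm : Measurable fun x => χ x ξ * g (σ x ξ) := hχξ.mul (hg.comp hσξ)
          rw [← lintegral_const_mul _ hm]
          refine lintegral_congr fun x => by ring
      _ ≤ ∫⁻ ξ, b.bound * ‖horizonKernel r ξ‖ₑ * ∫⁻ x, g x ∂μ := by
          refine lintegral_mono fun ξ => ?_
          exact mul_le_mul' le_rfl (htr ξ g hg)
      _ = _ := by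
          rw [lintegral_mul_const _ (hk.const_mul _), lintegral_const_mul _ hk,
            lintegral_enorm_horizonKernel]
          push_cast; rfl

/-- Multiplication by a bounded measurable function. -/
def ofMul (μ : Measure E3) [SFinite μ] (V : Type*) [NormedAddCommGroup V] [NormedSpace ℝ V]
    (a : E3 → ℝ) (ha : Measurable a) (C : ℝ≥0) (hC : ∀ x, ‖a x‖ ≤ C) :
    SchurKernel μ μ (Measure.dirac ()) V V where
  -- Integration against the Dirac mass on a one-point space is evaluation, so pointwise operators
  -- fall under Schur's test too.
  σ x _ := x
  Φ x _ := a x • ContinuousLinearMap.id ℝ V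
  weight _ _ := C
  C := C
  measurable_weight := measurable_const
  measurable_σ := measurable_fst
  stronglyMeasurable v hv :=
    (ha.comp measurable_fst).stronglyMeasurable.smul (hv.comp_measurable measurable_fst)
  enorm_le x _ := by
    rw [enorm_smul, ← mul_one (C : ℝ≥0∞)]
    refine mul_le_mul' ?_ (enorm_le_iff_norm_le (y := (1 : ℝ)) |>.2 ?_ |>.trans (by simp))
    · rw [← enorm_norm, ← ofReal_norm, norm_norm]
      exact (ENNReal.ofReal_le_ofReal (hC x)).trans (by simp)
    · simpa using ContinuousLinearMap.norm_id_le
  lintegral_weight_le _ := by simp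
  lintegral_lintegral_le g hg := by
    simp only [lintegral_dirac]
    rw [lintegral_const_mul _ hg]

theorem ofMul_apply (μ : Measure E3) [SFinite μ] (V : Type*) [NormedAddCommGroup V]
    [NormedSpace ℝ V] [CompleteSpace V] (a : E3 → ℝ) (ha : Measurable a) (C : ℝ≥0)
    (hC : ∀ x, ‖a x‖ ≤ C) (v : E3 → V) (x : E3) :
    (ofMul μ V a ha C hC).apply v x = a x • v x := by
  simp [SchurKernel.apply, ofMul]

end SchurKernel

namespace Composite

variable (M : Composite)

/-! ### Coefficients -/

theorem χf_wrap (y : E3) : M.χf (wrap y) = M.χf y := by rw [χf, χf, wrap_wrap]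

theorem χm_wrap (y : E3) : M.χm (wrap y) = M.χm y := by rw [χm, χm, χf_wrap]

theorem ρ_wrap (y : E3) : M.ρ (wrap y) = M.ρ y := by rw [ρ, ρ, χf_wrap, χm_wrap]

theorem α_congr_wrap {y y' z z' : E3} (hy : wrap y = wrap y') (hz : wrap z = wrap z') :
    M.α y z = M.α y' z' := by
  have h1 : M.χf y = M.χf y' := by rw [← χf_wrap, hy, χf_wrap]
  have h2 : M.χf z = M.χf z' := by rw [← χf_wrap, hz, χf_wrap]
  simp only [α, χm, h1, h2]

theorem χf_eq_zero_or_one (y : E3) : M.χf y = 0 ∨ M.χf y = 1 := by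
  by_cases h : wrap y ∈ M.inclusion <;> simp [χf, h]

theorem measurable_χf : Measurable M.χf :=
  (measurable_const.indicator M.measurableSet_inclusion).comp measurable_wrap

theorem measurable_χm : Measurable M.χm := measurable_const.sub M.measurable_χf

theorem measurable_ρ : Measurable M.ρ :=
  (M.measurable_χf.mul_const _).add (M.measurable_χm.mul_const _)

theorem measurable_α : Measurable (Function.uncurry M.α) := by
  have h1 : Measurable fun q : E3 × E3 => M.χf q.1 := M.measurable_χf.comp measurable_fst
  have h2 : Measurable fun q : E3 × E3 => M.χm q.1 := M.measurable_χm.comp measurable_fst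
  have h3 : Measurable fun q : E3 × E3 => M.χf q.2 := M.measurable_χf.comp measurable_snd
  have h4 : Measurable fun q : E3 × E3 => M.χm q.2 := M.measurable_χm.comp measurable_snd
  exact (((h1.mul h3).const_mul M.Cf).add ((h2.mul h4).const_mul M.Cm)).add
    (((h1.mul h4).add (h2.mul h3)).const_mul M.Ci)

theorem ρ_eq (y : E3) : M.ρ y = M.ρm ∨ M.ρ y = M.ρf := by
  rcases M.χf_eq_zero_or_one y with h | h <;> simp [ρ, χm, h]

theorem ρ_pos (y : E3) : 0 < M.ρ y := by
  rcases M.ρ_eq y with h | h <;> rw [h]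
  exacts [M.ρm_pos, M.ρf_pos]

/-- An upper bound for the inverse mass density. -/
def invρBound : ℝ≥0 := (M.ρf⁻¹ + M.ρm⁻¹).toNNReal

theorem norm_inv_ρ_le (y : E3) : ‖(M.ρ y)⁻¹‖ ≤ M.invρBound := by
  have h1 := inv_pos.2 M.ρf_pos
  have h2 := inv_pos.2 M.ρm_pos
  rw [invρBound, Real.coe_toNNReal _ (by positivity), Real.norm_eq_abs,
    abs_of_pos (inv_pos.2 (M.ρ_pos y))]
  rcases M.ρ_eq y with h | h <;> rw [h] <;> linarith

/-- An upper bound for the bond strength. -/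
def αBound : ℝ≥0 := (M.Cf + M.Cm + M.Ci).toNNReal

theorem norm_α_le (y z : E3) : ‖M.α y z‖ ≤ M.αBound := by
  have h1 := M.Cf_pos
  have h2 := M.Cm_pos
  have h3 := M.Ci_pos
  rw [αBound, Real.coe_toNNReal _ (by positivity), Real.norm_eq_abs]
  rcases M.χf_eq_zero_or_one y with h | h <;> rcases M.χf_eq_zero_or_one z with h' | h' <;>
    simp only [α, χm, h, h'] <;> norm_num <;> rw [abs_of_pos (by assumption)] <;> linarith

theorem measurable_α_comp {X : Type*} [MeasurableSpace X] {f g : X → E3} (hf : Measurable f)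
    (hg : Measurable g) : Measurable fun q => M.α (f q) (g q) :=
  M.measurable_α.comp (hf.prodMk hg)

/-- The bond strength as a function of the rescaled position and the bond vector. -/
def bondCoeff (c : ℝ) : BoundedCoefficient where
  toFun x ξ := M.α (c • x) (c • x + ξ)
  measurable := by
    have h1 : Measurable fun q : E3 × E3 => c • q.1 := by fun_prop
    have h2 : Measurable fun q : E3 × E3 => c • q.1 + q.2 := by fun_prop
    exact M.measurable_α_comp h1 h2
  bound := M.αBound
  norm_le _ _ := M.norm_α_le _ _

/-- The constant strength of the long-range bonds. -/
def lamCoeff : BoundedCoefficient where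
  toFun _ _ := M.lam
  measurable := measurable_const
  bound := M.lam.toNNReal
  norm_le _ _ := by rw [Real.coe_toNNReal _ M.lam_pos.le, Real.norm_of_nonneg M.lam_pos.le]

theorem measurableSet_Ω : MeasurableSet M.Ω := M.isOpen_Ω.measurableSet

/-- A coefficient, set to zero for bonds that leave `Ω`. -/
def cutCoeff (s : ℝ) (a : BoundedCoefficient) : BoundedCoefficient where
  toFun x ξ := M.Ω.indicator 1 (x + s • ξ) * a.toFun x ξ
  measurable := by
    have h : Measurable fun q : E3 × E3 => q.1 + s • q.2 := by fun_prop
    exact ((measurable_one.indicator M.measurableSet_Ω).comp h).mul a.measurable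
  bound := a.bound
  norm_le x ξ := by
    by_cases h : x + s • ξ ∈ M.Ω <;> simp [h]
    exact a.norm_le x ξ

theorem BoundedCoefficient.enorm_le (a : BoundedCoefficient) (x ξ : E3) :
    ‖a.toFun x ξ‖ₑ ≤ a.bound := by
  rw [← ofReal_norm]
  exact (ENNReal.ofReal_le_ofReal (a.norm_le x ξ)).trans (by simp)

/-- Schur data for `v ↦ ∫ 1_Ω(x + sξ) a(x, ξ) k(ξ) v(x + sξ) dξ` on `L^p(Ω)`. -/
def gainKernel (s r : ℝ) (a : BoundedCoefficient) :
    SchurKernel (volume.restrict M.Ω) (volume.restrict M.Ω) (volume : Measure E3) E3 E3 :=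
  SchurKernel.ofHorizon _ (fun L => L) (by fun_prop) (fun L => le_rfl) r (fun x ξ => x + s • ξ)
    (by fun_prop) (M.cutCoeff s a) (fun x ξ => M.Ω.indicator 1 (x + s • ξ))
    (by
      have h : Measurable fun q : E3 × E3 => q.1 + s • q.2 := by fun_prop
      exact (measurable_one.indicator M.measurableSet_Ω).comp h)
    (fun x ξ => by by_cases h : x + s • ξ ∈ M.Ω <;> simp [h])
    (fun x ξ => by
      by_cases h : x + s • ξ ∈ M.Ω
      · simpa [h] using BoundedCoefficient.enorm_le (M.cutCoeff s a) x ξ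
      · simp [cutCoeff, h])
    fun ξ g hg => by
      calc ∫⁻ x in M.Ω, M.Ω.indicator 1 (x + s • ξ) * g (x + s • ξ)
          ≤ ∫⁻ x, M.Ω.indicator 1 (x + s • ξ) * g (x + s • ξ) :=
            lintegral_mono' Measure.restrict_le_self le_rfl
        _ = ∫⁻ x, M.Ω.indicator 1 x * g x :=
            lintegral_add_right_eq_self (fun x => M.Ω.indicator (1 : E3 → ℝ≥0∞) x * g x) (s • ξ)
        _ = ∫⁻ x in M.Ω, g x := by
            rw [← lintegral_indicator M.measurableSet_Ω]
            refine lintegral_congr fun x => ?_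
            by_cases h : x ∈ M.Ω <;> simp [h]

/-- Schur data for `v ↦ ∫ 1_Ω(x + sξ) a(x, ξ) k(ξ) v(x) dξ` on `L^p(Ω)`. -/
def lossKernel (s r : ℝ) (a : BoundedCoefficient) :
    SchurKernel (volume.restrict M.Ω) (volume.restrict M.Ω) (volume : Measure E3) E3 E3 :=
  SchurKernel.ofHorizon _ (fun L => L) (by fun_prop) (fun L => le_rfl) r (fun x _ => x)
    measurable_fst (M.cutCoeff s a) (fun _ _ => 1) measurable_const (fun _ _ => le_rfl)
    (fun x ξ => by rw [mul_one]; exact BoundedCoefficient.enorm_le _ x ξ)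
    fun ξ g hg => by simp

section

variable (p : ℝ≥0∞) [Fact (1 ≤ p)] (hp : p ≠ ∞)

/-- The nonlocal operator `v ↦ ∫ 1_Ω(x + sξ) a(x, ξ) k(ξ) (v(x + sξ) - v(x)) dξ` on `L^p(Ω)`. -/
def nonlocal (s r : ℝ) (a : BoundedCoefficient) : M.LpField p →L[ℝ] M.LpField p :=
  (M.gainKernel s r a).toCLM p hp - (M.lossKernel s r a).toCLM p hp

/-- The integral `∫ 1_Ω(x + sξ) a(x, ξ) k(ξ) (v(x + sξ) - c) dξ`. -/
def nonlocalAt (s r : ℝ) (a : BoundedCoefficient) (x : E3) (v : E3 → E3) (c : E3) : E3 :=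
  ∫ ξ, ((M.Ω.indicator 1 (x + s • ξ) * a.toFun x ξ) • horizonKernel r ξ) (v (x + s • ξ) - c)

theorem norm_nonlocal_le (s r : ℝ) (a : BoundedCoefficient) :
    ‖M.nonlocal p hp s r a‖ ≤ 2 * (a.bound * horizonMass r) := by
  rw [two_mul]
  exact (norm_sub_le _ _).trans (add_le_add ((M.gainKernel s r a).norm_toCLM_le p hp)
    ((M.lossKernel s r a).norm_toCLM_le p hp))

/-- The kernel is integrable, so gain and loss integrals converge separately and no cancellation in
the difference is required. The representative w may be chosen freely, which is used for step
fields. -/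
theorem coeFn_nonlocal {s r : ℝ} {a : BoundedCoefficient} {v : M.LpField p} {w : E3 → E3}
    (hw : StronglyMeasurable w) (h : v =ᵐ[volume.restrict M.Ω] w) :
    M.nonlocal p hp s r a v =ᵐ[volume.restrict M.Ω] fun x => M.nonlocalAt s r a x w (w x) := by
  have hwp : MemLp w p (volume.restrict M.Ω) := (memLp_congr_ae h).1 (Lp.memLp v)
  filter_upwards [Lp.coeFn_sub ((M.gainKernel s r a).toCLM p hp v)
      ((M.lossKernel s r a).toCLM p hp v),
    (M.gainKernel s r a).coeFn_toCLM_of_ae_eq p hp hw h,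
    (M.lossKernel s r a).coeFn_toCLM_of_ae_eq p hp hw h,
    (M.gainKernel s r a).ae_integrable hw Fact.out hp hwp,
    (M.lossKernel s r a).ae_integrable hw Fact.out hp hwp] with x h1 h2 h3 h4 h5
  refine h1.trans ?_
  rw [Pi.sub_apply, h2, h3, SchurKernel.apply, SchurKernel.apply, ← integral_sub h4 h5]
  refine integral_congr_ae (Eventually.of_forall fun ξ => ?_)
  dsimp only
  rw [map_sub]
  rfl

theorem bond_smul {s : ℝ} (hs : 0 < s) (ξ η : E3) : bond (s • ξ) η = s⁻¹ • bond ξ η := by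
  rw [bond, bond, norm_smul, inner_smul_left, Real.norm_of_nonneg hs.le, smul_smul, smul_smul]
  congr 1
  rcases eq_or_ne ‖ξ‖ 0 with h | h
  · simp [h]
  · simp only [conj_trivial]; field_simp

/-- Under `z = x + sξ` the volume element gives s³ and the kernel, homogeneous of degree -1, gives
s⁻¹. The prefactor s⁻² is exactly the one leaving no power of s, whence bounds uniform in the scale.
The case s = 1 is the long-range term. -/
theorem nonlocalAt_eq_setIntegral {s r : ℝ} (hs : 0 < s) (a : BoundedCoefficient) (x : E3)
    (v : E3 → E3) (c : E3) : M.nonlocalAt s r a x v c = ∫ z in Metric.ball x (s * r) ∩ M.Ω,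
      ((1 / s ^ 2) * a.toFun x (s⁻¹ • (z - x))) • bond (z - x) (v z - c) := by
  -- The factor s offsets the s⁻¹ from `bond_smul`; combined with the Jacobian s⁻³ it leaves s⁻².
  set G : E3 → E3 := fun z => (Metric.ball x (s * r) ∩ M.Ω).indicator (fun z =>
    (s * a.toFun x (s⁻¹ • (z - x))) • bond (z - x) (v z - c)) z with hG
  have h1 : M.nonlocalAt s r a x v c = ∫ ξ, G (x + s • ξ) := by
    refine integral_congr_ae (Eventually.of_forall fun ξ => ?_)
    have hb : x + s • ξ ∈ Metric.ball x (s * r) ↔ ξ ∈ Metric.ball (0 : E3) r := by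
      rw [mem_ball_iff_norm, add_sub_cancel_left, norm_smul, Real.norm_of_nonneg hs.le,
        mem_ball_zero_iff, mul_lt_mul_iff_right₀ hs]
    simp only [hG, horizonKernel]
    by_cases h1 : x + s • ξ ∈ M.Ω
    · by_cases h2 : ξ ∈ Metric.ball (0 : E3) r
      · rw [indicator_of_mem h1, indicator_of_mem h2,
          indicator_of_mem (show x + s • ξ ∈ Metric.ball x (s * r) ∩ M.Ω from ⟨hb.2 h2, h1⟩)]
        simp only [add_sub_cancel_left, smul_smul, inv_mul_cancel₀ hs.ne', one_smul,
          bond_smul hs, smul_apply, bondCLM_apply, Pi.one_apply, one_mul]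
        congr 1
        field_simp
      · rw [indicator_of_notMem h2, indicator_of_notMem (show x + s • ξ ∉ Metric.ball x (s * r) ∩ M.Ω from
          fun h => h2 (hb.1 h.1))]
        simp
    · rw [indicator_of_notMem h1, indicator_of_notMem (show x + s • ξ ∉ Metric.ball x (s * r) ∩ M.Ω from
        fun h => h1 h.2)]
      simp
  have h2 : ∫ ξ, G (x + s • ξ) = (s ^ 3)⁻¹ • ∫ z, G z := by
    have := Measure.integral_comp_smul volume (fun ξ => G (x + ξ)) s
    rw [this, integral_add_left_eq_self G x, finrank_euclideanSpace_fin, abs_of_pos (by positivity)]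
  rw [h1, h2, hG, integral_indicator (Metric.isOpen_ball.measurableSet.inter M.measurableSet_Ω),
    ← integral_smul]
  refine integral_congr_ae (Eventually.of_forall fun z => ?_)
  dsimp only
  rw [smul_smul]
  congr 1
  field_simp

end

end Composite

namespace Composite

variable (M : Composite)

/-! ### Traces of two-scale fields on the diagonal `y = x/ε` -/

section

variable (F : Type*) [NormedAddCommGroup F] [NormedSpace ℝ F]

/-- Evaluation at `x`, zero for `x` outside the closure of `Ω`. -/
def evalAt (x : E3) : C(closure M.Ω, F) →L[ℝ] F :=
  open Classical in
  if h : x ∈ closure M.Ω then ContinuousMap.evalCLM ℝ (⟨x, h⟩ : closure M.Ω) else 0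

variable {F}

theorem evalAt_of_mem {x : E3} (h : x ∈ closure M.Ω) (φ : C(closure M.Ω, F)) :
    M.evalAt F x φ = φ ⟨x, h⟩ := by
  rw [evalAt, dif_pos h]; rfl

theorem evalAt_of_notMem {x : E3} (h : x ∉ closure M.Ω) (φ : C(closure M.Ω, F)) :
    M.evalAt F x φ = 0 := by
  rw [evalAt, dif_neg h]; rfl

theorem norm_evalAt_le (x : E3) : ‖M.evalAt F x‖ ≤ 1 := by
  refine ContinuousLinearMap.opNorm_le_bound _ zero_le_one fun φ => ?_
  rw [one_mul]
  by_cases h : x ∈ closure M.Ω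
  · rw [M.evalAt_of_mem h]; exact φ.norm_coe_le_norm _
  · rw [M.evalAt_of_notMem h, norm_zero]; exact norm_nonneg _

theorem norm_evalAt_apply_le (x : E3) (φ : C(closure M.Ω, F)) : ‖M.evalAt F x φ‖ ≤ ‖φ‖ := by
  simpa using (M.evalAt F x).le_of_opNorm_le (M.norm_evalAt_le x) φ

theorem valueAt_eq (φ : C(closure M.Ω, E3)) (x : E3) : valueAt φ x = M.evalAt E3 x φ := by
  by_cases h : x ∈ closure M.Ω
  · rw [M.evalAt_of_mem h, valueAt, dif_pos h]
  · rw [M.evalAt_of_notMem h, valueAt, dif_neg h]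

theorem stronglyMeasurable_evalAt (φ : C(closure M.Ω, F)) :
    StronglyMeasurable fun x => M.evalAt F x φ := by
  have h := (MeasurableEmbedding.subtype_coe
    (isClosed_closure (s := M.Ω)).measurableSet).stronglyMeasurable_extend
    φ.continuous.stronglyMeasurable (stronglyMeasurable_zero (β := F))
  convert h using 1
  ext x
  by_cases hx : x ∈ closure M.Ω
  · rw [M.evalAt_of_mem hx]
    exact (Subtype.val_injective.extend_apply φ (0 : E3 → F) ⟨x, hx⟩).symm
  · rw [M.evalAt_of_notMem hx, Function.extend_apply' _ _ _ fun ⟨a, ha⟩ => hx (ha ▸ a.2)]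
    rfl

/-- The set of points (x, x/ε) is null in the product, so a trace there makes sense only because
fields are strongly measurable with values in continuous functions: the claim is clear for simple
functions and passes to pointwise limits. -/
theorem stronglyMeasurable_evalAt_comp {Z : Type*} [MeasurableSpace Z]
    {f : Z → C(closure M.Ω, F)} (hf : StronglyMeasurable f) {g : Z → E3} (hg : Measurable g) :
    StronglyMeasurable fun z => M.evalAt F (g z) (f z) := by
  have hs : ∀ s : SimpleFunc Z C(closure M.Ω, F),
      StronglyMeasurable fun z => M.evalAt F (g z) (s z) := by
    intro s
    induction s using SimpleFunc.induction with
    | const c hA =>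
      rename_i A
      have : (fun z => M.evalAt F (g z) (SimpleFunc.piecewise A hA (SimpleFunc.const Z c)
          (SimpleFunc.const Z 0) z)) = A.indicator fun z => M.evalAt F (g z) c := by
        ext z
        by_cases h : z ∈ A <;> simp [h]
      rw [this]
      exact ((M.stronglyMeasurable_evalAt c).comp_measurable hg).indicator hA
    | add _ h1 h2 =>
      simp only [SimpleFunc.coe_add, Pi.add_apply, map_add]
      exact h1.add h2
  refine stronglyMeasurable_of_tendsto atTop (fun n => hs (hf.approx n)) ?_
  rw [tendsto_pi_nhds]
  exact fun z => ((M.evalAt F (g z)).continuous.tendsto _).comp (hf.tendsto_approx z)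

theorem exists_subset_ball : ∃ R : ℝ, M.Ω ⊆ Metric.ball 0 R :=
  M.isBounded_Ω.subset_ball 0

/-- A bound, uniform in the scale, for the trace operators. -/
def traceBound : ℝ≥0 :=
  -- The row condition of Schur's test needs 1, since the weight is 1 against a Dirac mass; the
  -- column condition needs the ball volume.
  max 1 (volume (Metric.ball (0 : E3) (M.exists_subset_ball.choose + 1))).toNNReal

variable (F)

/-- Schur data for the trace `w ↦ w(x, x/ε)`. -/
def traceKernel {ε : ℝ} (hε : 0 < ε) (hε1 : ε ≤ 1) :
    SchurKernel (volume.restrict unitCell) (volume.restrict M.Ω) (Measure.dirac ())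
      C(closure M.Ω, F) F where
  σ x _ := wrap (ε⁻¹ • x)
  Φ x _ := M.evalAt F x
  weight _ _ := 1
  C := M.traceBound
  measurable_weight := measurable_const
  measurable_σ := measurable_wrap.comp (measurable_fst.const_smul ε⁻¹)
  stronglyMeasurable v hv := by
    have h : Measurable fun q : E3 × Unit => wrap (ε⁻¹ • q.1) :=
      measurable_wrap.comp (measurable_fst.const_smul ε⁻¹)
    exact M.stronglyMeasurable_evalAt_comp (hv.comp_measurable h) measurable_fst
  enorm_le x _ := by
    rw [← ofReal_norm]
    exact (ENNReal.ofReal_le_ofReal (M.norm_evalAt_le x)).trans (by simp)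
  lintegral_weight_le _ := by
    simp [traceBound]
  lintegral_lintegral_le g hg := by
    simp only [lintegral_dirac, one_mul]
    refine (setLIntegral_wrap_smul_le hg M.exists_subset_ball.choose_spec hε hε1).trans ?_
    gcongr
    rw [traceBound, ENNReal.coe_max, ENNReal.coe_toNNReal measure_ball_lt_top.ne]
    exact le_max_right _ _

theorem traceKernel_apply [CompleteSpace F] {ε : ℝ} (hε : 0 < ε) (hε1 : ε ≤ 1)
    (w : E3 → C(closure M.Ω, F)) (x : E3) :
    (M.traceKernel F hε hε1).apply w x = M.evalAt F x (w (wrap (ε⁻¹ • x))) := by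
  simp [SchurKernel.apply, traceKernel]

end

variable {M} in
theorem perExt_eq {p : ℝ≥0∞} (w : M.PerField p) (x y : E3) :
    perExt w x y = M.evalAt E3 x (w (wrap y)) := M.valueAt_eq _ _

variable {M} in
theorem perExt_add {p : ℝ≥0∞} (v w : M.PerField p) :
    ∀ᵐ y : E3, ∀ x, perExt (v + w) x y = perExt v x y + perExt w x y := by
  filter_upwards [quasiMeasurePreserving_wrap.ae (Lp.coeFn_add v w)] with y hy x
  rw [perExt_eq, perExt_eq, perExt_eq, hy, Pi.add_apply, map_add]

section

variable (p : ℝ≥0∞) [Fact (1 ≤ p)] (hp : p ≠ ∞)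

/-- The trace `w ↦ w(x, x/ε)`. -/
def trace {ε : ℝ} (hε : 0 < ε) (hε1 : ε ≤ 1) : M.PerField p →L[ℝ] M.LpField p :=
  (M.traceKernel E3 hε hε1).toCLM p hp

theorem norm_trace_le {ε : ℝ} (hε : 0 < ε) (hε1 : ε ≤ 1) :
    ‖M.trace p hp hε hε1‖ ≤ M.traceBound := SchurKernel.norm_toCLM_le _ p hp

theorem coeFn_trace {ε : ℝ} (hε : 0 < ε) (hε1 : ε ≤ 1) {w : M.PerField p}
    {w' : E3 → C(closure M.Ω, E3)} (hw' : StronglyMeasurable w')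
    (h : w =ᵐ[volume.restrict unitCell] w') :
    M.trace p hp hε hε1 w =ᵐ[volume.restrict M.Ω]
      fun x => M.evalAt E3 x (w' (wrap (ε⁻¹ • x))) := by
  filter_upwards [(M.traceKernel E3 hε hε1).coeFn_toCLM_of_ae_eq p hp hw' h] with x hx
  rw [← M.traceKernel_apply E3 hε hε1]
  exact hx

theorem coeFn_trace_perExt {ε : ℝ} (hε : 0 < ε) (hε1 : ε ≤ 1) (w : M.PerField p) :
    M.trace p hp hε hε1 w =ᵐ[volume.restrict M.Ω] fun x => perExt w x (ε⁻¹ • x) := by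
  filter_upwards [M.coeFn_trace p hp hε hε1 (Lp.stronglyMeasurable w) EventuallyEq.rfl] with x hx
  rw [hx, perExt_eq]

/-! ### Division by the density -/

/-- Division by `ρ(c x)` on `L^p(Ω)`. -/
def divρ (c : ℝ) : M.LpField p →L[ℝ] M.LpField p :=
  (SchurKernel.ofMul (volume.restrict M.Ω) E3 (fun x => (M.ρ (c • x))⁻¹)
    ((M.measurable_ρ.comp (measurable_const_smul c)).inv) M.invρBound
    fun _ => M.norm_inv_ρ_le _).toCLM p hp

theorem coeFn_divρ (c : ℝ) (v : M.LpField p) :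
    M.divρ p hp c v =ᵐ[volume.restrict M.Ω] fun x => (M.ρ (c • x))⁻¹ • v x := by
  refine (SchurKernel.coeFn_toCLM _ p hp v).trans (Eventually.of_forall fun x => ?_)
  rw [SchurKernel.ofMul_apply]

theorem norm_divρ_le (c : ℝ) : ‖M.divρ p hp c‖ ≤ M.invρBound := SchurKernel.norm_toCLM_le _ p hp

theorem eq_divρ_iff (c : ℝ) {v w : M.LpField p} :
    v = M.divρ p hp c w ↔ ∀ᵐ x ∂(volume.restrict M.Ω), M.ρ (c • x) • v x = w x := by
  constructor
  · rintro rfl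
    filter_upwards [M.coeFn_divρ p hp c w] with x hx
    rw [hx, smul_smul, mul_inv_cancel₀ (M.ρ_pos _).ne', one_smul]
  · intro h
    refine Lp.ext ?_
    filter_upwards [h, M.coeFn_divρ p hp c w] with x hx h2
    rw [h2, ← hx, smul_smul, inv_mul_cancel₀ (M.ρ_pos _).ne', one_smul]

/-- Division by `ρ(y)` on `L^p_per(Y; C(Ω̄)³)`. -/
def cellDivρ : M.PerField p →L[ℝ] M.PerField p :=
  (SchurKernel.ofMul (volume.restrict unitCell) C(closure M.Ω, E3) (fun y => (M.ρ y)⁻¹)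
    M.measurable_ρ.inv M.invρBound fun _ => M.norm_inv_ρ_le _).toCLM p hp

theorem coeFn_cellDivρ (v : M.PerField p) :
    M.cellDivρ p hp v =ᵐ[volume.restrict unitCell] fun y => (M.ρ y)⁻¹ • v y := by
  refine (SchurKernel.coeFn_toCLM _ p hp v).trans (Eventually.of_forall fun x => ?_)
  rw [SchurKernel.ofMul_apply]

theorem eq_cellDivρ_iff {v w : M.PerField p} :
    v = M.cellDivρ p hp w ↔
      ∀ᵐ y : E3, ∀ x ∈ closure M.Ω, M.ρ y • perExt v x y = perExt w x y := by
  constructor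
  · rintro rfl
    filter_upwards [quasiMeasurePreserving_wrap.ae (M.coeFn_cellDivρ p hp w)] with y hy x hx
    rw [perExt_eq, perExt_eq, hy, map_smul, smul_smul, ρ_wrap, mul_inv_cancel₀ (M.ρ_pos _).ne',
      one_smul]
  · intro h
    refine Lp.ext ?_
    filter_upwards [ae_unitCell_of_ae h, M.coeFn_cellDivρ p hp w] with y hy h2
    rw [h2]
    ext1 x
    have := hy.1 x x.2
    rw [perExt_eq, perExt_eq, M.evalAt_of_mem x.2, M.evalAt_of_mem x.2, wrap_of_mem hy.2] at this
    rw [ContinuousMap.smul_apply, ← this, smul_smul, inv_mul_cancel₀ (M.ρ_pos _).ne', one_smul]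

/-- The density is periodic, so dividing by it commutes with the trace and contributes nothing to
the consistency error. -/
theorem divρ_trace {ε : ℝ} (hε : 0 < ε) (hε1 : ε ≤ 1) (w : M.PerField p) :
    M.divρ p hp ε⁻¹ (M.trace p hp hε hε1 w) = M.trace p hp hε hε1 (M.cellDivρ p hp w) := by
  refine Lp.ext ?_
  have hm : StronglyMeasurable fun y => (M.ρ y)⁻¹ • w y :=
    M.measurable_ρ.inv.stronglyMeasurable.smul (Lp.stronglyMeasurable w)
  filter_upwards [M.coeFn_divρ p hp ε⁻¹ (M.trace p hp hε hε1 w),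
    M.coeFn_trace p hp hε hε1 (Lp.stronglyMeasurable w) EventuallyEq.rfl,
    M.coeFn_trace p hp hε hε1 hm (M.coeFn_cellDivρ p hp w)] with x h1 h2 h3
  rw [h1, h2, h3, map_smul, ρ_wrap]

end

end Composite

namespace Composite

variable (M : Composite)

/-! ### The long-range operators on continuous fields -/

/-- The pointwise action of a linear map on continuous fields. -/
def fieldMap (L : E3 →L[ℝ] E3) : C(closure M.Ω, E3) →L[ℝ] C(closure M.Ω, E3) :=
  L.compLeftContinuous ℝ (closure M.Ω)

theorem fieldMap_apply (L : E3 →L[ℝ] E3) (φ : C(closure M.Ω, E3)) (x : closure M.Ω) :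
    M.fieldMap L φ x = L (φ x) := rfl

theorem norm_fieldMap_le (L : E3 →L[ℝ] E3) : ‖M.fieldMap L‖ ≤ ‖L‖ := by
  refine ContinuousLinearMap.opNorm_le_bound _ (norm_nonneg _) fun φ => ?_
  refine (ContinuousMap.norm_le _ (by positivity)).2 fun x => ?_
  exact (L.le_opNorm _).trans (by gcongr; exact φ.norm_coe_le_norm x)

theorem continuous_fieldMap :
    Continuous fun q : (E3 →L[ℝ] E3) × C(closure M.Ω, E3) => M.fieldMap q.1 q.2 := by
  refine ContinuousMap.continuous_of_continuous_uncurry _ ?_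
  change Continuous fun q : ((E3 →L[ℝ] E3) × C(closure M.Ω, E3)) × closure M.Ω =>
    q.1.1 (q.1.2 q.2)
  fun_prop

theorem evalAt_fieldMap (L : E3 →L[ℝ] E3) (φ : C(closure M.Ω, E3)) (x : E3) :
    M.evalAt E3 x (M.fieldMap L φ) = L (M.evalAt E3 x φ) := by
  by_cases h : x ∈ closure M.Ω
  · rw [M.evalAt_of_mem h, M.evalAt_of_mem h, fieldMap_apply]
  · rw [M.evalAt_of_notMem h, M.evalAt_of_notMem h, map_zero]

/-- The extension by zero from `Ω` of a continuous field. -/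
def innerField (φ : C(closure M.Ω, E3)) : E3 → E3 := M.Ω.indicator fun x => M.evalAt E3 x φ

theorem stronglyMeasurable_innerField (φ : C(closure M.Ω, E3)) :
    StronglyMeasurable (M.innerField φ) :=
  (M.stronglyMeasurable_evalAt φ).indicator M.measurableSet_Ω

theorem norm_innerField_le (φ : C(closure M.Ω, E3)) (x : E3) : ‖M.innerField φ x‖ ≤ ‖φ‖ := by
  refine (norm_indicator_le_norm_self _ _).trans (M.norm_evalAt_apply_le x φ)

theorem innerField_add (φ ψ : C(closure M.Ω, E3)) (x : E3) :
    M.innerField (φ + ψ) x = M.innerField φ x + M.innerField ψ x := by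
  by_cases h : x ∈ M.Ω <;> simp [innerField, h]

theorem innerField_smul (c : ℝ) (φ : C(closure M.Ω, E3)) (x : E3) :
    M.innerField (c • φ) x = c • M.innerField φ x := by
  by_cases h : x ∈ M.Ω <;> simp [innerField, h]

theorem integrable_horizonKernel_innerField (φ : C(closure M.Ω, E3)) (r : ℝ) (x : E3) :
    Integrable fun ξ => horizonKernel r ξ (M.innerField φ (x + ξ)) :=
  integrable_horizonKernel_apply r
    ((M.stronglyMeasurable_innerField φ).comp_measurable (measurable_const_add x))
    fun _ => M.norm_innerField_le φ _

/-- The operator `φ ↦ λ ∫ k(ξ) (1_Ω φ)(x + ξ) dξ` on continuous fields. -/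
def longGain : C(closure M.Ω, E3) →L[ℝ] C(closure M.Ω, E3) :=
  LinearMap.mkContinuous
    { toFun := fun φ =>
        ⟨fun x => M.lam • ∫ ξ, horizonKernel M.γ ξ (M.innerField φ (x + ξ)),
          ((continuous_integral_bilin (ContinuousLinearMap.apply ℝ E3).flip
            (integrable_horizonKernel M.γ) (M.stronglyMeasurable_innerField φ)
            (M.norm_innerField_le φ)).comp continuous_subtype_val).const_smul M.lam⟩
      map_add' := fun φ ψ => by
        ext1 x
        simp only [ContinuousMap.coe_mk, ContinuousMap.add_apply, innerField_add, map_add]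
        rw [integral_add (M.integrable_horizonKernel_innerField φ _ _)
          (M.integrable_horizonKernel_innerField ψ _ _), smul_add]
        rfl
      map_smul' := fun c φ => by
        ext1 x
        simp only [ContinuousMap.coe_mk, ContinuousMap.smul_apply, innerField_smul, map_smul,
          integral_smul, RingHom.id_apply]
        rw [smul_comm]
        rfl }
    (M.lam * ∫ ξ, ‖horizonKernel M.γ ξ‖) fun φ => by
      have h0 : 0 ≤ ∫ ξ, ‖horizonKernel M.γ ξ‖ := integral_nonneg fun _ => norm_nonneg _
      have hl := M.lam_pos.le
      refine (ContinuousMap.norm_le _ (by positivity)).2 fun x => ?_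
      change ‖M.lam • ∫ ξ, horizonKernel M.γ ξ (M.innerField φ (x + ξ))‖ ≤ _
      rw [norm_smul, Real.norm_of_nonneg hl, mul_assoc]
      gcongr
      exact norm_integral_horizonKernel_le _ fun ξ => M.norm_innerField_le φ _

theorem longGain_apply (φ : C(closure M.Ω, E3)) (x : closure M.Ω) :
    M.longGain φ x = M.lam • ∫ ξ, horizonKernel M.γ ξ (M.innerField φ (x + ξ)) := rfl

/-- The matrix field `λ ∫ 1_Ω(x + ξ) k(ξ) dξ`. -/
def longStiffness : C(closure M.Ω, E3 →L[ℝ] E3) :=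
  ⟨fun x => M.lam • ∫ ξ, M.Ω.indicator (1 : E3 → ℝ) (x + ξ) • horizonKernel M.γ ξ,
    ((continuous_integral_bilin (ContinuousLinearMap.lsmul ℝ ℝ).flip
      (integrable_horizonKernel M.γ)
      (measurable_one.indicator M.measurableSet_Ω).stronglyMeasurable (C := 1) (fun x => by
        by_cases h : x ∈ M.Ω <;> simp [h])).comp continuous_subtype_val).const_smul M.lam⟩

/-- Multiplication by `longStiffness`. -/
def longLoss : C(closure M.Ω, E3) →L[ℝ] C(closure M.Ω, E3) :=
  LinearMap.mkContinuous
    { toFun := fun φ => ⟨fun x => M.longStiffness x (φ x), by fun_prop⟩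
      map_add' := fun φ ψ => by ext1 x; simp
      map_smul' := fun c φ => by ext1 x; simp }
    ‖M.longStiffness‖ fun φ => by
      refine (ContinuousMap.norm_le _ (by positivity)).2 fun x => ?_
      refine ((M.longStiffness x).le_opNorm _).trans ?_
      gcongr
      exacts [M.longStiffness.norm_coe_le_norm x, φ.norm_coe_le_norm x]

theorem longLoss_apply (φ : C(closure M.Ω, E3)) (x : closure M.Ω) :
    M.longLoss φ x = M.longStiffness x (φ x) := rfl

theorem integrable_indicator_horizonKernel (r : ℝ) (x : E3) :
    Integrable fun ξ => M.Ω.indicator (1 : E3 → ℝ) (x + ξ) • horizonKernel r ξ := by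
  have hm : Measurable fun ξ => M.Ω.indicator (1 : E3 → ℝ) (x + ξ) :=
    (measurable_one.indicator M.measurableSet_Ω).comp (measurable_const_add x)
  exact integrable_smul_of_norm_le_one hm
    (fun ξ => by by_cases h : x + ξ ∈ M.Ω <;> simp [h]) (integrable_horizonKernel r)

/-- φ and ψ are independent because the limit equation compares the cell average at `x + ξ` with the
field at one fixed y. -/
theorem longGain_sub_longLoss (φ ψ : C(closure M.Ω, E3)) (x : closure M.Ω) :
    M.longGain φ x - M.longLoss ψ x =
      M.nonlocalAt 1 M.γ M.lamCoeff x (fun z => M.evalAt E3 z φ) (ψ x) := by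
  rw [longGain_apply, longLoss_apply]
  change _ - (M.lam • ∫ ξ, M.Ω.indicator (1 : E3 → ℝ) (x + ξ) • horizonKernel M.γ ξ) (ψ x) = _
  have hi := M.integrable_indicator_horizonKernel M.γ x
  rw [smul_apply, ContinuousLinearMap.integral_apply hi, ← smul_sub,
    ← integral_sub (M.integrable_horizonKernel_innerField φ _ _) (hi.apply_continuousLinearMap _),
    ← integral_smul, nonlocalAt]
  refine integral_congr_ae (Eventually.of_forall fun ξ => ?_)
  by_cases h : (x : E3) + ξ ∈ M.Ω <;> simp [h, innerField, lamCoeff]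

/-! ### Nonlocal operators in the cell variable -/

/-- Schur data for `w ↦ ∫ α(y, y + ξ) k(ξ) w(y + ξ) dξ` on periodic fields. -/
def cellGainKernel : SchurKernel (volume.restrict unitCell) (volume.restrict unitCell)
    (volume : Measure E3) C(closure M.Ω, E3) C(closure M.Ω, E3) :=
  SchurKernel.ofHorizon _ M.fieldMap M.continuous_fieldMap M.norm_fieldMap_le M.δ
    (fun y ξ => wrap (y + ξ)) (measurable_wrap.comp (measurable_fst.add measurable_snd))
    (M.bondCoeff 1) (fun _ _ => 1) measurable_const (fun _ _ => le_rfl)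
    (fun x ξ => by rw [mul_one]; exact BoundedCoefficient.enorm_le _ x ξ)
    fun ξ g hg => by simpa using (setLIntegral_unitCell_wrap_add g ξ).le

/-- Schur data for `w ↦ ∫ α(y, y + ξ) k(ξ) w(y) dξ` on periodic fields. -/
def cellLossKernel : SchurKernel (volume.restrict unitCell) (volume.restrict unitCell)
    (volume : Measure E3) C(closure M.Ω, E3) C(closure M.Ω, E3) :=
  SchurKernel.ofHorizon _ M.fieldMap M.continuous_fieldMap M.norm_fieldMap_le M.δ
    (fun y _ => y) measurable_fst
    (M.bondCoeff 1) (fun _ _ => 1) measurable_const (fun _ _ => le_rfl)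
    (fun x ξ => by rw [mul_one]; exact BoundedCoefficient.enorm_le _ x ξ)
    fun ξ g hg => by simp

/-- Schur data for `w ↦ longGain (∫ w)`. -/
def meanGainKernel : SchurKernel (volume.restrict unitCell) (volume.restrict unitCell)
    (volume.restrict unitCell) C(closure M.Ω, E3) C(closure M.Ω, E3) where
  σ _ y := y
  Φ _ _ := M.longGain
  weight _ _ := ‖M.longGain‖ₑ
  C := ‖M.longGain‖₊
  measurable_weight := measurable_const
  measurable_σ := measurable_snd
  stronglyMeasurable v hv :=
    M.longGain.continuous.comp_stronglyMeasurable (hv.comp_measurable measurable_snd)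
  enorm_le _ _ := le_rfl
  lintegral_weight_le _ := by simp [enorm_eq_nnnorm]
  lintegral_lintegral_le g hg := by
    simp only [lintegral_const, measure_univ, mul_one]
    rw [lintegral_const_mul _ hg, enorm_eq_nnnorm]

section

variable (p : ℝ≥0∞) [Fact (1 ≤ p)] (hp : p ≠ ∞)

/-- The short-range operator on periodic fields. -/
def cellNonlocal : M.PerField p →L[ℝ] M.PerField p :=
  M.cellGainKernel.toCLM p hp - M.cellLossKernel.toCLM p hp

/-- The long-range operator on periodic fields. -/
def cellLong : M.PerField p →L[ℝ] M.PerField p :=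
  M.meanGainKernel.toCLM p hp - M.longLoss.compLpL p (volume.restrict unitCell)

/-- The integrand of the short-range operator. -/
def cellIntegrand (w : E3 → C(closure M.Ω, E3)) (y ξ : E3) : C(closure M.Ω, E3) :=
  M.α y (y + ξ) • M.fieldMap (horizonKernel M.δ ξ) (w (wrap (y + ξ)) - w y)

/-- The integral is a Bochner integral of continuous fields. Recording integrability allows
evaluation at every x simultaneously, with an exceptional null set of y independent of x. -/
theorem coeFn_cellNonlocal {v : M.PerField p} {w : E3 → C(closure M.Ω, E3)}
    (hw : StronglyMeasurable w) (h : v =ᵐ[volume.restrict unitCell] w) :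
    ∀ᵐ y ∂(volume.restrict unitCell), Integrable (M.cellIntegrand w y) ∧
      M.cellNonlocal p hp v y = ∫ ξ, M.cellIntegrand w y ξ := by
  have hwp : MemLp w p (volume.restrict unitCell) := (memLp_congr_ae h).1 (Lp.memLp v)
  filter_upwards [Lp.coeFn_sub (M.cellGainKernel.toCLM p hp v) (M.cellLossKernel.toCLM p hp v),
    M.cellGainKernel.coeFn_toCLM_of_ae_eq p hp hw h,
    M.cellLossKernel.coeFn_toCLM_of_ae_eq p hp hw h,
    M.cellGainKernel.ae_integrable hw Fact.out hp hwp,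
    M.cellLossKernel.ae_integrable hw Fact.out hp hwp] with y h1 h2 h3 h4 h5
  have heq : (fun ξ => M.cellGainKernel.Φ y ξ (w (M.cellGainKernel.σ y ξ)) -
      M.cellLossKernel.Φ y ξ (w (M.cellLossKernel.σ y ξ))) = M.cellIntegrand w y := by
    ext1 ξ
    change (M.α ((1 : ℝ) • y) ((1 : ℝ) • y + ξ) • M.fieldMap (horizonKernel M.δ ξ))
        (w (wrap (y + ξ))) - (M.α ((1 : ℝ) • y) ((1 : ℝ) • y + ξ) •
        M.fieldMap (horizonKernel M.δ ξ)) (w y) = _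
    rw [one_smul, ← map_sub]
    rfl
  refine ⟨heq ▸ h4.sub h5, ?_⟩
  rw [← heq, integral_sub h4 h5]
  refine h1.trans ?_
  rw [Pi.sub_apply, h2, h3]
  rfl

theorem integrable_perField (w : M.PerField p) : Integrable w (volume.restrict unitCell) :=
  (Lp.memLp w).integrable Fact.out

theorem coeFn_cellLong (w : M.PerField p) :
    ∀ᵐ y ∂(volume.restrict unitCell), M.cellLong p hp w y =
      M.longGain (∫ y in unitCell, w y) - M.longLoss (w y) := by
  filter_upwards [Lp.coeFn_sub (M.meanGainKernel.toCLM p hp w)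
      (M.longLoss.compLpL p (volume.restrict unitCell) w),
    M.meanGainKernel.coeFn_toCLM p hp w, M.longLoss.coeFn_compLpL w] with y h1 h2 h3
  refine h1.trans ?_
  rw [Pi.sub_apply, h2, h3]
  congr 1
  exact M.longGain.integral_comp_comm (M.integrable_perField p w)

theorem evalAt_integral (w : M.PerField p) (x : E3) :
    M.evalAt E3 x (∫ y in unitCell, w y) = ∫ y in unitCell, perExt w x y := by
  rw [← (M.evalAt E3 x).integral_comp_comm (M.integrable_perField p w)]
  refine setIntegral_congr_fun measurableSet_unitCell fun y hy => ?_
  rw [perExt_eq, wrap_of_mem hy]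

theorem perExt_cellLong (w : M.PerField p) :
    ∀ᵐ y : E3, ∀ x ∈ closure M.Ω, perExt (M.cellLong p hp w) x y =
      ∫ z in Metric.ball x M.γ ∩ M.Ω,
        M.lam • bond (z - x) ((∫ y' in unitCell, perExt w z y') - perExt w x y) := by
  filter_upwards [quasiMeasurePreserving_wrap.ae (M.coeFn_cellLong p hp w)] with y hy x hx
  rw [perExt_eq, hy, M.evalAt_of_mem hx, ContinuousMap.sub_apply, longGain_sub_longLoss,
    nonlocalAt_eq_setIntegral _ one_pos]
  simp only [one_mul, evalAt_integral, perExt_eq, M.evalAt_of_mem hx, one_pow, div_one]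
  rfl

theorem perExt_cellNonlocal (w : M.PerField p) :
    ∀ᵐ y : E3, ∀ x ∈ closure M.Ω, perExt (M.cellNonlocal p hp w) x y =
      ∫ z in Metric.ball y M.δ, M.α y z • bond (z - y) (perExt w x z - perExt w x y) := by
  filter_upwards [quasiMeasurePreserving_wrap.ae (M.coeFn_cellNonlocal p hp
    (Lp.stronglyMeasurable w) EventuallyEq.rfl)] with y hy x hx
  rw [perExt_eq, hy.2, ← (M.evalAt E3 x).integral_comp_comm hy.1,
    ← integral_indicator Metric.isOpen_ball.measurableSet,
    ← integral_add_left_eq_self ((Metric.ball y M.δ).indicator _) y]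
  refine integral_congr_ae (Eventually.of_forall fun ξ => ?_)
  have hb : y + ξ ∈ Metric.ball y M.δ ↔ ξ ∈ Metric.ball (0 : E3) M.δ := by
    rw [mem_ball_iff_norm, add_sub_cancel_left, mem_ball_zero_iff]
  have hα : M.α (wrap y) (wrap y + ξ) = M.α y (y + ξ) :=
    M.α_congr_wrap (wrap_wrap y) (wrap_wrap_add y ξ)
  dsimp only
  rw [cellIntegrand, map_smul, evalAt_fieldMap, map_sub, hα, wrap_wrap_add, horizonKernel]
  by_cases h : ξ ∈ Metric.ball (0 : E3) M.δ
  · rw [indicator_of_mem h, indicator_of_mem (hb.2 h), bondCLM_apply, add_sub_cancel_left,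
      perExt_eq, perExt_eq]
  · rw [indicator_of_notMem h, indicator_of_notMem fun h' => h (hb.1 h')]
    simp

end

end Composite

/-! ### Linear second-order equations in Banach spaces -/

section

variable {X : Type*} [NormedAddCommGroup X] [NormedSpace ℝ X]

theorem HasDerivWithinAt.Ici_of_Icc {u : ℝ → X} {v : X} {T t : ℝ} (ht : t ∈ Ico 0 T)
    (h : HasDerivWithinAt u v (Icc 0 T) t) : HasDerivWithinAt u v (Ici t) t :=
  h.mono_of_mem_nhdsWithin (Icc_mem_nhdsGE_of_mem ht)

/-- Gronwall's inequality for the pair (u, u') in the maximum norm, whose derivative is bounded by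
`(L + 1) ‖(u, u')‖ + η`. The rate `L + 1` covers both components and is never zero. -/
theorem norm_le_of_second_order {u u' u'' : ℝ → X} {T L η : ℝ} (hL : 0 ≤ L) (hη : 0 ≤ η)
    (h1 : ∀ t ∈ Icc 0 T, HasDerivWithinAt u (u' t) (Icc 0 T) t)
    (h2 : ∀ t ∈ Icc 0 T, HasDerivWithinAt u' (u'' t) (Icc 0 T) t)
    (h0 : u 0 = 0) (h0' : u' 0 = 0) (hb : ∀ t ∈ Icc 0 T, ‖u'' t‖ ≤ L * ‖u t‖ + η) :
    ∀ t ∈ Icc 0 T, ‖u t‖ ≤ η * ((Real.exp ((L + 1) * T) - 1) / (L + 1)) := by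
  intro t ht
  have key := norm_le_gronwallBound_of_norm_deriv_right_le (f := fun t => (u t, u' t))
    (f' := fun t => (u' t, u'' t)) (δ := 0) (K := L + 1) (ε := η) (a := 0) (b := T)
    (fun t ht => ((h1 t ht).continuousWithinAt.prodMk (h2 t ht).continuousWithinAt))
    (fun t ht => ((h1 t ⟨ht.1, ht.2.le⟩).Ici_of_Icc ht).prodMk
      ((h2 t ⟨ht.1, ht.2.le⟩).Ici_of_Icc ht)) (by simp [h0, h0'])
    (fun t ht => by
      have hf : ‖u t‖ ≤ ‖(u t, u' t)‖ := norm_fst_le (u t, u' t)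
      have hs : ‖u' t‖ ≤ ‖(u t, u' t)‖ := norm_snd_le (u t, u' t)
      have hn : 0 ≤ ‖(u t, u' t)‖ := norm_nonneg _
      refine max_le ?_ ?_
      · change ‖u' t‖ ≤ _
        nlinarith [mul_nonneg hL hn]
      · change ‖u'' t‖ ≤ _
        nlinarith [hb t ⟨ht.1, ht.2.le⟩, mul_le_mul_of_nonneg_left hf hL]) t ht
  rw [gronwallBound_of_K_ne_0 (by positivity)] at key
  simp only [zero_mul, zero_add, sub_zero] at key
  refine ((norm_fst_le (u t, u' t)).trans key).trans ?_
  rw [div_mul_eq_mul_div, mul_div_assoc]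
  gcongr
  exact ht.2

/-- Duhamel's formula for the first-order system `U' = B U + (0, F)` on X × X, with the
norm-convergent exponential of `tB`. -/
theorem exists_second_order [CompleteSpace X] (A : X →L[ℝ] X) {F : ℝ → X} (hF : Continuous F)
    (u₀ v₀ : X) : ∃ u u' : ℝ → X, (∀ t, HasDerivAt u (u' t) t) ∧
      (∀ t, HasDerivAt u' (A (u t) + F t) t) ∧ u 0 = u₀ ∧ u' 0 = v₀ := by
  let B : X × X →L[ℝ] X × X :=
    (ContinuousLinearMap.snd ℝ X X).prod (A.comp (ContinuousLinearMap.fst ℝ X X))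
  let : NormedAlgebra ℚ (X × X →L[ℝ] X × X) := NormedAlgebra.restrictScalars ℚ ℝ _
  let S : ℝ → (X × X →L[ℝ] X × X) := fun t => NormedSpace.exp (t • B)
  have hS : ∀ t, HasDerivAt S (B * S t) t := fun t => hasDerivAt_exp_smul_const' B t
  have hSc : Continuous S := continuous_iff_continuousAt.2 fun t => (hS t).continuousAt
  have hinv : ∀ t, S t * S (-t) = 1 := fun t => by
    simp only [S]
    rw [← NormedSpace.exp_add_of_commute
      ((Commute.refl B).smul_left t |>.smul_right (-t)), ← add_smul, add_neg_cancel, zero_smul,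
      NormedSpace.exp_zero]
  let G : ℝ → X × X := fun s => S (-s) (0, F s)
  have hG : Continuous G := (hSc.comp continuous_neg).clm_apply (by fun_prop)
  let I : ℝ → X × X := fun t => (u₀, v₀) + ∫ s in (0 : ℝ)..t, G s
  have hI : ∀ t, HasDerivAt I (G t) t := fun t =>
    (intervalIntegral.integral_hasDerivAt_right (hG.intervalIntegrable _ _)
      (hG.stronglyMeasurableAtFilter _ _) hG.continuousAt).const_add _
  let U : ℝ → X × X := fun t => S t (I t)
  have hU : ∀ t, HasDerivAt U (B (U t) + (0, F t)) t := fun t => by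
    have h := (hS t).clm_apply (hI t)
    have h2 : S t (G t) = (0, F t) := by
      change (S t * S (-t)) (0, F t) = _
      rw [hinv]; rfl
    rw [h2] at h
    exact h
  have hU0 : U 0 = (u₀, v₀) := by
    simp [U, I, S]
  refine ⟨fun t => (U t).1, fun t => (U t).2, fun t => ?_, fun t => ?_,
    congrArg Prod.fst hU0, congrArg Prod.snd hU0⟩
  · have := (ContinuousLinearMap.fst ℝ X X).hasFDerivAt.comp_hasDerivAt t (hU t)
    simpa [B, Function.comp_def] using this
  · have := (ContinuousLinearMap.snd ℝ X X).hasFDerivAt.comp_hasDerivAt t (hU t)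
    simpa [B, Function.comp_def] using this

/-- A function in `C²([0,T]; X)` solving `u'' = A u + F` with given initial data. -/
structure SolvesIVP (T : ℝ) (A : X →L[ℝ] X) (F : ℝ → X) (u₀ v₀ : X) (u : ℝ → X) : Prop where
  contDiffOn : ContDiffOn ℝ 2 u (Icc 0 T)
  equation : ∀ t ∈ Icc 0 T, iteratedDerivWithin 2 u (Icc 0 T) t = A (u t) + F t
  initial : u 0 = u₀
  initial_deriv : derivWithin u (Icc 0 T) 0 = v₀

variable {T : ℝ} {A : X →L[ℝ] X} {F : ℝ → X} {u₀ v₀ : X} {u : ℝ → X}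

theorem ContDiffOn.hasDerivWithinAt_two (hT : 0 < T) (h : ContDiffOn ℝ 2 u (Icc 0 T)) :
    ∀ t ∈ Icc 0 T, HasDerivWithinAt u (derivWithin u (Icc 0 T) t) (Icc 0 T) t ∧
      HasDerivWithinAt (derivWithin u (Icc 0 T))
        (iteratedDerivWithin 2 u (Icc 0 T) t) (Icc 0 T) t := by
  intro t ht
  have hU := uniqueDiffOn_Icc hT
  have h1 : ContDiffOn ℝ 1 (derivWithin u (Icc 0 T)) (Icc 0 T) :=
    h.derivWithin hU (by norm_num)
  refine ⟨(h.differentiableOn (by norm_num) t ht).hasDerivWithinAt, ?_⟩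
  have h2 : iteratedDerivWithin 2 u (Icc 0 T) t =
      derivWithin (derivWithin u (Icc 0 T)) (Icc 0 T) t := by
    rw [iteratedDerivWithin_succ]
    rw [iteratedDerivWithin_one]
  rw [h2]
  exact (h1.differentiableOn (by norm_num) t ht).hasDerivWithinAt

theorem exists_solvesIVP [CompleteSpace X] (hT : 0 < T) (A : X →L[ℝ] X)
    (hF : ContinuousOn F (Icc 0 T)) (u₀ v₀ : X) : ∃ u, SolvesIVP T A F u₀ v₀ u := by
  -- F is extended by its endpoint values, so that the equation can be solved on the whole line and
  -- then restricted.
  have hF' : Continuous (IccExtend hT.le ((Icc 0 T).domRestrict F)) :=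
    (continuousOn_iff_continuous_domRestrict.1 hF).Icc_extend'
  obtain ⟨u, u', h1, h2, h3, h4⟩ := exists_second_order A hF' u₀ v₀
  have hU := uniqueDiffOn_Icc hT
  have hd1 : deriv u = u' := funext fun t => (h1 t).deriv
  have hd2 : deriv u' = fun t => A (u t) + IccExtend hT.le ((Icc 0 T).domRestrict F) t :=
    funext fun t => (h2 t).deriv
  have hcu : Continuous u := continuous_iff_continuousAt.2 fun t => (h1 t).continuousAt
  have hcd : ContDiff ℝ 2 u := by
    have hu' : ContDiff ℝ 1 u' := by
      rw [contDiff_one_iff_deriv]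
      exact ⟨fun t => (h2 t).differentiableAt, by rw [hd2]; fun_prop⟩
    have : ContDiff ℝ (1 + 1) u := by
      rw [contDiff_succ_iff_deriv]
      exact ⟨fun t => (h1 t).differentiableAt, by simp, by rwa [hd1]⟩
    exact this.of_le (by norm_num [one_add_one_eq_two])
  have hw1 : EqOn (derivWithin u (Icc 0 T)) u' (Icc 0 T) := fun t ht =>
    (h1 t).hasDerivWithinAt.derivWithin (hU t ht)
  have h0 : (0 : ℝ) ∈ Icc 0 T := ⟨le_rfl, hT.le⟩
  refine ⟨u, hcd.contDiffOn, fun t ht => ?_, h3, by rw [hw1 h0, h4]⟩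
  have h := (hcd.contDiffOn.hasDerivWithinAt_two hT t ht).2
  have h' : HasDerivWithinAt (derivWithin u (Icc 0 T))
      (A (u t) + IccExtend hT.le ((Icc 0 T).domRestrict F) t) (Icc 0 T) t :=
    ((h2 t).hasDerivWithinAt).congr hw1 (hw1 ht)
  rw [(hU t ht).eq_deriv _ h h', IccExtend_of_mem _ _ ht]
  rfl

namespace SolvesIVP

/-- The difference between a solution and the image of a solution of another equation is controlled
by the consistency error. -/
theorem norm_sub_map_le {Z : Type*} [NormedAddCommGroup Z] [NormedSpace ℝ Z] (hT : 0 < T)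
    (hu : SolvesIVP T A F u₀ v₀ u) {B : Z →L[ℝ] Z} {E : X →L[ℝ] Z} {z : ℝ → Z}
    (hz : SolvesIVP T B (fun t => E (F t)) (E u₀) (E v₀) z) {L η : ℝ} (hL : ‖B‖ ≤ L) (hη : 0 ≤ η)
    (hE : ∀ t ∈ Icc 0 T, ‖B (E (u t)) - E (A (u t))‖ ≤ η) :
    ∀ t ∈ Icc 0 T, ‖z t - E (u t)‖ ≤ η * ((Real.exp ((L + 1) * T) - 1) / (L + 1)) := by
  have hu1 := hu.contDiffOn.hasDerivWithinAt_two hT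
  have hz1 := hz.contDiffOn.hasDerivWithinAt_two hT
  refine norm_le_of_second_order ((norm_nonneg B).trans hL) hη
    (u' := fun t => derivWithin z (Icc 0 T) t - E (derivWithin u (Icc 0 T) t))
    (u'' := fun t => (B (z t) + E (F t)) - E (A (u t) + F t))
    (fun t ht => (hz1 t ht).1.sub (E.hasFDerivAt.comp_hasDerivWithinAt t (hu1 t ht).1))
    (fun t ht => ?_) (by rw [hz.initial, hu.initial, sub_self])
    (by rw [hz.initial_deriv, hu.initial_deriv, sub_self]) fun t ht => ?_
  · have h := (hz1 t ht).2.sub (E.hasFDerivAt.comp_hasDerivWithinAt t (hu1 t ht).2)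
    rw [hz.equation t ht, hu.equation t ht] at h
    exact h
  -- The error e = z - E u satisfies `e'' = B e + (B E - E A) u`: a stable equation driven by the
  -- consistency error.
  · have : B (z t) + E (F t) - E (A (u t) + F t) =
        B (z t - E (u t)) + (B (E (u t)) - E (A (u t))) := by
      rw [map_add, map_sub]; abel
    rw [this]
    exact (norm_add_le _ _).trans (add_le_add (B.le_of_opNorm_le hL _) (hE t ht))

/-- The case E = id, B = A of the comparison estimate, where the consistency error is zero. -/
theorem eqOn (hT : 0 < T) {w : ℝ → X} (hu : SolvesIVP T A F u₀ v₀ u)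
    (hw : SolvesIVP T A F u₀ v₀ w) : EqOn w u (Icc 0 T) := fun t ht => by
  have h := hu.norm_sub_map_le hT (B := A) (E := ContinuousLinearMap.id ℝ X) (z := w) hw le_rfl
    le_rfl (fun t _ => by simp) t ht
  rw [zero_mul] at h
  exact sub_eq_zero.1 (norm_le_zero_iff.1 h)

end SolvesIVP

/-- Pointwise convergence of equibounded operators is uniform on compact sets. -/
theorem tendstoUniformlyOn_of_pointwise {Z : Type*} [NormedAddCommGroup Z] [NormedSpace ℝ Z]
    {D : ℕ → X →L[ℝ] Z} {C : ℝ} (hC : ∀ n, ‖D n‖ ≤ C)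
    (hD : ∀ x, Tendsto (fun n => D n x) atTop (𝓝 0)) {K : Set X} (hK : IsCompact K) {η : ℝ}
    (hη : 0 < η) : ∀ᶠ n in atTop, ∀ x ∈ K, ‖D n x‖ ≤ η := by
  have hC0 : 0 ≤ C := (norm_nonneg _).trans (hC 0)
  -- The radius makes C times it at most η / 2; C + 1 replaces C so that C = 0 causes no division by
  -- zero.
  obtain ⟨s, hs, hcov⟩ := Metric.totallyBounded_iff.1 hK.totallyBounded
    (η / (2 * (C + 1))) (by positivity)
  have h1 : ∀ᶠ n in atTop, ∀ x ∈ s, ‖D n x‖ < η / 2 := by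
    rw [eventually_all_finite hs]
    intro x _
    have := (hD x).norm
    rw [norm_zero] at this
    exact this.eventually_lt_const (half_pos hη)
  filter_upwards [h1] with n hn x hx
  obtain ⟨y, hy, hxy⟩ := mem_iUnion₂.1 (hcov hx)
  rw [mem_ball_iff_norm] at hxy
  have h2 : ‖D n (x - y)‖ ≤ C * (η / (2 * (C + 1))) :=
    ((D n).le_of_opNorm_le (hC n) _).trans (by gcongr)
  have h3 : C * (η / (2 * (C + 1))) ≤ η / 2 := by
    rw [mul_div_assoc', div_le_div_iff₀ (by positivity) (by positivity)]
    nlinarith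
  calc ‖D n x‖ = ‖D n (x - y) + D n y‖ := by rw [← map_add, sub_add_cancel]
    _ ≤ ‖D n (x - y)‖ + ‖D n y‖ := norm_add_le _ _
    _ ≤ η := by linarith [hn y hy]

end

/-! ### Strong convergence in Lebesgue spaces -/

/-- Bounded convergence in `L^p` of a finite measure. -/
theorem tendsto_Lp_zero_of_bounded {α E : Type*} [MeasurableSpace α] {μ : Measure α}
    [IsFiniteMeasure μ] [NormedAddCommGroup E] {p : ℝ≥0∞} [Fact (1 ≤ p)] (hp : p ≠ ∞)
    {f : ℕ → Lp E p μ} {C : ℝ} (hC : ∀ n, ∀ᵐ x ∂μ, ‖f n x‖ ≤ C)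
    (hlim : ∀ᵐ x ∂μ, Tendsto (fun n => f n x) atTop (𝓝 0)) :
    Tendsto f atTop (𝓝 0) := by
  have hp1 : (1 : ℝ≥0∞) ≤ p := Fact.out
  have hp0 : p ≠ 0 := (zero_lt_one.trans_le hp1).ne'
  have hq0 : 0 < p.toReal := ENNReal.toReal_pos hp0 hp
  have hlint : Tendsto (fun n => ∫⁻ x, ‖f n x‖ₑ ^ p.toReal ∂μ) atTop (𝓝 (∫⁻ _, 0 ∂μ)) := by
    refine tendsto_lintegral_of_dominated_convergence (fun _ => ENNReal.ofReal C ^ p.toReal)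
      (fun n => (Lp.stronglyMeasurable (f n)).enorm.pow_const _) (fun n => ?_) ?_ ?_
    · filter_upwards [hC n] with x hx
      rw [← ofReal_norm]
      gcongr
    · rw [lintegral_const]
      exact (ENNReal.mul_lt_top (ENNReal.rpow_lt_top_of_nonneg hq0.le ENNReal.ofReal_ne_top)
        (measure_lt_top μ univ)).ne
    · filter_upwards [hlim] with x hx
      have h := (ENNReal.continuous_rpow_const (y := p.toReal)).tendsto 0 |>.comp
        (by simpa using hx.enorm)
      rwa [ENNReal.zero_rpow_of_pos hq0] at h
  rw [lintegral_zero] at hlint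
  refine Lp.tendsto_Lp_iff_tendsto_eLpNorm' _ _ |>.2 ?_
  have h := (ENNReal.continuous_rpow_const (y := 1 / p.toReal)).tendsto 0 |>.comp hlint
  rw [ENNReal.zero_rpow_of_pos (by positivity)] at h
  refine h.congr fun n => ?_
  rw [Function.comp_apply, ← eLpNorm_eq_lintegral_rpow_enorm_toReal hp0 hp]
  refine eLpNorm_congr_ae ?_
  filter_upwards [Lp.coeFn_zero E p μ] with x hx
  rw [Pi.sub_apply, hx]
  simp

/-- With equibounded operators, convergence to zero at nearby points passes to the limit point. This
is the closedness step in the two density arguments. -/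
theorem isClosed_setOf_tendsto_zero {X Z : Type*} [NormedAddCommGroup X] [NormedSpace ℝ X]
    [NormedAddCommGroup Z] [NormedSpace ℝ Z] {D : ℕ → X →L[ℝ] Z} {C : ℝ} (hC : ∀ n, ‖D n‖ ≤ C) :
    IsClosed {x | Tendsto (fun n => D n x) atTop (𝓝 0)} := by
  have hC0 : 0 ≤ C := (norm_nonneg _).trans (hC 0)
  refine isClosed_of_closure_subset fun x hx => ?_
  rw [mem_ofPred_eq, Metric.tendsto_atTop]
  intro η hη
  obtain ⟨y, hy, hxy⟩ := Metric.mem_closure_iff.1 hx (η / (2 * (C + 1))) (by positivity)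
  obtain ⟨N, hN⟩ := Metric.tendsto_atTop.1 hy (η / 2) (half_pos hη)
  refine ⟨N, fun n hn => ?_⟩
  have h1 := hN n hn
  rw [dist_zero_right] at h1 ⊢
  rw [dist_eq_norm] at hxy
  have h2 : ‖D n (x - y)‖ ≤ C * (η / (2 * (C + 1))) :=
    ((D n).le_of_opNorm_le (hC n) _).trans (by gcongr)
  have h3 : C * (η / (2 * (C + 1))) ≤ η / 2 := by
    rw [mul_div_assoc', div_le_div_iff₀ (by positivity) (by positivity)]
    nlinarith
  calc ‖D n x‖ = ‖D n (x - y) + D n y‖ := by rw [← map_add, sub_add_cancel]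
    _ ≤ ‖D n (x - y)‖ + ‖D n y‖ := norm_add_le _ _
    _ < η := by linarith

/-! ### The evolution problems as equations with bounded generators -/

namespace Composite

variable (M : Composite)

instance : IsFiniteMeasure (volume.restrict M.Ω) :=
  ⟨by rw [Measure.restrict_apply_univ]; exact M.isBounded_Ω.measure_lt_top⟩

theorem ae_wrap_smul {c : ℝ} (hc : c ≠ 0) {P : E3 → Prop}
    (h : ∀ᵐ y ∂(volume.restrict unitCell), P y) :
    ∀ᵐ x ∂(volume.restrict M.Ω), P (wrap (c • x)) :=
  ae_restrict_of_ae ((quasiMeasurePreserving_wrap.comp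
    (Measure.quasiMeasurePreserving_smul volume hc)).ae h)

section

variable (p : ℝ≥0∞) [Fact (1 ≤ p)] (hp : p ≠ ∞)

/-- The generator of the two-scale equation. -/
def cellGenerator : M.PerField p →L[ℝ] M.PerField p :=
  (M.cellDivρ p hp).comp (M.cellLong p hp + M.cellNonlocal p hp)

/-- The generator of the equation at scale `ε`. -/
def generator (ε : ℝ) : M.LpField p →L[ℝ] M.LpField p :=
  (M.divρ p hp ε⁻¹).comp
    (M.nonlocal p hp 1 M.γ M.lamCoeff + M.nonlocal p hp ε M.δ (M.bondCoeff ε⁻¹))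

/-- A bound for the generators, uniform in the scale. -/
def generatorBound : ℝ :=
  M.invρBound * (2 * (M.lamCoeff.bound * horizonMass M.γ) + 2 * (M.αBound * horizonMass M.δ))

theorem norm_generator_le (ε : ℝ) : ‖M.generator p hp ε‖ ≤ M.generatorBound := by
  refine (ContinuousLinearMap.opNorm_comp_le _ _).trans ?_
  refine mul_le_mul (M.norm_divρ_le p hp _) ((norm_add_le _ _).trans (add_le_add
    (M.norm_nonlocal_le p hp _ _ _) (M.norm_nonlocal_le p hp _ _ _))) (norm_nonneg _)
    M.invρBound.2

variable {p}

/-- An element of L^p_per(Y; C(Ω̄)) is determined by its values at all x for almost every y, so the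
pointwise equation is equality in that space once ρ is divided out. -/
theorem isTwoScaleSolution_iff {T : ℝ} {u₀ v₀ : M.PerField p} {b u : ℝ → M.PerField p} :
    IsTwoScaleSolution T u₀ v₀ b u ↔
      SolvesIVP T (M.cellGenerator p hp) (fun t => M.cellDivρ p hp (b t)) u₀ v₀ u := by
  have key : ∀ t, (iteratedDerivWithin 2 u (Icc 0 T) t =
      M.cellGenerator p hp (u t) + M.cellDivρ p hp (b t)) ↔
      ∀ᵐ y : E3, ∀ x ∈ closure M.Ω,
        M.ρ y • perExt (iteratedDerivWithin 2 u (Icc 0 T) t) x y =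
          (∫ z in Metric.ball x M.γ ∩ M.Ω,
            M.lam • bond (z - x) ((∫ y' in unitCell, perExt (u t) z y') - perExt (u t) x y))
          + (∫ z in Metric.ball y M.δ,
              M.α y z • bond (z - y) (perExt (u t) x z - perExt (u t) x y))
          + perExt (b t) x y := fun t => by
    rw [cellGenerator, ContinuousLinearMap.comp_apply, ← map_add, eq_cellDivρ_iff, add_apply]
    have hsum : ∀ᵐ y : E3, ∀ x ∈ closure M.Ω,
        perExt (M.cellLong p hp (u t) + M.cellNonlocal p hp (u t) + b t) x y =
          (∫ z in Metric.ball x M.γ ∩ M.Ω,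
            M.lam • bond (z - x) ((∫ y' in unitCell, perExt (u t) z y') - perExt (u t) x y))
          + (∫ z in Metric.ball y M.δ,
              M.α y z • bond (z - y) (perExt (u t) x z - perExt (u t) x y))
          + perExt (b t) x y := by
      filter_upwards [perExt_add (M.cellLong p hp (u t) + M.cellNonlocal p hp (u t)) (b t),
        perExt_add (M.cellLong p hp (u t)) (M.cellNonlocal p hp (u t)),
        M.perExt_cellLong p hp (u t), M.perExt_cellNonlocal p hp (u t)] with y h1 h2 h3 h4 x hx
      rw [h1, h2, h3 x hx, h4 x hx]
    constructor
    · intro h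
      filter_upwards [h, hsum] with y h1 h2 x hx
      rw [h1 x hx, h2 x hx]
    · intro h
      filter_upwards [h, hsum] with y h1 h2 x hx
      rw [h1 x hx, h2 x hx]
  exact ⟨fun h => ⟨h.contDiffOn, fun t ht => (key t).2 (h.equation t ht), h.initial,
    h.initial_deriv⟩, fun h => ⟨h.contDiffOn, fun t ht => (key t).1 (h.equation t ht), h.initial,
    h.initial_deriv⟩⟩

/-- Solutions at scale ε are given, so one implication suffices. Forcing and data appear as traces
of those of the limit problem, the form that `SolvesIVP.norm_sub_map_le` requires. -/
theorem IsSolution.solvesIVP {T ε : ℝ} (hε : 0 < ε) (hε1 : ε ≤ 1) {u₀ v₀ : M.PerField p}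
    {b : ℝ → M.PerField p} {u : ℝ → M.LpField p} (h : IsSolution T ε u₀ v₀ b u) :
    SolvesIVP T (M.generator p hp ε) (fun t => M.trace p hp hε hε1 (M.cellDivρ p hp (b t)))
      (M.trace p hp hε hε1 u₀) (M.trace p hp hε hε1 v₀) u := by
  refine ⟨h.contDiffOn, fun t ht => ?_, ?_, ?_⟩
  · rw [← divρ_trace, generator, ContinuousLinearMap.comp_apply, ← map_add, eq_divρ_iff, add_apply]
    filter_upwards [h.equation t ht,
      Lp.coeFn_add (M.nonlocal p hp 1 M.γ M.lamCoeff (u t)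
        + M.nonlocal p hp ε M.δ (M.bondCoeff ε⁻¹) (u t)) (M.trace p hp hε hε1 (b t)),
      Lp.coeFn_add (M.nonlocal p hp 1 M.γ M.lamCoeff (u t))
        (M.nonlocal p hp ε M.δ (M.bondCoeff ε⁻¹) (u t)),
      M.coeFn_nonlocal p hp (s := 1) (r := M.γ) (a := M.lamCoeff)
        (Lp.stronglyMeasurable (u t)) EventuallyEq.rfl,
      M.coeFn_nonlocal p hp (s := ε) (r := M.δ) (a := M.bondCoeff ε⁻¹)
        (Lp.stronglyMeasurable (u t)) EventuallyEq.rfl,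
      M.coeFn_trace_perExt p hp hε hε1 (b t)] with x h1 h2 h3 h4 h5 h6
    rw [h1, h2, Pi.add_apply, h3, Pi.add_apply, h4, h5, h6, M.nonlocalAt_eq_setIntegral one_pos,
      M.nonlocalAt_eq_setIntegral hε]
    congr 2
    · simp [lamCoeff]
    · refine integral_congr_ae (Eventually.of_forall fun z => ?_)
      simp [bondCoeff, smul_sub]
  · refine Lp.ext ?_
    filter_upwards [h.initial, M.coeFn_trace_perExt p hp hε hε1 u₀] with x h1 h2
    rw [h1, h2]
  · refine Lp.ext ?_
    filter_upwards [h.initial_deriv, M.coeFn_trace_perExt p hp hε hε1 v₀] with x h1 h2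
    rw [h1, h2]

end

end Composite

/-! ### Pointwise limits of the nonlocal operators on step fields -/

theorem integrable_smul_horizonKernel_apply (r : ℝ) {b : E3 → ℝ} (hb : Measurable b) {v : E3 → E3}
    (hv : StronglyMeasurable v) {C : ℝ} (hC : ∀ ξ, ‖b ξ • v ξ‖ ≤ C) :
    Integrable fun ξ => (b ξ • horizonKernel r ξ) (v ξ) := by
  have h := integrable_horizonKernel_apply r (hb.stronglyMeasurable.smul hv) hC
  refine h.congr (Eventually.of_forall fun ξ => ?_)
  simp

theorem norm_integral_smul_horizonKernel_le (r : ℝ) {b : E3 → ℝ} {v : E3 → E3} {C : ℝ}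
    (hC : ∀ ξ, ‖b ξ • v ξ‖ ≤ C) :
    ‖∫ ξ, (b ξ • horizonKernel r ξ) (v ξ)‖ ≤ (∫ ξ, ‖horizonKernel r ξ‖) * C := by
  have h := norm_integral_horizonKernel_le r hC
  refine le_trans (le_of_eq ?_) h
  congr 1
  refine integral_congr_ae (Eventually.of_forall fun ξ => ?_)
  simp

namespace Composite

variable (M : Composite)

theorem norm_smul_coefficient_le (a : BoundedCoefficient) (x ξ v : E3) {C : ℝ} (hv : ‖v‖ ≤ C) :
    ‖a.toFun x ξ • v‖ ≤ a.bound * C := by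
  rw [norm_smul]
  exact mul_le_mul (a.norm_le x ξ) hv (norm_nonneg _) a.bound.2

theorem norm_nonlocalAt_le (s r : ℝ) (a : BoundedCoefficient) (x : E3) {v : E3 → E3} {c : E3}
    {C : ℝ} (hC : ∀ z, ‖v z - c‖ ≤ C) :
    ‖M.nonlocalAt s r a x v c‖ ≤ (∫ ξ, ‖horizonKernel r ξ‖) * (a.bound * C) :=
  norm_integral_smul_horizonKernel_le r fun ξ =>
    norm_smul_coefficient_le (M.cutCoeff s a) x ξ _ (hC _)

theorem integrable_nonlocalAt (s r : ℝ) (a : BoundedCoefficient) (x : E3) {v : E3 → E3}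
    (hv : StronglyMeasurable v) {C : ℝ} (hC : ∀ z, ‖v z‖ ≤ C) (c : E3) :
    Integrable fun ξ => ((M.Ω.indicator 1 (x + s • ξ) * a.toFun x ξ) • horizonKernel r ξ)
      (v (x + s • ξ) - c) := by
  have h : Measurable fun ξ : E3 => x + s • ξ := by fun_prop
  exact integrable_smul_horizonKernel_apply r ((M.cutCoeff s a).measurable.of_uncurry_left (x := x))
    ((hv.comp_measurable h).sub stronglyMeasurable_const) fun ξ =>
      norm_smul_coefficient_le (M.cutCoeff s a) x ξ _
        ((norm_sub_le _ _).trans (add_le_add_left (hC _) ‖c‖))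

/-- The field equal to `φ` for `y ∈ A` and zero otherwise. -/
def step (A : Set E3) (φ : C(closure M.Ω, E3)) : E3 → C(closure M.Ω, E3) := A.indicator fun _ => φ

/-- The trace of `step A φ` at scale `1/c`. -/
def stepTrace (A : Set E3) (φ : C(closure M.Ω, E3)) (c : ℝ) (x : E3) : E3 :=
  M.evalAt E3 x (M.step A φ (wrap (c • x)))

variable {A : Set E3} (φ : C(closure M.Ω, E3))

theorem step_eq_smul (y : E3) : M.step A φ y = A.indicator (1 : E3 → ℝ) y • φ := by
  by_cases h : y ∈ A
  · simp [step, h]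
  · rw [step, indicator_of_notMem h, indicator_of_notMem h]
    exact (zero_smul ℝ φ).symm

theorem norm_step_le (y : E3) : ‖M.step A φ y‖ ≤ ‖φ‖ := norm_indicator_le_norm_self _ _

theorem stronglyMeasurable_step (hA : MeasurableSet A) : StronglyMeasurable (M.step A φ) :=
  stronglyMeasurable_const.indicator hA

theorem stronglyMeasurable_stepTrace (hA : MeasurableSet A) (c : ℝ) :
    StronglyMeasurable (M.stepTrace A φ c) := by
  have h : Measurable fun x : E3 => wrap (c • x) := measurable_wrap.comp (measurable_const_smul c)
  exact M.stronglyMeasurable_evalAt_comp ((M.stronglyMeasurable_step φ hA).comp_measurable h)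
    measurable_id

theorem norm_stepTrace_le (c : ℝ) (x : E3) : ‖M.stepTrace A φ c x‖ ≤ ‖φ‖ :=
  (M.norm_evalAt_apply_le _ _).trans (M.norm_step_le φ _)

/-- Volume fraction of `A` in the period cube. -/
def volumeFraction (A : Set E3) : ℝ := ∫ y in unitCell, A.indicator (1 : E3 → ℝ) y

/-- The local value at x oscillates and need not converge, but it enters both terms and cancels.
There remains a fixed integrable function F times the oscillating indicator minus its average. -/
theorem tendsto_nonlocalAt_stepTrace (hA : MeasurableSet A) {ε : ℕ → ℝ} (hε : ∀ n, 0 < ε n)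
    (hε0 : Tendsto ε atTop (𝓝 0)) (x : E3) :
    Tendsto (fun n => M.nonlocalAt 1 M.γ M.lamCoeff x (M.stepTrace A φ (ε n)⁻¹)
        (M.stepTrace A φ (ε n)⁻¹ x)
      - M.nonlocalAt 1 M.γ M.lamCoeff x (fun z => M.evalAt E3 z (volumeFraction A • φ))
        (M.stepTrace A φ (ε n)⁻¹ x)) atTop (𝓝 0) := by
  set F : E3 → E3 := fun z => (M.Ω.indicator (1 : E3 → ℝ) z * M.lam) •
    horizonKernel M.γ (z - x) (M.evalAt E3 z φ) with hF
  have hFx : (fun ξ => F (x + ξ)) = fun ξ => ((M.Ω.indicator (1 : E3 → ℝ) (x + (1 : ℝ) • ξ) *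
      M.lamCoeff.toFun x ξ) • horizonKernel M.γ ξ) (M.evalAt E3 (x + (1 : ℝ) • ξ) φ - 0) := by
    ext1 ξ
    simp [hF, lamCoeff]
  have hFi : Integrable F := by
    have h := M.integrable_nonlocalAt 1 M.γ M.lamCoeff x (M.stronglyMeasurable_evalAt φ)
      (fun z => M.norm_evalAt_apply_le z φ) 0
    rw [← hFx] at h
    simpa using h.comp_sub_right x
  have hosc := tendsto_integral_indicator_wrap_smul hA hFi hε hε0
  have hlim := hosc.sub_const (volumeFraction A • ∫ z, F z)
  rw [volumeFraction, sub_self] at hlim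
  refine hlim.congr fun n => ?_
  have hgm := M.stronglyMeasurable_stepTrace φ hA (ε n)⁻¹
  rw [nonlocalAt, nonlocalAt, ← integral_sub (M.integrable_nonlocalAt 1 M.γ M.lamCoeff x hgm
    (M.norm_stepTrace_le φ _) _) (M.integrable_nonlocalAt 1 M.γ M.lamCoeff x
    (M.stronglyMeasurable_evalAt _) (fun z => M.norm_evalAt_apply_le z _) _),
    ← integral_smul, ← integral_sub]
  · rw [← integral_add_left_eq_self _ x]
    refine integral_congr_ae (Eventually.of_forall fun ξ => ?_)
    dsimp only
    rw [← map_sub, sub_sub_sub_cancel_right, stepTrace, step_eq_smul]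
    simp only [hF, one_smul, lamCoeff, add_sub_cancel_left, map_smul, smul_apply, map_sub,
      volumeFraction]
  · refine integrable_smul_of_norm_le_one (g := fun z => A.indicator (1 : E3 → ℝ)
      (wrap ((ε n)⁻¹ • z))) ?_ (fun z => ?_) hFi
    · exact (measurable_one.indicator hA).comp
        (measurable_wrap.comp (measurable_const_smul (ε n)⁻¹))
    · by_cases h : wrap ((ε n)⁻¹ • z) ∈ A <;> simp [h]
  · exact (hFi.smul (∫ y in unitCell, A.indicator (1 : E3 → ℝ) y) :)

/-- The short-range operator on `step A φ`, evaluated at `(x, x/ε)`. -/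
def stepCell (A : Set E3) (φ : C(closure M.Ω, E3)) (c : ℝ) (x : E3) : E3 :=
  ∫ ξ, ((M.bondCoeff c).toFun x ξ • horizonKernel M.δ ξ)
    (M.evalAt E3 x (M.step A φ (wrap (c • x + ξ))) - M.stepTrace A φ c x)

theorem norm_sub_le_two {u v : E3} {C : ℝ} (hu : ‖u‖ ≤ C) (hv : ‖v‖ ≤ C) : ‖u - v‖ ≤ 2 * C := by
  linarith [norm_sub_le u v]

theorem norm_stepCell_le (c : ℝ) (x : E3) : ‖M.stepCell A φ c x‖ ≤
    (∫ ξ, ‖horizonKernel M.δ ξ‖) * (M.αBound * (2 * ‖φ‖)) :=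
  norm_integral_smul_horizonKernel_le _ fun ξ => norm_smul_coefficient_le (M.bondCoeff c) x ξ _
    (norm_sub_le_two ((M.norm_evalAt_apply_le _ _).trans (M.norm_step_le φ _))
      (M.norm_stepTrace_le φ c x))

theorem integrable_stepCell (hA : MeasurableSet A) (c : ℝ) (x : E3) :
    Integrable fun ξ => ((M.bondCoeff c).toFun x ξ • horizonKernel M.δ ξ)
      (M.evalAt E3 x (M.step A φ (wrap (c • x + ξ))) - M.stepTrace A φ c x) := by
  have h : Measurable fun ξ : E3 => wrap (c • x + ξ) :=
    measurable_wrap.comp (measurable_const_add (c • x))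
  refine integrable_smul_horizonKernel_apply _
    ((M.bondCoeff c).measurable.of_uncurry_left (x := x))
    (StronglyMeasurable.sub ((M.evalAt E3 x).continuous.comp_stronglyMeasurable
      ((M.stronglyMeasurable_step φ hA).comp_measurable h)) stronglyMeasurable_const)
    fun ξ => norm_smul_coefficient_le (M.bondCoeff c) x ξ _
    (norm_sub_le_two ((M.norm_evalAt_apply_le _ _).trans (M.norm_step_le φ _))
      (M.norm_stepTrace_le φ c x))

theorem exists_ball_evalAt {x : E3} (hx : x ∈ M.Ω) {η : ℝ} (hη : 0 < η) :
    ∃ r > 0, ∀ z ∈ Metric.ball x r, z ∈ M.Ω ∧ ‖M.evalAt E3 z φ - M.evalAt E3 x φ‖ ≤ η := by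
  have hc : ContinuousAt (fun z => M.evalAt E3 z φ) x := by
    have h : ContinuousOn (fun z => M.evalAt E3 z φ) (closure M.Ω) := by
      rw [continuousOn_iff_continuous_domRestrict]
      refine φ.continuous.congr fun z => ?_
      exact (M.evalAt_of_mem z.2 φ).symm
    exact h.continuousAt (mem_of_superset (M.isOpen_Ω.mem_nhds hx) subset_closure)
  obtain ⟨r1, h1, hr1⟩ := Metric.isOpen_iff.1 M.isOpen_Ω x hx
  obtain ⟨r2, h2, hr2⟩ := Metric.continuousAt_iff.1 hc η hη
  refine ⟨min r1 r2, lt_min h1 h2, fun z hz => ⟨hr1 (Metric.ball_subset_ball (min_le_left _ _) hz),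
    ?_⟩⟩
  have := hr2 (Metric.ball_subset_ball (min_le_right _ _) hz)
  rw [dist_eq_norm] at this
  exact this.le

/-- Since `(x + εξ)/ε = x/ε + ξ`, both integrands have the same indicator factors and differ only
through φ at `x + εξ` and at x. Because x is interior, bonds of length below εδ eventually stay in Ω
and the cut-off is inactive. -/
theorem tendsto_nonlocalAt_sub_stepCell (hA : MeasurableSet A) {ε : ℕ → ℝ} (hε : ∀ n, 0 < ε n)
    (hε0 : Tendsto ε atTop (𝓝 0)) {x : E3} (hx : x ∈ M.Ω) :
    Tendsto (fun n => M.nonlocalAt (ε n) M.δ (M.bondCoeff (ε n)⁻¹) x (M.stepTrace A φ (ε n)⁻¹)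
      (M.stepTrace A φ (ε n)⁻¹ x) - M.stepCell A φ (ε n)⁻¹ x) atTop (𝓝 0) := by
  set m := ∫ ξ, ‖horizonKernel M.δ ξ‖ with hm
  have hm0 : 0 ≤ m := integral_nonneg fun _ => norm_nonneg _
  have hα0 : (0 : ℝ) ≤ M.αBound := M.αBound.2
  rw [Metric.tendsto_atTop]
  intro η hη
  -- Tolerance for the oscillation of φ, chosen so that kernel mass times bond strength times κ is
  -- below η.
  set κ := η / (2 * (m * M.αBound + 1)) with hκ
  have hκ0 : 0 < κ := by positivity
  obtain ⟨r, hr, hball⟩ := M.exists_ball_evalAt φ hx hκ0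
  obtain ⟨N, hN⟩ := Metric.tendsto_atTop.1 hε0 (r / M.δ) (div_pos hr M.δ_pos)
  refine ⟨N, fun n hn => ?_⟩
  have hεr : ε n * M.δ < r := by
    have := hN n hn
    rw [dist_zero_right, Real.norm_of_nonneg (hε n).le, lt_div_iff₀ M.δ_pos] at this
    exact this
  have hgm := M.stronglyMeasurable_stepTrace φ hA (ε n)⁻¹
  rw [dist_zero_right, nonlocalAt, stepCell, ← integral_sub
    (M.integrable_nonlocalAt _ _ _ x hgm (M.norm_stepTrace_le φ _) _)
    (M.integrable_stepCell φ hA _ x)]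
  have hle : m * (M.αBound * κ) < η := by
    rw [hκ, ← mul_assoc, mul_div_assoc', div_lt_iff₀ (by positivity)]
    nlinarith [mul_nonneg hm0 hα0]
  refine lt_of_le_of_lt ?_ hle
  rw [hm, ← integral_mul_const]
  refine norm_integral_le_of_norm_le ((integrable_horizonKernel M.δ).norm.mul_const _)
    (Eventually.of_forall fun ξ => ?_)
  by_cases hξ : ξ ∈ Metric.ball (0 : E3) M.δ
  · have hmem : x + ε n • ξ ∈ Metric.ball x r := by
      rw [mem_ball_iff_norm, add_sub_cancel_left, norm_smul, Real.norm_of_nonneg (hε n).le]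
      rw [mem_ball_zero_iff] at hξ
      exact (mul_le_mul_of_nonneg_left hξ.le (hε n).le).trans_lt hεr
    obtain ⟨hΩ, hφ⟩ := hball _ hmem
    rw [indicator_of_mem hΩ, Pi.one_apply, one_mul, ← map_sub, sub_sub_sub_cancel_right, smul_apply,
      ← map_smul]
    refine ((horizonKernel M.δ ξ).le_opNorm _).trans ?_
    refine mul_le_mul_of_nonneg_left ?_ (norm_nonneg _)
    refine norm_smul_coefficient_le (M.bondCoeff (ε n)⁻¹) x ξ _ ?_
    have harg : (ε n)⁻¹ • (x + ε n • ξ) = (ε n)⁻¹ • x + ξ := by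
      rw [smul_add, smul_smul, inv_mul_cancel₀ (hε n).ne', one_smul]
    rw [stepTrace, harg, step_eq_smul, map_smul, map_smul, ← smul_sub]
    refine (norm_smul_le_of_norm_le_one ?_ _).trans hφ
    by_cases h : wrap ((ε n)⁻¹ • x + ξ) ∈ A <;> simp [h]
  · have h0 : horizonKernel M.δ ξ = 0 := indicator_of_notMem hξ _
    simp [h0]

end Composite

/-! ### Consistency of the generators with the trace -/

namespace Composite

variable (M : Composite)

theorem integral_of_ae_eq_step {A : Set E3} {p : ℝ≥0∞}
    (φ : C(closure M.Ω, E3)) {w : M.PerField p}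
    (hw : w =ᵐ[volume.restrict unitCell] M.step A φ) :
    ∫ y in unitCell, w y = volumeFraction A • φ := by
  rw [integral_congr_ae hw, volumeFraction]
  exact (integral_congr_ae (Eventually.of_forall fun y => M.step_eq_smul φ y)).trans
    (integral_smul_const _ φ)

section

variable (p : ℝ≥0∞) [Fact (1 ≤ p)] (hp : p ≠ ∞)

theorem trace_cellLong_of_ae_eq_step {A : Set E3} (φ : C(closure M.Ω, E3)) {w : M.PerField p}
    (hw : w =ᵐ[volume.restrict unitCell] M.step A φ) {ε : ℝ} (hε : 0 < ε) (hε1 : ε ≤ 1) :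
    M.trace p hp hε hε1 (M.cellLong p hp w) =ᵐ[volume.restrict M.Ω] fun x =>
      M.nonlocalAt 1 M.γ M.lamCoeff x (fun z => M.evalAt E3 z (volumeFraction A • φ))
        (M.stepTrace A φ ε⁻¹ x) := by
  filter_upwards [M.coeFn_trace p hp hε hε1 (Lp.stronglyMeasurable (M.cellLong p hp w))
      EventuallyEq.rfl, M.ae_wrap_smul (inv_ne_zero hε.ne') (M.coeFn_cellLong p hp w),
    M.ae_wrap_smul (inv_ne_zero hε.ne') hw, ae_restrict_mem M.measurableSet_Ω] with x h1 h2 h3 hx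
  have hx' : x ∈ closure M.Ω := subset_closure hx
  rw [h1, h2, h3, M.evalAt_of_mem hx', ContinuousMap.sub_apply, longGain_sub_longLoss,
    M.integral_of_ae_eq_step φ hw, stepTrace, M.evalAt_of_mem hx']

theorem trace_cellNonlocal_of_ae_eq_step {A : Set E3} (hA : MeasurableSet A)
    (φ : C(closure M.Ω, E3)) {w : M.PerField p}
    (hw : w =ᵐ[volume.restrict unitCell] M.step A φ) {ε : ℝ} (hε : 0 < ε) (hε1 : ε ≤ 1) :
    M.trace p hp hε hε1 (M.cellNonlocal p hp w) =ᵐ[volume.restrict M.Ω]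
      M.stepCell A φ ε⁻¹ := by
  filter_upwards [M.coeFn_trace p hp hε hε1 (Lp.stronglyMeasurable (M.cellNonlocal p hp w))
      EventuallyEq.rfl, M.ae_wrap_smul (inv_ne_zero hε.ne')
        (M.coeFn_cellNonlocal p hp (M.stronglyMeasurable_step φ hA) hw)] with x h1 h2
  rw [h1, h2.2, ← (M.evalAt E3 x).integral_comp_comm h2.1, stepCell]
  refine integral_congr_ae (Eventually.of_forall fun ξ => ?_)
  have hα : M.α (wrap (ε⁻¹ • x)) (wrap (ε⁻¹ • x) + ξ) = M.α (ε⁻¹ • x) (ε⁻¹ • x + ξ) :=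
    M.α_congr_wrap (wrap_wrap _) (wrap_wrap_add _ ξ)
  dsimp only
  rw [cellIntegrand, map_smul, evalAt_fieldMap, map_sub, hα, wrap_wrap_add]
  rfl

variable {ε : ℕ → ℝ} (hε : ∀ n, 0 < ε n) (hε1 : ∀ n, ε n ≤ 1)

/-- The consistency error at scale `ε n`. -/
def consistencyError (n : ℕ) : M.PerField p →L[ℝ] M.LpField p :=
  (M.generator p hp (ε n)).comp (M.trace p hp (hε n) (hε1 n)) -
    (M.trace p hp (hε n) (hε1 n)).comp (M.cellGenerator p hp)

theorem norm_consistencyError_le (n : ℕ) : ‖M.consistencyError p hp hε hε1 n‖ ≤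
    M.generatorBound * M.traceBound + M.traceBound * ‖M.cellGenerator p hp‖ := by
  have h1 : ‖(M.generator p hp (ε n)).comp (M.trace p hp (hε n) (hε1 n))‖ ≤
      M.generatorBound * M.traceBound := (ContinuousLinearMap.opNorm_comp_le _ _).trans <|
    mul_le_mul (M.norm_generator_le p hp _) (M.norm_trace_le p hp _ _) (norm_nonneg _)
      ((norm_nonneg _).trans (M.norm_generator_le p hp (ε n)))
  have h2 : ‖(M.trace p hp (hε n) (hε1 n)).comp (M.cellGenerator p hp)‖ ≤
      M.traceBound * ‖M.cellGenerator p hp‖ := (ContinuousLinearMap.opNorm_comp_le _ _).trans <|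
    mul_le_mul_of_nonneg_right (M.norm_trace_le p hp _ _) (norm_nonneg _)
  have h := norm_sub_le ((M.generator p hp (ε n)).comp (M.trace p hp (hε n) (hε1 n)))
    ((M.trace p hp (hε n) (hε1 n)).comp (M.cellGenerator p hp))
  exact h.trans (by linarith)

theorem consistencyError_apply (n : ℕ) (w : M.PerField p) :
    M.consistencyError p hp hε hε1 n w = M.divρ p hp (ε n)⁻¹
      ((M.nonlocal p hp 1 M.γ M.lamCoeff (M.trace p hp (hε n) (hε1 n) w)
        - M.trace p hp (hε n) (hε1 n) (M.cellLong p hp w))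
      + (M.nonlocal p hp (ε n) M.δ (M.bondCoeff (ε n)⁻¹) (M.trace p hp (hε n) (hε1 n) w)
        - M.trace p hp (hε n) (hε1 n) (M.cellNonlocal p hp w))) := by
  rw [consistencyError, sub_apply, ContinuousLinearMap.comp_apply, ContinuousLinearMap.comp_apply,
    cellGenerator, generator, ContinuousLinearMap.comp_apply, ContinuousLinearMap.comp_apply,
    ← divρ_trace, ← map_sub, add_apply, add_apply, map_add]
  congr 1
  abel

/-- Each term converges to zero at almost every x under a bound independent of n and x, so bounded
convergence on the finite-measure set Ω applies; division by the density is uniformly bounded. -/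
theorem tendsto_consistencyError_of_ae_eq_step (hε0 : Tendsto ε atTop (𝓝 0)) {A : Set E3}
    (hA : MeasurableSet A) (φ : C(closure M.Ω, E3)) {w : M.PerField p}
    (hw : w =ᵐ[volume.restrict unitCell] M.step A φ) :
    Tendsto (fun n => M.consistencyError p hp hε hε1 n w) atTop (𝓝 0) := by
  have htr : ∀ n, M.trace p hp (hε n) (hε1 n) w =ᵐ[volume.restrict M.Ω]
      M.stepTrace A φ (ε n)⁻¹ := fun n =>
    M.coeFn_trace p hp (hε n) (hε1 n) (M.stronglyMeasurable_step φ hA) hw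
  have hgm := fun n => M.stronglyMeasurable_stepTrace φ hA (ε n)⁻¹
  have h1 : Tendsto (fun n => M.nonlocal p hp 1 M.γ M.lamCoeff (M.trace p hp (hε n) (hε1 n) w)
      - M.trace p hp (hε n) (hε1 n) (M.cellLong p hp w)) atTop (𝓝 0) := by
    have heq : ∀ n, ∀ᵐ x ∂(volume.restrict M.Ω),
        (M.nonlocal p hp 1 M.γ M.lamCoeff (M.trace p hp (hε n) (hε1 n) w)
          - M.trace p hp (hε n) (hε1 n) (M.cellLong p hp w)) x =
        M.nonlocalAt 1 M.γ M.lamCoeff x (M.stepTrace A φ (ε n)⁻¹) (M.stepTrace A φ (ε n)⁻¹ x)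
        - M.nonlocalAt 1 M.γ M.lamCoeff x (fun z => M.evalAt E3 z (volumeFraction A • φ))
          (M.stepTrace A φ (ε n)⁻¹ x) := fun n => by
      filter_upwards [Lp.coeFn_sub (M.nonlocal p hp 1 M.γ M.lamCoeff
          (M.trace p hp (hε n) (hε1 n) w)) (M.trace p hp (hε n) (hε1 n) (M.cellLong p hp w)),
        M.coeFn_nonlocal p hp (s := 1) (r := M.γ) (a := M.lamCoeff) (hgm n) (htr n),
        M.trace_cellLong_of_ae_eq_step p hp φ hw (hε n) (hε1 n)] with x e1 e2 e3
      rw [e1, Pi.sub_apply, e2, e3]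
    refine tendsto_Lp_zero_of_bounded hp (C := (∫ ξ, ‖horizonKernel M.γ ξ‖) *
        (M.lamCoeff.bound * (‖φ‖ + ‖φ‖)) + (∫ ξ, ‖horizonKernel M.γ ξ‖) *
        (M.lamCoeff.bound * (‖volumeFraction A • φ‖ + ‖φ‖))) (fun n => ?_) ?_
    · filter_upwards [heq n] with x hx
      rw [hx]
      refine (norm_sub_le _ _).trans (add_le_add ?_ ?_)
      · exact M.norm_nonlocalAt_le _ _ _ _ fun z => (norm_sub_le _ _).trans
          (add_le_add (M.norm_stepTrace_le φ _ _) (M.norm_stepTrace_le φ _ _))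
      · exact M.norm_nonlocalAt_le _ _ _ _ fun z => (norm_sub_le _ _).trans
          (add_le_add (M.norm_evalAt_apply_le _ _) (M.norm_stepTrace_le φ _ _))
    · filter_upwards [ae_all_iff.2 heq] with x hx
      exact (M.tendsto_nonlocalAt_stepTrace φ hA hε hε0 x).congr fun n => (hx n).symm
  have h2 : Tendsto (fun n => M.nonlocal p hp (ε n) M.δ (M.bondCoeff (ε n)⁻¹)
      (M.trace p hp (hε n) (hε1 n) w)
      - M.trace p hp (hε n) (hε1 n) (M.cellNonlocal p hp w)) atTop (𝓝 0) := by
    have heq : ∀ n, ∀ᵐ x ∂(volume.restrict M.Ω),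
        (M.nonlocal p hp (ε n) M.δ (M.bondCoeff (ε n)⁻¹) (M.trace p hp (hε n) (hε1 n) w)
          - M.trace p hp (hε n) (hε1 n) (M.cellNonlocal p hp w)) x =
        M.nonlocalAt (ε n) M.δ (M.bondCoeff (ε n)⁻¹) x (M.stepTrace A φ (ε n)⁻¹)
          (M.stepTrace A φ (ε n)⁻¹ x) - M.stepCell A φ (ε n)⁻¹ x := fun n => by
      filter_upwards [Lp.coeFn_sub (M.nonlocal p hp (ε n) M.δ (M.bondCoeff (ε n)⁻¹)
          (M.trace p hp (hε n) (hε1 n) w)) (M.trace p hp (hε n) (hε1 n) (M.cellNonlocal p hp w)),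
        M.coeFn_nonlocal p hp (s := ε n) (r := M.δ) (a := M.bondCoeff (ε n)⁻¹) (hgm n) (htr n),
        M.trace_cellNonlocal_of_ae_eq_step p hp hA φ hw (hε n) (hε1 n)] with x e1 e2 e3
      rw [e1, Pi.sub_apply, e2, e3]
    refine tendsto_Lp_zero_of_bounded hp (C := (∫ ξ, ‖horizonKernel M.δ ξ‖) *
        (M.αBound * (‖φ‖ + ‖φ‖)) + (∫ ξ, ‖horizonKernel M.δ ξ‖) *
        (M.αBound * (2 * ‖φ‖))) (fun n => ?_) ?_
    · filter_upwards [heq n] with x hx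
      rw [hx]
      refine (norm_sub_le _ _).trans (add_le_add ?_ (M.norm_stepCell_le φ _ _))
      exact M.norm_nonlocalAt_le _ _ (M.bondCoeff (ε n)⁻¹) _ fun z => (norm_sub_le _ _).trans
          (add_le_add (M.norm_stepTrace_le φ _ _) (M.norm_stepTrace_le φ _ _))
    · filter_upwards [ae_all_iff.2 heq, ae_restrict_mem M.measurableSet_Ω] with x hx hxΩ
      exact (M.tendsto_nonlocalAt_sub_stepCell φ hA hε hε0 hxΩ).congr fun n => (hx n).symm
  have h3 := (h1.add h2).norm.const_mul (M.invρBound : ℝ)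
  rw [add_zero, norm_zero, mul_zero] at h3
  refine squeeze_zero_norm (fun n => ?_) h3
  rw [consistencyError_apply]
  exact (M.divρ p hp _).le_of_opNorm_le (M.norm_divρ_le p hp _) _

/-- Simple functions are dense as p is finite, and the error operators are equibounded. -/
theorem tendsto_consistencyError (hε0 : Tendsto ε atTop (𝓝 0)) (w : M.PerField p) :
    Tendsto (fun n => M.consistencyError p hp hε hε1 n w) atTop (𝓝 0) := by
  refine Lp.induction hp (motive := fun w =>
    Tendsto (fun n => M.consistencyError p hp hε hε1 n w) atTop (𝓝 0)) ?_ ?_ ?_ w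
  · intro φ A hA hμA
    exact M.tendsto_consistencyError_of_ae_eq_step p hp hε hε1 hε0 hA φ
      (by rw [Lp.simpleFunc.coe_indicatorConst]; exact indicatorConstLp_coeFn)
  · intro f g hf hg _ h1 h2
    simpa using h1.add h2
  · exact isClosed_setOf_tendsto_zero (M.norm_consistencyError_le p hp hε hε1)

end

end Composite

namespace Composite

variable (M : Composite)

/-! ### Two-scale convergence of traces -/

/-- Integration over `Ω` of continuous functions on the closure of `Ω`. -/
def domainIntegral : C(closure M.Ω, ℝ) →L[ℝ] ℝ :=
  LinearMap.mkContinuous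
    { toFun := fun φ => ∫ x in M.Ω, M.evalAt ℝ x φ
      map_add' := fun φ ψ => by
        simp only [map_add]
        have hi : ∀ φ : C(closure M.Ω, ℝ), Integrable (fun x => M.evalAt ℝ x φ)
            (volume.restrict M.Ω) := fun φ =>
          Integrable.of_bound (M.stronglyMeasurable_evalAt φ).aestronglyMeasurable ‖φ‖
            (Eventually.of_forall fun x => M.norm_evalAt_apply_le x φ)
        exact integral_add (hi φ) (hi ψ)
      map_smul' := fun c φ => by
        simp only [map_smul, integral_smul, RingHom.id_apply] }
    ((volume.restrict M.Ω).real univ) fun φ => by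
      have h := norm_integral_le_of_norm_le_const (μ := volume.restrict M.Ω) (C := ‖φ‖)
        (Eventually.of_forall fun x => M.norm_evalAt_apply_le x φ)
      rw [mul_comm]
      exact h

theorem domainIntegral_apply (φ : C(closure M.Ω, ℝ)) :
    M.domainIntegral φ = ∫ x in M.Ω, M.evalAt ℝ x φ := rfl

/-- The variables separate for a step field, leaving the weak limit of the rescaled indicator of A
tested against φ cut off to Ω. -/
theorem tendsto_oscillationError_step {ε : ℕ → ℝ} (hε : ∀ n, 0 < ε n)
    (hε0 : Tendsto ε atTop (𝓝 0)) {A : Set E3}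
    (hA : MeasurableSet A) (φ : C(closure M.Ω, ℝ)) :
    Tendsto (fun n => (∫ x in M.Ω, M.evalAt ℝ x (A.indicator (fun _ => φ) (wrap ((ε n)⁻¹ • x)))) -
      ∫ y in unitCell, ∫ x in M.Ω, M.evalAt ℝ x (A.indicator (fun _ => φ) y)) atTop (𝓝 0) := by
  have hs : ∀ x y, M.evalAt ℝ x (A.indicator (fun _ => φ) y) =
      A.indicator (1 : E3 → ℝ) y • M.evalAt ℝ x φ := fun x y => by
    by_cases h : y ∈ A <;> simp [h]
  have hi : Integrable (M.Ω.indicator fun x => M.evalAt ℝ x φ) := by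
    refine IntegrableOn.integrable_indicator ?_ M.measurableSet_Ω
    exact Integrable.of_bound (M.stronglyMeasurable_evalAt φ).aestronglyMeasurable ‖φ‖
      (Eventually.of_forall fun x => M.norm_evalAt_apply_le x φ)
  have h := (tendsto_integral_indicator_wrap_smul hA hi hε hε0).sub_const
    ((∫ y in unitCell, A.indicator (1 : E3 → ℝ) y) • ∫ z, M.Ω.indicator
      (fun x => M.evalAt ℝ x φ) z)
  rw [sub_self] at h
  refine h.congr fun n => ?_
  simp_rw [hs]
  congr 1
  · rw [← integral_indicator M.measurableSet_Ω]
    refine integral_congr_ae (Eventually.of_forall fun x => ?_)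
    by_cases hx : x ∈ M.Ω <;> simp [hx]
  · rw [integral_indicator M.measurableSet_Ω, ← integral_smul_const]
    refine integral_congr_ae (Eventually.of_forall fun y => ?_)
    dsimp only
    rw [integral_smul]

section

variable {ε : ℕ → ℝ} (hε : ∀ n, 0 < ε n) (hε1 : ∀ n, ε n ≤ 1)

/-- The error between the integral of a trace and its two-scale limit. -/
def oscillationError (n : ℕ) : Lp C(closure M.Ω, ℝ) 1 (volume.restrict unitCell) →L[ℝ] ℝ :=
  (L1.integralCLM (α := E3) (E := ℝ) (μ := volume.restrict M.Ω)).comp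
    ((M.traceKernel ℝ (hε n) (hε1 n)).toCLM 1 ENNReal.one_ne_top) -
  M.domainIntegral.comp (L1.integralCLM (μ := volume.restrict unitCell))

theorem oscillationError_apply (n : ℕ) {w : Lp C(closure M.Ω, ℝ) 1 (volume.restrict unitCell)}
    {w' : E3 → C(closure M.Ω, ℝ)} (hw' : StronglyMeasurable w')
    (h : w =ᵐ[volume.restrict unitCell] w') :
    M.oscillationError hε hε1 n w = (∫ x in M.Ω, M.evalAt ℝ x (w' (wrap ((ε n)⁻¹ • x)))) -
      ∫ y in unitCell, ∫ x in M.Ω, M.evalAt ℝ x (w' y) := by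
  have h1 : L1.integralCLM ((M.traceKernel ℝ (hε n) (hε1 n)).toCLM 1 ENNReal.one_ne_top w) =
      ∫ x in M.Ω, M.evalAt ℝ x (w' (wrap ((ε n)⁻¹ • x))) := by
    rw [← L1.integral_eq, L1.integral_eq_integral]
    refine integral_congr_ae ?_
    filter_upwards [(M.traceKernel ℝ (hε n) (hε1 n)).coeFn_toCLM_of_ae_eq 1 ENNReal.one_ne_top
      hw' h] with x hx
    rw [hx, traceKernel_apply]
  have h2 : M.domainIntegral (L1.integralCLM w) =
      ∫ y in unitCell, ∫ x in M.Ω, M.evalAt ℝ x (w' y) := by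
    rw [← L1.integral_eq, L1.integral_eq_integral,
      ← M.domainIntegral.integral_comp_comm (L1.integrable_coeFn w)]
    refine integral_congr_ae ?_
    filter_upwards [h] with y hy
    rw [hy, domainIntegral_apply]
  rw [oscillationError, sub_apply, ContinuousLinearMap.comp_apply, ContinuousLinearMap.comp_apply,
    h1, h2]

theorem norm_oscillationError_le (n : ℕ) :
    ‖M.oscillationError hε hε1 n‖ ≤ M.traceBound + ‖M.domainIntegral‖ := by
  have h1 : ‖(L1.integralCLM (α := E3) (E := ℝ) (μ := volume.restrict M.Ω)).comp
      ((M.traceKernel ℝ (hε n) (hε1 n)).toCLM 1 ENNReal.one_ne_top)‖ ≤ 1 * M.traceBound :=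
    (ContinuousLinearMap.opNorm_comp_le _ _).trans <|
      mul_le_mul L1.norm_Integral_le_one (SchurKernel.norm_toCLM_le _ 1 _) (norm_nonneg _)
        zero_le_one
  have h2 : ‖M.domainIntegral.comp (L1.integralCLM (α := E3) (E := C(closure M.Ω, ℝ))
      (μ := volume.restrict unitCell))‖ ≤ ‖M.domainIntegral‖ * 1 :=
    (ContinuousLinearMap.opNorm_comp_le _ _).trans <|
      mul_le_mul_of_nonneg_left L1.norm_Integral_le_one (norm_nonneg _)
  have h := norm_sub_le ((L1.integralCLM (α := E3) (E := ℝ) (μ := volume.restrict M.Ω)).comp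
    ((M.traceKernel ℝ (hε n) (hε1 n)).toCLM 1 ENNReal.one_ne_top))
    (M.domainIntegral.comp (L1.integralCLM (α := E3) (E := C(closure M.Ω, ℝ))
      (μ := volume.restrict unitCell)))
  exact h.trans (by linarith)

theorem tendsto_oscillationError (hε0 : Tendsto ε atTop (𝓝 0))
    (w : Lp C(closure M.Ω, ℝ) 1 (volume.restrict unitCell)) :
    Tendsto (fun n => M.oscillationError hε hε1 n w) atTop (𝓝 0) := by
  refine Lp.induction ENNReal.one_ne_top (motive := fun w =>
    Tendsto (fun n => M.oscillationError hε hε1 n w) atTop (𝓝 0)) ?_ ?_ ?_ w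
  · intro φ A hA hμA
    refine (M.tendsto_oscillationError_step hε hε0 hA φ).congr fun n => ?_
    refine (M.oscillationError_apply hε hε1 n (stronglyMeasurable_const.indicator hA) ?_).symm
    rw [Lp.simpleFunc.coe_indicatorConst]
    exact indicatorConstLp_coeFn
  · intro f g hf hg _ h1 h2
    simpa using h1.add h2
  · exact isClosed_setOf_tendsto_zero (M.norm_oscillationError_le hε hε1)

end

/-! ### Test functions -/

/-- The pointwise inner product of two continuous fields. -/
def innerField₂ (φ ψ : C(closure M.Ω, E3)) : C(closure M.Ω, ℝ) :=
  { toFun := fun x => inner ℝ (φ x) (ψ x)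
    continuous_toFun := Continuous.inner (𝕜 := ℝ) (E := E3) φ.continuous ψ.continuous }

theorem continuous_innerField₂ :
    Continuous fun q : C(closure M.Ω, E3) × C(closure M.Ω, E3) => M.innerField₂ q.1 q.2 := by
  refine ContinuousMap.continuous_of_continuous_uncurry _ ?_
  change Continuous fun q : (C(closure M.Ω, E3) × C(closure M.Ω, E3)) × closure M.Ω =>
    (inner ℝ (q.1.1 q.2) (q.1.2 q.2) : ℝ)
  fun_prop

theorem norm_innerField₂_le (φ ψ : C(closure M.Ω, E3)) {C : ℝ} (hC0 : 0 ≤ C)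
    (hC : ∀ x, ‖ψ x‖ ≤ C) : ‖M.innerField₂ φ ψ‖ ≤ C * ‖φ‖ := by
  refine (ContinuousMap.norm_le _ (by positivity)).2 fun x => ?_
  refine (norm_inner_le_norm (𝕜 := ℝ) (E := E3) (φ x) (ψ x)).trans ?_
  rw [mul_comm]
  exact mul_le_mul (hC x) (φ.norm_coe_le_norm x) (norm_nonneg _) hC0

/-- The inner product of w with the test function is itself a field G in L¹(Y; C(Ω̄)), so the
pairing is the integral of the trace of G and `tendsto_oscillationError` applies. -/
theorem tendsto_integral_inner_trace {p : ℝ≥0∞} [Fact (1 ≤ p)] (hp : p ≠ ∞) {ε : ℕ → ℝ}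
    (hε : ∀ n, 0 < ε n) (hε1 : ∀ n, ε n ≤ 1) (hε0 : Tendsto ε atTop (𝓝 0)) (w : M.PerField p)
    {ψ : E3 → E3 → E3} (hψ : Continuous (Function.uncurry ψ)) (hper : ∀ x y, ψ x (wrap y) = ψ x y)
    {C : ℝ} (hC : ∀ x ∈ closure M.Ω, ∀ y, ‖ψ x y‖ ≤ C) :
    Tendsto (fun n => ∫ x in M.Ω, inner ℝ (M.trace p hp (hε n) (hε1 n) w x)
        (ψ x ((ε n)⁻¹ • x))) atTop
      (𝓝 (∫ y in unitCell, ∫ x in M.Ω, inner ℝ (perExt w x y) (ψ x y))) := by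
  let Ψ : E3 → C(closure M.Ω, E3) := fun y => ⟨fun x => ψ x y, by fun_prop⟩
  have hΨ : Continuous Ψ := by
    refine ContinuousMap.continuous_of_continuous_uncurry _ ?_
    change Continuous fun q : E3 × closure M.Ω => ψ q.2 q.1
    fun_prop
  let G : E3 → C(closure M.Ω, ℝ) := fun y => M.innerField₂ (w y) (Ψ y)
  have hG : StronglyMeasurable G := M.continuous_innerField₂.comp_stronglyMeasurable
    ((Lp.stronglyMeasurable w).prodMk hΨ.stronglyMeasurable)
  have hGi : Integrable G (volume.restrict unitCell) := by
    refine Integrable.mono' (((M.integrable_perField p w).norm).const_mul (max C 0))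
      hG.aestronglyMeasurable (Eventually.of_forall fun y => ?_)
    exact M.norm_innerField₂_le _ _ (le_max_right _ _)
      fun x => (hC x x.2 y).trans (le_max_left _ _)
  have h := M.tendsto_oscillationError hε hε1 hε0 hGi.toL1
  have hev : ∀ x ∈ M.Ω, ∀ y, M.evalAt ℝ x (G (wrap y)) = inner ℝ (perExt w x y) (ψ x y) :=
    fun x hx y => by
      have hx' : x ∈ closure M.Ω := subset_closure hx
      rw [perExt_eq, M.evalAt_of_mem hx', M.evalAt_of_mem hx', ← hper x y]
      rfl
  have h1 : ∀ n, (∫ x in M.Ω, M.evalAt ℝ x (G (wrap ((ε n)⁻¹ • x)))) =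
      ∫ x in M.Ω, inner ℝ (M.trace p hp (hε n) (hε1 n) w x) (ψ x ((ε n)⁻¹ • x)) := fun n => by
    refine integral_congr_ae ?_
    filter_upwards [M.coeFn_trace_perExt p hp (hε n) (hε1 n) w,
      ae_restrict_mem M.measurableSet_Ω] with x hx hxΩ
    rw [hx, hev x hxΩ]
  have h2 : (∫ y in unitCell, ∫ x in M.Ω, M.evalAt ℝ x (G y)) =
      ∫ y in unitCell, ∫ x in M.Ω, inner ℝ (perExt w x y) (ψ x y) := by
    refine setIntegral_congr_fun measurableSet_unitCell fun y hy => ?_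
    refine setIntegral_congr_fun M.measurableSet_Ω fun x hx => ?_
    rw [← hev x hx, wrap_of_mem hy]
  have h3 := h.add_const (∫ y in unitCell, ∫ x in M.Ω, M.evalAt ℝ x (G y))
  rw [zero_add, h2] at h3
  refine h3.congr fun n => ?_
  rw [M.oscillationError_apply hε hε1 n hG hGi.coeFn_toL1, h1, h2, sub_add_cancel]

namespace IsTestFunction

variable {ψ : E3 → E3 → ℝ → E3}

theorem continuous (hψ : IsTestFunction ψ) :
    Continuous fun q : E3 × E3 × ℝ => ψ q.1 q.2.1 q.2.2 := hψ.smooth.continuous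

theorem add_of_mem_intLattice (hψ : IsTestFunction ψ) (x y : E3) (t : ℝ) {v : E3}
    (hv : v ∈ intLattice) : ψ x (y + v) t = ψ x y t := by
  obtain ⟨k, hk⟩ := mem_intLattice.1 hv
  have hP : ∀ i, Function.Periodic (fun y => ψ x y t) (EuclideanSpace.single i (1 : ℝ)) :=
    fun i y => hψ.periodic x y t i
  have hv' : v = k 0 • EuclideanSpace.single 0 (1 : ℝ) + k 1 • EuclideanSpace.single 1 (1 : ℝ)
      + k 2 • EuclideanSpace.single 2 (1 : ℝ) := by
    ext i
    rw [hk]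
    fin_cases i <;> simp
  have h := (((hP 0).zsmul (k 0)).add_period ((hP 1).zsmul (k 1))).add_period
    ((hP 2).zsmul (k 2)) y
  rw [hv']
  exact h

theorem wrap (hψ : IsTestFunction ψ) (x y : E3) (t : ℝ) : ψ x (wrap y) t = ψ x y t := by
  have h := hψ.add_of_mem_intLattice x y t (wrap_sub_self_mem y)
  rwa [add_sub_cancel] at h

theorem exists_bound (hψ : IsTestFunction ψ) (T : ℝ) :
    ∃ C, 0 ≤ C ∧ ∀ x ∈ closure M.Ω, ∀ y, ∀ t ∈ Icc 0 T, ‖ψ x y t‖ ≤ C := by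
  have hK : IsCompact (closure M.Ω ×ˢ (Metric.closedBall (0 : E3) 1 ×ˢ Icc 0 T)) :=
    M.isBounded_Ω.isCompact_closure.prod ((isCompact_closedBall 0 1).prod isCompact_Icc)
  obtain ⟨C, hC⟩ := hK.exists_bound_of_continuousOn hψ.continuous.continuousOn
  refine ⟨max C 0, le_max_right _ _, fun x hx y t ht => ?_⟩
  -- Periodicity confines y to the unit ball, hence to a compact set.
  rw [← hψ.wrap]
  refine (hC (x, _root_.wrap y, t) ⟨hx, ?_, ht⟩).trans (le_max_left _ _)
  rw [mem_closedBall_zero_iff]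
  exact norm_le_one_of_mem_unitCell (wrap_mem y)

end IsTestFunction

end Composite

theorem memLp_of_continuousOn {X : Type*} [NormedAddCommGroup X] {p : ℝ≥0∞} {T : ℝ}
    {f : ℝ → X}
    (hf : ContinuousOn f (Icc 0 T)) {R : ℝ} (hR : ∀ t ∈ Icc 0 T, ‖f t‖ ≤ R) :
    MemLp f p (volume.restrict (Ioo 0 T)) := by
  refine MemLp.of_bound ((hf.mono Ioo_subset_Icc_self).aestronglyMeasurable measurableSet_Ioo) R ?_
  filter_upwards [ae_restrict_mem measurableSet_Ioo] with t ht
  exact hR t (Ioo_subset_Icc_self ht)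

namespace Composite

variable (M : Composite)

/-- The norm of the embedding of `L^p(Ω)` into `L¹(Ω)`. -/
def embeddingBound (p : ℝ≥0∞) : ℝ := (volume.restrict M.Ω univ ^ (1 - 1 / p.toReal)).toReal

theorem embeddingBound_nonneg (p : ℝ≥0∞) : 0 ≤ M.embeddingBound p := ENNReal.toReal_nonneg

section

variable {p : ℝ≥0∞} [Fact (1 ≤ p)]

/-! ### Pairing with bounded fields -/

theorem integrable_lpField (v : M.LpField p) : Integrable v (volume.restrict M.Ω) :=
  (Lp.memLp v).integrable Fact.out

theorem integral_norm_le (v : M.LpField p) :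
    ∫ x in M.Ω, ‖v x‖ ≤ M.embeddingBound p * ‖v‖ := by
  have h1 : (1 : ℝ≥0∞) ≤ p := Fact.out
  have h := eLpNorm_le_eLpNorm_mul_rpow_measure_univ h1 (Lp.aestronglyMeasurable v)
  have he : 0 ≤ 1 - 1 / p.toReal := by
    by_cases hp : p = ∞
    · simp [hp]
    · have : 1 ≤ p.toReal := by simpa using ENNReal.toReal_mono hp h1
      rw [sub_nonneg, div_le_one (by linarith)]
      exact this
  rw [ENNReal.toReal_one, one_div_one] at h
  rw [integral_norm_eq_lintegral_enorm (Lp.aestronglyMeasurable v), ← eLpNorm_one_eq_lintegral_enorm,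
    embeddingBound, Lp.norm_def, ← ENNReal.toReal_mul, mul_comm]
  refine ENNReal.toReal_mono (ENNReal.mul_ne_top (Lp.eLpNorm_ne_top v) ?_) h
  exact ENNReal.rpow_ne_top_of_nonneg he (measure_ne_top _ _)

variable {g : E3 → E3} {C : ℝ}

theorem integrable_inner_lpField (v : M.LpField p) (hg : Continuous g)
    (hC : ∀ x ∈ M.Ω, ‖g x‖ ≤ C) :
    Integrable (fun x => (inner ℝ (v x) (g x) : ℝ)) (volume.restrict M.Ω) := by
  refine Integrable.mono' ((M.integrable_lpField v).norm.mul_const C)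
    ((Lp.aestronglyMeasurable v).inner hg.aestronglyMeasurable) ?_
  filter_upwards [ae_restrict_mem M.measurableSet_Ω] with x hx
  exact (norm_inner_le_norm _ _).trans (mul_le_mul_of_nonneg_left (hC x hx) (norm_nonneg _))

theorem norm_integral_inner_le (v : M.LpField p) (hC0 : 0 ≤ C) (hC : ∀ x ∈ M.Ω, ‖g x‖ ≤ C) :
    ‖∫ x in M.Ω, (inner ℝ (v x) (g x) : ℝ)‖ ≤ M.embeddingBound p * C * ‖v‖ := by
  have h : ‖∫ x in M.Ω, (inner ℝ (v x) (g x) : ℝ)‖ ≤ ∫ x in M.Ω, ‖v x‖ * C := by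
    refine norm_integral_le_of_norm_le ((M.integrable_lpField v).norm.mul_const C) ?_
    filter_upwards [ae_restrict_mem M.measurableSet_Ω] with x hx
    exact (norm_inner_le_norm _ _).trans (mul_le_mul_of_nonneg_left (hC x hx) (norm_nonneg _))
  rw [integral_mul_const] at h
  refine h.trans ?_
  rw [mul_right_comm]
  exact mul_le_mul_of_nonneg_right (M.integral_norm_le v) hC0

theorem integral_inner_sub (v w : M.LpField p) (hg : Continuous g) (hC : ∀ x ∈ M.Ω, ‖g x‖ ≤ C) :
    ∫ x in M.Ω, (inner ℝ ((v - w) x) (g x) : ℝ) =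
      (∫ x in M.Ω, inner ℝ (v x) (g x)) - ∫ x in M.Ω, inner ℝ (w x) (g x) := by
  rw [← integral_sub (M.integrable_inner_lpField v hg hC) (M.integrable_inner_lpField w hg hC)]
  refine integral_congr_ae ?_
  filter_upwards [Lp.coeFn_sub v w] with x hx
  rw [hx, Pi.sub_apply, inner_sub_left]

/-- Supplies the measurability in time needed for dominated convergence. Near s, the change of v is
controlled in norm and the change of g by domination for the fixed field `v s`. -/
theorem continuousOn_integral_inner {T : ℝ} {v : ℝ → M.LpField p} (hv : ContinuousOn v (Icc 0 T))
    {g : E3 → ℝ → E3} (hg : Continuous (Function.uncurry g)) (hC0 : 0 ≤ C)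
    (hC : ∀ x ∈ M.Ω, ∀ t ∈ Icc 0 T, ‖g x t‖ ≤ C) :
    ContinuousOn (fun t => ∫ x in M.Ω, (inner ℝ (v t x) (g x t) : ℝ)) (Icc 0 T) := by
  intro s hs
  have hgt : ∀ t, Continuous fun x => g x t := fun t => by fun_prop
  have h1 : Tendsto (fun t => ∫ x in M.Ω, (inner ℝ ((v t - v s) x) (g x t) : ℝ)) (𝓝[Icc 0 T] s)
      (𝓝 0) := by
    refine squeeze_zero_norm' (a := fun t => M.embeddingBound p * C * ‖v t - v s‖) ?_ ?_
    · filter_upwards [self_mem_nhdsWithin] with t ht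
      exact M.norm_integral_inner_le _ hC0 fun x hx => hC x hx t ht
    · have h := ((hv s hs).sub_const (v s)).norm.const_mul (M.embeddingBound p * C)
      rwa [sub_self, norm_zero, mul_zero] at h
  have h2 : ContinuousWithinAt (fun t => ∫ x in M.Ω, (inner ℝ (v s x) (g x t) : ℝ)) (Icc 0 T) s := by
    refine continuousWithinAt_of_dominated (bound := fun x => ‖v s x‖ * C)
      (Eventually.of_forall fun t => (Lp.aestronglyMeasurable (v s)).inner
        (hgt t).aestronglyMeasurable) ?_ ((M.integrable_lpField (v s)).norm.mul_const C)
      (Eventually.of_forall fun x => ?_)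
    · filter_upwards [self_mem_nhdsWithin] with t ht
      filter_upwards [ae_restrict_mem M.measurableSet_Ω] with x hx
      exact (norm_inner_le_norm _ _).trans
        (mul_le_mul_of_nonneg_left (hC x hx t ht) (norm_nonneg _))
    · have : Continuous fun t => (inner ℝ (v s x) (g x t) : ℝ) :=
        continuous_const.inner (by fun_prop)
      exact this.continuousWithinAt
  have h3 := h1.add h2
  rw [zero_add] at h3
  refine h3.congr' ?_
  filter_upwards [self_mem_nhdsWithin] with t ht
  rw [M.integral_inner_sub _ _ (hgt t) fun x hx => hC x hx t ht, sub_add_cancel]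

/-! ### Convergence of the solutions -/

variable {ε : ℕ → ℝ} {T : ℝ} {u₀ v₀ : M.PerField p} {b u : ℝ → M.PerField p} {v : ℕ → ℝ → M.LpField p}

/-- The strong corrector result behind the theorem: the consistency error is uniformly small on the
compact orbit of u, and the Gronwall constant does not depend on n. -/
theorem tendsto_sub_trace (hp : p ≠ ∞) (hε : ∀ n, 0 < ε n) (hε1 : ∀ n, ε n ≤ 1)
    (hε0 : Tendsto ε atTop (𝓝 0)) (hT : 0 < T)
    (hu : IsTwoScaleSolution T u₀ v₀ b u) (hv : ∀ n, IsSolution T (ε n) u₀ v₀ b (v n)) {t : ℝ}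
    (ht : t ∈ Icc 0 T) :
    Tendsto (fun n => v n t - M.trace p hp (hε n) (hε1 n) (u t)) atTop (𝓝 0) := by
  have hu' := (M.isTwoScaleSolution_iff hp).1 hu
  have hL : 0 ≤ M.generatorBound := (norm_nonneg _).trans (M.norm_generator_le p hp 1)
  have hexp : 0 ≤ (Real.exp ((M.generatorBound + 1) * T) - 1) / (M.generatorBound + 1) :=
    div_nonneg (sub_nonneg.2 (Real.one_le_exp (by positivity))) (by positivity)
  set c := (Real.exp ((M.generatorBound + 1) * T) - 1) / (M.generatorBound + 1)
  rw [Metric.tendsto_atTop']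
  intro η hη
  have hK : IsCompact (u '' Icc 0 T) :=
    isCompact_Icc.image_of_continuousOn hu.contDiffOn.continuousOn
  obtain ⟨N, hN⟩ := eventually_atTop.1 (tendstoUniformlyOn_of_pointwise
    (M.norm_consistencyError_le p hp hε hε1) (M.tendsto_consistencyError p hp hε hε1 hε0) hK
    (η := η / (c + 1)) (by positivity))
  refine ⟨N, fun n hn => ?_⟩
  have h := hu'.norm_sub_map_le hT (IsSolution.solvesIVP M hp (hε n) (hε1 n) (hv n))
    (M.norm_generator_le p hp (ε n)) (by positivity)
    (fun s hs => hN n hn.le (u s) (mem_image_of_mem u hs)) t ht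
  rw [dist_zero_right]
  refine h.trans_lt ?_
  rw [div_mul_eq_mul_div, div_lt_iff₀ (by positivity)]
  change η * c < _
  nlinarith

/-- The same comparison estimate, now with only the crude uniform bound D on the consistency error,
holds for every n and not just eventually. -/
theorem exists_bound_of_isSolution (hp : p ≠ ∞) (hε : ∀ n, 0 < ε n) (hε1 : ∀ n, ε n ≤ 1)
    (hT : 0 < T)
    (hu : IsTwoScaleSolution T u₀ v₀ b u) (hv : ∀ n, IsSolution T (ε n) u₀ v₀ b (v n)) :
    ∃ R, 0 ≤ R ∧ ∀ n, ∀ t ∈ Icc 0 T, ‖v n t‖ ≤ R := by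
  have hu' := (M.isTwoScaleSolution_iff hp).1 hu
  obtain ⟨S, hS⟩ := isCompact_Icc.exists_bound_of_continuousOn hu.contDiffOn.continuousOn
  have hS0 : 0 ≤ S := (norm_nonneg _).trans (hS 0 ⟨le_rfl, hT.le⟩)
  set D := M.generatorBound * M.traceBound + M.traceBound * ‖M.cellGenerator p hp‖
  have hB : (0 : ℝ) ≤ M.traceBound := M.traceBound.2
  have hD : 0 ≤ D := add_nonneg (mul_nonneg
    ((norm_nonneg _).trans (M.norm_generator_le p hp 1)) hB) (mul_nonneg hB (ContinuousLinearMap.opNorm_nonneg _))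
  set c := (Real.exp ((M.generatorBound + 1) * T) - 1) / (M.generatorBound + 1)
  have key : ∀ n, ∀ t ∈ Icc 0 T, ‖v n t‖ ≤ D * S * c + M.traceBound * S := fun n t ht => by
    have h := hu'.norm_sub_map_le hT (IsSolution.solvesIVP M hp (hε n) (hε1 n) (hv n))
      (M.norm_generator_le p hp (ε n)) (mul_nonneg hD hS0)
      (fun s hs => ((M.consistencyError p hp hε hε1 n).le_of_opNorm_le
        (M.norm_consistencyError_le p hp hε hε1 n) (u s)).trans
        (mul_le_mul_of_nonneg_left (hS s hs) hD)) t ht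
    have h2 : ‖M.trace p hp (hε n) (hε1 n) (u t)‖ ≤ M.traceBound * S :=
      ((M.trace p hp (hε n) (hε1 n)).le_of_opNorm_le (M.norm_trace_le p hp _ _) _).trans
        (mul_le_mul_of_nonneg_left (hS t ht) hB)
    have h3 := norm_add_le (v n t - M.trace p hp (hε n) (hε1 n) (u t))
      (M.trace p hp (hε n) (hε1 n) (u t))
    rw [sub_add_cancel] at h3
    exact h3.trans (add_le_add h h2)
  exact ⟨_, (norm_nonneg _).trans (key 0 0 ⟨le_rfl, hT.le⟩), key⟩

/-- At fixed t the solution is the trace of `u t` plus a remainder vanishing in norm; the uniform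
bound R gives domination in time. -/
theorem twoScaleConverges_of_isSolution (hp : p ≠ ∞) (hε : ∀ n, 0 < ε n) (hε1 : ∀ n, ε n ≤ 1)
    (hε0 : Tendsto ε atTop (𝓝 0)) (hT : 0 < T)
    (hu : IsTwoScaleSolution T u₀ v₀ b u) (hv : ∀ n, IsSolution T (ε n) u₀ v₀ b (v n)) :
    TwoScaleConverges T ε v u := by
  obtain ⟨R, hR0, hR⟩ := M.exists_bound_of_isSolution hp hε hε1 hT hu hv
  obtain ⟨S, hS⟩ := isCompact_Icc.exists_bound_of_continuousOn hu.contDiffOn.continuousOn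
  refine ⟨fun n => memLp_of_continuousOn (hv n).contDiffOn.continuousOn (hR n), ?_,
    memLp_of_continuousOn hu.contDiffOn.continuousOn hS, fun ψ hψ => ?_⟩
  · have hfin : volume.restrict (Ioo 0 T) univ ^ p.toReal⁻¹ * ENNReal.ofReal R ≠ ∞ :=
      ENNReal.mul_ne_top (ENNReal.rpow_ne_top_of_nonneg (by positivity) (measure_ne_top _ _))
        ENNReal.ofReal_ne_top
    refine ⟨(volume.restrict (Ioo 0 T) univ ^ p.toReal⁻¹ * ENNReal.ofReal R).toNNReal,
      fun n => ?_⟩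
    rw [ENNReal.coe_toNNReal hfin]
    refine eLpNorm_le_of_ae_bound ?_
    filter_upwards [ae_restrict_mem measurableSet_Ioo] with t ht
    exact hR n t (Ioo_subset_Icc_self ht)
  obtain ⟨C, hC0, hC⟩ := hψ.exists_bound M T
  have hcont : ∀ n, Continuous (Function.uncurry fun (x : E3) (t : ℝ) => ψ x ((ε n)⁻¹ • x) t) :=
    fun n => hψ.continuous.comp (by fun_prop : Continuous fun q : E3 × ℝ =>
      (q.1, (ε n)⁻¹ • q.1, q.2))
  have hbd : ∀ n, ∀ x ∈ M.Ω, ∀ t ∈ Icc 0 T, ‖ψ x ((ε n)⁻¹ • x) t‖ ≤ C := fun n x hx t ht =>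
    hC x (subset_closure hx) _ t ht
  refine tendsto_integral_of_dominated_convergence (fun _ => M.embeddingBound p * C * R)
    (fun n => ?_) (integrable_const _) (fun n => ?_) ?_
  · exact ((M.continuousOn_integral_inner (hv n).contDiffOn.continuousOn (hcont n) hC0
      (hbd n)).mono Ioo_subset_Icc_self).aestronglyMeasurable measurableSet_Ioo
  · filter_upwards [ae_restrict_mem measurableSet_Ioo] with t ht
    have ht' := Ioo_subset_Icc_self ht
    exact (M.norm_integral_inner_le _ hC0 fun x hx => hbd n x hx t ht').trans
      (mul_le_mul_of_nonneg_left (hR n t ht') (mul_nonneg (M.embeddingBound_nonneg p) hC0))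
  · filter_upwards [ae_restrict_mem measurableSet_Ioo] with t ht
    have ht' := Ioo_subset_Icc_self ht
    have h1 : Tendsto (fun n => ∫ x in M.Ω, (inner ℝ
        ((v n t - M.trace p hp (hε n) (hε1 n) (u t)) x) (ψ x ((ε n)⁻¹ • x) t) : ℝ)) atTop
        (𝓝 0) := by
      refine squeeze_zero_norm (fun n => M.norm_integral_inner_le _ hC0
        fun x hx => hbd n x hx t ht') ?_
      have h := (M.tendsto_sub_trace hp hε hε1 hε0 hT hu hv ht').norm.const_mul
        (M.embeddingBound p * C)
      rwa [norm_zero, mul_zero] at h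
    have h2 := M.tendsto_integral_inner_trace hp hε hε1 hε0 (u t) (ψ := fun x y => ψ x y t)
      (hψ.continuous.comp (by fun_prop : Continuous fun q : E3 × E3 => (q.1, q.2, t)))
      (fun x y => hψ.wrap x y t) fun x hx y => hC x hx y t ht'
    have h3 := h1.add h2
    rw [zero_add] at h3
    refine h3.congr fun n => ?_
    have hg : Continuous fun x : E3 => ψ x ((ε n)⁻¹ • x) t :=
      (hcont n).comp (by fun_prop : Continuous fun x : E3 => (x, t))
    rw [M.integral_inner_sub _ _ hg fun x hx => hbd n x hx t ht', sub_add_cancel]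

end

end Composite

/-! ### The homogenization theorem -/

theorem theorem3p10 (M : Composite) (T : ℝ) (hT : 0 < T)
    (p : ℝ≥0∞) [Fact (1 ≤ p)] (hp : 3 / 2 < p) (hp_top : p < ∞)
    (u₀ v₀ : M.PerField p) (b : ℝ → M.PerField p) (hb : ContinuousOn b (Icc 0 T))
    (uε : ℕ → ℝ → M.LpField p)
    (huε : ∀ n : ℕ, Composite.IsSolution T (1 / ((n : ℝ) + 1)) u₀ v₀ b (uε n)) :
    ∃ u : ℝ → M.PerField p,
      Composite.TwoScaleConverges T (fun n : ℕ => 1 / ((n : ℝ) + 1)) uε u ∧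
      Composite.IsTwoScaleSolution T u₀ v₀ b u ∧
      ∀ w : ℝ → M.PerField p, Composite.IsTwoScaleSolution T u₀ v₀ b w →
        EqOn w u (Icc 0 T) := by
  have hp' : p ≠ ∞ := hp_top.ne
  obtain ⟨u, hu⟩ := exists_solvesIVP hT (M.cellGenerator p hp')
    ((M.cellDivρ p hp').continuous.comp_continuousOn hb) u₀ v₀
  have hu' : Composite.IsTwoScaleSolution T u₀ v₀ b u := (M.isTwoScaleSolution_iff hp').2 hu
  refine ⟨u, M.twoScaleConverges_of_isSolution hp' (fun n => by positivity) (fun n => ?_)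
    tendsto_one_div_add_atTop_nhds_zero_nat hT hu' huε, hu',
    fun w hw => hu.eqOn hT ((M.isTwoScaleSolution_iff hp').1 hw)⟩
  -- The index starts at 0, so the scales are 1, 1/2, 1/3, ..., and the largest one still satisfies
  -- ε ≤ 1.
  rw [div_le_one (by positivity)]
  linarith [n.cast_nonneg (α := ℝ)]

end
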